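/- **Setting.** Let $\mathcal X$ be a measurable space, $\mathcal Y=\{-1,+1\}$, $P$ a probability measure on $\mathcal X\times\mathcal Y$, and $\mathbb F$ a set of measurable classifiers $h:\mathcal X\to\mathcal Y$. As usual, for every $k$ and $y\in\mathcal Y^k$ the event that some $h\in\mathbb F$ satisfies $h(x_i)=y_i$ for all $i\le k$ is assumed measurable (up to null sets) for $k$ independent draws $x_1,\dots,x_k$ from the marginal of $P$ on $\mathcal X$. Let $d$ be the VC dimension of $\mathbb F$ and $\mathcal S(\mathbb F,k)$ the largest number of labelings of $k$ points realized by $\mathbb F$. Put $\mathrm{er}(h)=P((x,y):h(x)\ne y)$, and let $f^*$ be any infimal hypothesis: a classifier (not necessarily in $\mathbb F$) with $\mathrm{er}(f^*)=\inf_{h\in\mathbb F}\mathrm{er}(h)$ and $\inf_{h\in\mathbb F}P((x,y):h(x)\neq f^*(x))=0$. For a sample $S$ let $\mathrm{VS}_S=\{h\in\mathbb F:\forall (x,y)\in S,\ h(x)=f^*(x)\}$, and let $\hat n(S)$ be the size of a smallest $C\subseteq S$ with $\mathrm{VS}_C=\mathrm{VS}_S$. Let $\mathcal B_{\hat n}(m,\delta)=\min\{b\in\mathbb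 N\cup\{0\}:\mathbb P(\hat n(S_m)\le b)\ge 1-\delta\}$, where $S_m$ consists of $m$ independent draws from $P$. **Algorithm (Dasgupta–Hsu–Monteleoni, with a label budget).** Inputs: $\delta$ and the budget $n$. $\mathrm{LEARN}(S,T)$ returns an $h\in\mathbb F$ consistent with $S$ that has minimal empirical error on $T$ among such hypotheses (ties broken arbitrarily), and fails if no $h\in\mathbb F$ is consistent with $S$. Start with $S=T=\emptyset$ and process i.i.d. examples $(x_1,y_1),(x_2,y_2),\dots$ with law $P$, the labels being hidden. At $x_m$ put $h_{\hat y}=\mathrm{LEARN}(S\cup\{(x_m,\hat y)\},T)$ for $\hat y=\pm1$. Let $\mathrm{err}$ denote the empirical error on $S\cup T$ and $$\Delta=\beta_{m-1}^2+\beta_{m-1}\big(\sqrt{\mathrm{err}(h_{+1})}+\sqrt{\mathrm{err}(h_{-1})}\big),\qquad \beta_k=\sqrt{\tfrac4k\ln\tfrac{8(k^2+k)\,\mathcal S(\mathbb F,2k)^2}{\delta}},\quad \beta_0=\infty .$$ If for some $\hat y$ the call for $h_{-\hat y}$ fails or $\mathrm{err}(h_{-\hat y})-\mathrm{err}(h_{\hat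 y})>\Delta$, add $(x_m,\hat y)$ to $S$; otherwise request $y_m$ and add $(x_m,y_m)$ to $T$. Stop as soon as $n$ labels have been requested or $u$ examples have been processed ($u\in\mathbb N$ is a cap that ensures termination), and output $\hat f_u=\mathrm{LEARN}(S,T)$. **Theorem.** There is a finite universal constant $c>0$ such that, for all $\mathcal X,P,\mathbb F,f^*$ as above and any $\epsilon,\delta\in(0,1/2)$, given $\delta$ and a budget $n$, the algorithm requests at most $n$ labels and outputs a classifier in $\mathbb F$, and if $d<\infty$ and $$n\ \ge\ c\Big(\max_{r>\mathrm{er}(f^*)+\epsilon}\mathcal B_{\hat n}\big(\lceil 1/r\rceil,\tfrac1{20}\big)+1\Big)\Big(\frac{\mathrm{er}(f^*)^2}{\epsilon^2}+1\Big)\Big(d\log\frac1\epsilon+\log\frac1\delta\Big)\log\frac1\epsilon ,$$ then with probability at least $1-\delta$ the classifier produced satisfies $\mathrm{er}(\hat f_u)\le \mathrm{er}(f^*)+\epsilon$, simultaneously for all caps $u\ge 2^n$. -/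

import Mathlib

open MeasureTheory Set

noncomputable section

namespace ActiveLearning

universe u

variable {X : Type u}

/-! Labels are elements of `Bool`, with `true` standing for `+1` and `false` for `-1`.
A hypothesis is a map `X → Bool`, a concept space is a set of measurable hypotheses. -/

/-- The finite set `A` is shattered by `F`. -/
def Shatters (F : Set (X → Bool)) (A : Finset X) : Prop :=
  ∀ g : X → Bool, ∃ h ∈ F, ∀ x ∈ A, h x = g x

/-- The Vapnik-Chervonenkis dimension of `F`, possibly infinite. -/
def vcDim (F : Set (X → Bool)) : ℕ∞ :=
  ⨆ A ∈ {A : Finset X | Shatters F A}, (A.card : ℕ∞)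

/-- The shatter coefficient (growth function): the largest number of distinct labelings
of `k` points of `X` that are realized by `F`. It is at most `2 ^ k`. -/
def growth (F : Set (X → Bool)) (k : ℕ) : ℕ :=
  ⨆ x : Fin k → X, ({y : Fin k → Bool | ∃ h ∈ F, ∀ i, h (x i) = y i}).ncard

/-! ### Error rates, the infimal hypothesis, the version space compression set size -/

/-- The error rate `er(h) = P((x,y) : h(x) ≠ y)`. -/
def er [MeasurableSpace X] (P : Measure (X × Bool)) (h : X → Bool) : ℝ :=
  P.real {z | h z.1 ≠ z.2}

/-- `f` is an infimal hypothesis of `F` with respect to `P`: a classifier, not necessarily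
in `F`, with `er(f) = inf_{h ∈ F} er(h)` and `inf_{h ∈ F} P((x,y) : h(x) ≠ f(x)) = 0`.
(The conditions force `F` to be nonempty.) -/
structure IsInfimal [MeasurableSpace X] (F : Set (X → Bool)) (P : Measure (X × Bool))
    (f : X → Bool) : Prop where
  measurable : Measurable f
  isGLB_er : IsGLB (er P '' F) (er P f)
  isGLB_dist : IsGLB ((fun h : X → Bool => P.real {z | h z.1 ≠ f z.1}) '' F) 0

/-- The agnostic version space `{h ∈ F : ∀ (x,y) ∈ S, h(x) = f(x)}` of a set `S` of examples. -/
def versionSpace (F : Set (X → Bool)) (f : X → Bool) (S : Set (X × Bool)) : Set (X → Bool) :=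
  {h ∈ F | ∀ z ∈ S, h z.1 = f z.1}

/-- The agnostic version space compression set size of a sample `S`: the size of a smallest
subset `C` of `S` that induces the same agnostic version space as `S`. -/
def compressionSize (F : Set (X → Bool)) (f : X → Bool) {m : ℕ} (S : Fin m → X × Bool) : ℕ :=
  sInf {k | ∃ C ⊆ range S,
    versionSpace F f C = versionSpace F f (range S) ∧ C.ncard = k}

/-- The version space compression set size minimal bound: the least `b` with
`ℙ(compression set size of S_m ≤ b) ≥ 1 - δ`, where `S_m` consists of `m` independent
examples with law `P`. -/
def compressionBound [MeasurableSpace X] (F : Set (X → Bool)) (P : Measure (X × Bool))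
    (f : X → Bool) (m : ℕ) (δ : ℝ) : ℕ :=
  sInf {b | ENNReal.ofReal (1 - δ) ≤
    Measure.pi (fun _ : Fin m => P) {S | compressionSize F f S ≤ b}}

/-- `max_{r > r₀} B(⌈1/r⌉, 1/20)`. For `r₀ > 0` only finitely many values of `⌈1/r⌉` occur. -/
def maxCompressionBound [MeasurableSpace X] (F : Set (X → Bool)) (P : Measure (X × Bool))
    (f : X → Bool) (r₀ : ℝ) : ℕ :=
  ⨆ r : Ioi r₀, compressionBound F P f ⌈1 / (r : ℝ)⌉₊ (1 / 20)

/-- The standing measurability convention on `F`, without which uniform laws over `F` make no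
sense: for every `k` and every pattern `y` of `k` labels, the event that some `h ∈ F` labels
`k` independent instances by `y` is measurable, up to null sets. -/
def TraceMeasurable [MeasurableSpace X] (F : Set (X → Bool)) (P : Measure (X × Bool)) : Prop :=
  ∀ (k : ℕ) (y : Fin k → Bool),
    NullMeasurableSet {x : Fin k → X | ∃ h ∈ F, ∀ i, h (x i) = y i}
      (Measure.pi (fun _ : Fin k => P.map Prod.fst))

/-! ### The active learning algorithm of Dasgupta, Hsu and Monteleoni -/

/-- The empirical error of `h` on a list of labeled examples (`0` on the empty list). -/
def empErr (h : X → Bool) (Z : List (X × Bool)) : ℝ :=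
  (Z.countP (fun z => h z.1 != z.2) : ℝ) / Z.length

/-- `h` is consistent with the labeled examples in `Z`. -/
def Consistent (h : X → Bool) (Z : List (X × Bool)) : Prop :=
  ∀ z ∈ Z, h z.1 = z.2

/-- `learn` is a version of the subroutine `LEARN(S, T)` with an arbitrary rule for breaking
ties: it returns a hypothesis of `F` that is consistent with `S` and has minimal empirical error
on `T` among those, and it reports failure (`none`) only if no hypothesis of `F` is consistent
with `S`. -/
def IsLearner (F : Set (X → Bool))
    (learn : List (X × Bool) → List (X × Bool) → Option (X → Bool)) : Prop :=
  ∀ S T : List (X × Bool),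
    (∀ h, learn S T = some h → h ∈ F ∧ Consistent h S ∧
      ∀ g ∈ F, Consistent g S → empErr h T ≤ empErr g T) ∧
    (learn S T = none → ∀ h ∈ F, ¬ Consistent h S)

/-- The state of the algorithm: the examples whose labels were inferred by the algorithm
(with the inferred labels) and those whose labels were requested (with the true labels). -/
structure State (X : Type u) where
  inferred : List (X × Bool)
  queried : List (X × Bool)

/-- All the examples processed so far. -/
def State.all (s : State X) : List (X × Bool) := s.inferred ++ s.queried

/-- `β_m = √((4 / m) ln(8 (m² + m) 𝒮(F, 2m)² / δ))`; equal to `0` for `m = 0`, see below. -/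
def dhmBeta (F : Set (X → Bool)) (δ : ℝ) (m : ℕ) : ℝ :=
  Real.sqrt (4 / m * Real.log (8 * ((m : ℝ) ^ 2 + m) * (growth F (2 * m) : ℝ) ^ 2 / δ))

/-- The threshold `Δ = β² + β (√err(h₁) + √err(h₂))`, with the empirical errors measured on all
the processed examples. -/
def dhmDelta (F : Set (X → Bool)) (δ : ℝ) (s : State X) (h₁ h₂ : X → Bool) : ℝ :=
  dhmBeta F δ s.all.length ^ 2 +
    dhmBeta F δ s.all.length * (Real.sqrt (empErr h₁ s.all) + Real.sqrt (empErr h₂ s.all))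

open Classical in
/-- The decision on a new unlabeled instance `x`: `some y` means that the label `y` is inferred,
`none` means that the label is to be requested. The label `y` is inferred if no hypothesis is
consistent with the inferred examples and `(x, !y)`, or if the best such hypothesis is worse by
more than `Δ` than the best one for `(x, y)`. (Before the first example both empirical errors
and `Δ` are `0`, so a comparison then never infers a label, as if `Δ` were infinite.) -/
def dhmDecide (F : Set (X → Bool))
    (learn : List (X × Bool) → List (X × Bool) → Option (X → Bool)) (δ : ℝ)
    (s : State X) (x : X) : Option Bool :=
  match learn ((x, true) :: s.inferred) s.queried,
      learn ((x, false) :: s.inferred) s.queried with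
  | _, none => some true
  | none, some _ => some false
  | some hp, some hm =>
    if empErr hm s.all - empErr hp s.all > dhmDelta F δ s hp hm then some true
    else if empErr hp s.all - empErr hm s.all > dhmDelta F δ s hp hm then some false
    else none

/-- Processing of one example `z = (x, y)` of the stream, with label budget `n`. Nothing happens
once `n` labels have been requested; the label `y` is used only if it is requested. -/
def dhmStep (F : Set (X → Bool))
    (learn : List (X × Bool) → List (X × Bool) → Option (X → Bool)) (δ : ℝ) (n : ℕ)
    (s : State X) (z : X × Bool) : State X :=
  if s.queried.length = n then s
  else match dhmDecide F learn δ s z.1 with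
    | some y => ⟨(z.1, y) :: s.inferred, s.queried⟩
    | none => ⟨s.inferred, z :: s.queried⟩

/-- The state of the algorithm with budget `n` on the stream `ω` when it stops, if it stops as
soon as it has requested `n` labels or has processed `u` examples. -/
def dhmState (F : Set (X → Bool))
    (learn : List (X × Bool) → List (X × Bool) → Option (X → Bool)) (δ : ℝ) (n : ℕ)
    (ω : ℕ → X × Bool) : ℕ → State X
  | 0 => ⟨[], []⟩
  | u + 1 => dhmStep F learn δ n (dhmState F learn δ n ω u) (ω u)

/-- The number of labels requested by the algorithm. -/
def dhmRequests (F : Set (X → Bool))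
    (learn : List (X × Bool) → List (X × Bool) → Option (X → Bool)) (δ : ℝ) (n u : ℕ)
    (ω : ℕ → X × Bool) : ℕ :=
  (dhmState F learn δ n ω u).queried.length

/-- The classifier produced by the algorithm. -/
def dhmOutput (F : Set (X → Bool))
    (learn : List (X × Bool) → List (X × Bool) → Option (X → Bool)) (δ : ℝ) (n u : ℕ)
    (ω : ℕ → X × Bool) : Option (X → Bool) :=
  learn (dhmState F learn δ n ω u).inferred (dhmState F learn δ n ω u).queried

end ActiveLearning

end

open ActiveLearning

noncomputable section

namespace ActiveLearning

universe u

variable {X : Type u}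

/-! Write ν for the error of f*, L for d log(1/ε) + log(1/δ), and β for `dhmBeta`. The proof studies
the run deterministically on outcomes that satisfy uniform relative deviation bounds (`Favourable`),
and bounds separately the probability of leaving them and the number of requests.

On a favourable outcome every inferred label is that of f*, although it may differ from the true
one. This does no harm: two hypotheses consistent with the inferred examples agree there, so the
difference of their empirical errors is the one on the true sample (`Faithful.empErr_sub`). Since f*
need not lie in F, it is replaced by members of F that agree with it on the sample, which exist
almost surely (`ae_exists_approx`). Comparison with them shows that an inference against f* would
violate the deviation bounds (`Favourable.decide_eq`), that a request at x needs a hypothesis within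
10ν + 2ε + 12β² of f* that disagrees with f* at x (`Favourable.decide_none`), and that the output
has excess error at most β² + 2β√(2ν + β²) (`Favourable.er_le`). The latter is below ε after W =
4096 L(ν + ε)/ε² examples.

It remains to see that the budget survives the first ⌈W⌉ examples. A request at time m falls in a
non-random set containing all disagreements with f* in a ball of radius r, and this set has measure
O((B + 1) r), with B the maximal compression bound (`exists_disagreement_set_le`). Indeed, among
about 1/(4r) exchangeable draws, a block of a fraction 1/(10(B + 1)) of them avoids, with constant
probability, the disagreement region left by the others; yet a hypothesis in the ball agrees with f*
on those others with probability at least 3/4, so each point of the set usually belongs to that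
region. As these sets are fixed in advance, the number of requests is at most a sum of independent
indicators, and `chernoff_count` applies. Summing the radii, the terms in ν + ε contribute (ν²/ε² +
1) L and the terms β², of order L/m, a harmonic sum of order L log(1/ε).

The deviation bounds come from symmetrization with a ghost sample, applied to the events that h errs
and h' does not; on 2m points these have at most the square of the growth function many traces,
which is what β accounts for. -/

/-! ### Product measures and null measurability of trace events. -/

/-- This is exchangeability together with restriction: it serves to pass from the stream to its
first draws, to swap a sample with its ghost, and to shift a sample cyclically. -/
theorem measurePreserving_comp_injective {Z ι κ : Type*} [MeasurableSpace Z] [Fintype κ]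
    (P : Measure Z) [IsProbabilityMeasure P] {e : κ → ι} (he : Function.Injective e) :
    MeasurePreserving (fun (ω : ι → Z) k => ω (e k))
      (Measure.infinitePi fun _ : ι => P) (Measure.pi fun _ : κ => P) := by
  classical
  have hm : Measurable (fun (ω : ι → Z) k => ω (e k)) := by fun_prop
  refine ⟨hm, ?_⟩
  symm
  apply Measure.pi_eq
  intro s hs
  rw [Measure.map_apply hm (MeasurableSet.univ_pi hs)]
  have h1 : (fun (ω : ι → Z) k => ω (e k)) ⁻¹' (Set.pi univ s) =
      Set.pi (Finset.univ.image e : Finset ι)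
        (fun i => if h : ∃ k, e k = i then s h.choose else univ) := by
    have key : ∀ k, (if h : ∃ k', e k' = e k then s h.choose else univ) = s k := by
      intro k
      have h : ∃ k', e k' = e k := ⟨k, rfl⟩
      rw [dif_pos h, he h.choose_spec]
    ext ω
    simp only [mem_preimage, mem_pi, mem_univ, true_imp_iff, Finset.coe_image, Finset.coe_univ,
      image_univ, mem_range, forall_exists_index, forall_apply_eq_imp_iff, key]
  rw [h1, Measure.infinitePi_pi]
  · rw [Finset.prod_image (fun a _ b _ h => he h)]
    refine Finset.prod_congr rfl fun k _ => ?_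
    have h : ∃ k', e k' = e k := ⟨k, rfl⟩
    rw [dif_pos h, he h.choose_spec]
  · intro i _
    split_ifs with h
    · exact hs _
    · exact MeasurableSet.univ

theorem measurePreserving_pi_comp_injective {Z ι κ : Type*} [MeasurableSpace Z] [Fintype ι]
    [Fintype κ] (P : Measure Z) [IsProbabilityMeasure P] {e : κ → ι}
    (he : Function.Injective e) :
    MeasurePreserving (fun (ω : ι → Z) k => ω (e k))
      (Measure.pi fun _ : ι => P) (Measure.pi fun _ : κ => P) := by
  rw [← Measure.infinitePi_eq_pi (μ := fun _ : ι => P)]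
  exact measurePreserving_comp_injective P he

/-- Fubini for a null measurable event on two independent blocks of draws. -/
theorem pi_sum_apply {Z α β : Type*} [MeasurableSpace Z] [Fintype α] [Fintype β]
    (P : Measure Z) [IsProbabilityMeasure P] {E : Set (α ⊕ β → Z)}
    (hE : NullMeasurableSet E (Measure.pi fun _ => P)) :
    AEMeasurable (fun s : α → Z => (Measure.pi fun _ : β => P) {t | Sum.elim s t ∈ E})
        (Measure.pi fun _ => P) ∧
      (Measure.pi fun _ => P) E =
        ∫⁻ s, (Measure.pi fun _ : β => P) {t | Sum.elim s t ∈ E}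
          ∂(Measure.pi fun _ : α => P) := by
  have hmp := measurePreserving_sumPiEquivProdPi_symm (fun _ : α ⊕ β => P)
  set G : (α → Z) × (β → Z) → (α ⊕ β → Z) := fun p => Sum.elim p.1 p.2 with hG
  have hGe : ⇑(MeasurableEquiv.sumPiEquivProdPi (fun _ : α ⊕ β => Z)).symm = G := by
    funext p i
    cases i <;> rfl
  rw [hGe] at hmp
  have hE' : NullMeasurableSet (G ⁻¹' E)
      ((Measure.pi fun _ : α => P).prod (Measure.pi fun _ : β => P)) :=
    hE.preimage hmp.quasiMeasurePreserving
  obtain ⟨E₁, -, hE₁, hEE⟩ := hE'.exists_measurable_superset_ae_eq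
  have hae : ∀ᵐ s ∂(Measure.pi fun _ : α => P),
      (Measure.pi fun _ : β => P) (Prod.mk s ⁻¹' E₁) =
        (Measure.pi fun _ : β => P) {t | Sum.elim s t ∈ E} := by
    filter_upwards [Measure.ae_ae_of_ae_prod hEE] with s hs
    exact measure_congr hs
  constructor
  · exact (measurable_measure_prodMk_left hE₁).aemeasurable.congr hae
  · rw [← hmp.measure_preimage hE, ← measure_congr hEE, Measure.prod_apply hE₁]
    exact lintegral_congr_ae hae

theorem nullMeasurableSet_trace [MeasurableSpace X] {F : Set (X → Bool)}
    {P : Measure (X × Bool)} [IsProbabilityMeasure P] (hT : TraceMeasurable F P)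
    {ι : Type*} [Fintype ι] (y : ι → Bool) :
    NullMeasurableSet {z : ι → X × Bool | ∃ h ∈ F, ∀ i, h (z i).1 = y i}
      (Measure.pi fun _ => P) := by
  have e := (Fintype.equivFin ι).symm
  have : IsProbabilityMeasure (P.map Prod.fst) :=
    Measure.isProbabilityMeasure_map measurable_fst.aemeasurable
  have h1 := measurePreserving_pi_comp_injective P (e := e) e.injective
  have h2 := measurePreserving_pi (fun _ : Fin (Fintype.card ι) => P)
    (fun _ => P.map Prod.fst) (f := fun _ => Prod.fst)
    (fun _ => measurable_fst.measurePreserving P)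
  have h3 := (hT (Fintype.card ι) (fun i => y (e i))).preimage (h2.comp h1).quasiMeasurePreserving
  convert h3 using 1
  ext z
  simp only [mem_ofPred_eq, mem_preimage, Function.comp]
  refine exists_congr fun h => and_congr_right fun _ => ?_
  exact ⟨fun H i => H _, fun H i => by simpa using H (e.symm i)⟩

/-- The event depends on h only through finitely many labels, so it is a finite union over label
patterns of trace events cut by measurable sets. -/
theorem nullMeasurableSet_trace_of [MeasurableSpace X] {F : Set (X → Bool)}
    {P : Measure (X × Bool)} [IsProbabilityMeasure P] (hT : TraceMeasurable F P)
    {ι : Type*} [Fintype ι] (W : (ι → Bool) → Set (ι → X × Bool))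
    (hW : ∀ y, MeasurableSet (W y)) :
    NullMeasurableSet {z : ι → X × Bool | ∃ h ∈ F, z ∈ W (fun i => h (z i).1)}
      (Measure.pi fun _ => P) := by
  have : {z : ι → X × Bool | ∃ h ∈ F, z ∈ W (fun i => h (z i).1)} =
      ⋃ y : ι → Bool, {z : ι → X × Bool | ∃ h ∈ F, ∀ i, h (z i).1 = y i} ∩ W y := by
    ext z
    simp only [mem_ofPred_eq, mem_iUnion, mem_inter_iff]
    constructor
    · rintro ⟨h, hF, hz⟩
      exact ⟨_, ⟨h, hF, fun _ => rfl⟩, hz⟩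
    · rintro ⟨y, ⟨h, hF, hy⟩, hz⟩
      obtain rfl : (fun i => h (z i).1) = y := funext hy
      exact ⟨h, hF, hz⟩
  rw [this]
  exact NullMeasurableSet.iUnion fun y =>
    (nullMeasurableSet_trace hT y).inter (hW y).nullMeasurableSet

/-! ### Moments and tail bounds for sums of independent indicators. -/

theorem integrable_of_abs_le {Ω : Type*} [MeasurableSpace Ω] {μ : Measure Ω}
    [IsFiniteMeasure μ] {Y : Ω → ℝ} (hY : Measurable Y) {B : ℝ} (hB : ∀ x, |Y x| ≤ B) :
    Integrable Y μ :=
  Integrable.of_bound hY.aestronglyMeasurable B (Filter.Eventually.of_forall hB)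

/-- A centered bounded variable with the fourth moment of a sum of independent indicators is
at most `1` with probability bounded below. -/
theorem prob_le_one_of_moments {Ω : Type*} [MeasurableSpace Ω] {μ : Measure Ω}
    [IsProbabilityMeasure μ] {Y : Ω → ℝ} (hY : Measurable Y) {B : ℝ} (hB : ∀ x, |Y x| ≤ B)
    {v : ℝ} (h1 : ∫ x, Y x ∂μ = 0) (h2 : ∫ x, Y x ^ 2 ∂μ = v)
    (h4 : ∫ x, Y x ^ 4 ∂μ ≤ 3 * v ^ 2 + v) :
    1 / 9 ≤ μ.real {x | Y x ≤ 1} := by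
  have hv : 0 ≤ v := h2 ▸ integral_nonneg fun x => sq_nonneg _
  have hpow : ∀ k : ℕ, Integrable (fun x => Y x ^ k) μ := fun k =>
    integrable_of_abs_le (B := B ^ k) (hY.pow_const k) fun x => by
      rw [abs_pow]; exact pow_le_pow_left₀ (abs_nonneg _) (hB x) k
  have hI1 : Integrable Y μ := by simpa using hpow 1
  have hms : MeasurableSet {x | Y x ≤ 1} := measurableSet_le hY measurable_const
  have hind : ∫ x, ({x | Y x ≤ 1}.indicator (fun _ => (1 : ℝ)) x) ∂μ = μ.real {x | Y x ≤ 1} := by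
    simpa using integral_indicator_const (μ := μ) (1 : ℝ) hms
  have hIind : Integrable ({x | Y x ≤ 1}.indicator (fun _ => (1 : ℝ))) μ :=
    (integrable_const _).indicator hms
  by_cases hv1 : v < 1
  -- Cantelli's inequality: a quadratic minorant of the indicator that touches it at `-v` and
  -- vanishes at `1`.
  · have hp : ∀ x, 1 - (1 / (1 + v) ^ 2) * (Y x ^ 2 + 2 * v * Y x + v ^ 2) ≤
        {x | Y x ≤ 1}.indicator (fun _ => (1 : ℝ)) x := by
      intro x
      by_cases hx : Y x ≤ 1
      · rw [indicator_of_mem (by exact hx)]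
        have : 0 ≤ (1 / (1 + v) ^ 2) * (Y x + v) ^ 2 := by positivity
        nlinarith
      · rw [indicator_of_notMem (by exact hx)]
        push Not at hx
        have : (1 + v) ^ 2 ≤ (Y x + v) ^ 2 := by gcongr
        have h3 : 1 ≤ (1 / (1 + v) ^ 2) * (Y x + v) ^ 2 := by
          rw [one_div, ← div_eq_inv_mul, le_div_iff₀ (by positivity)]; linarith
        nlinarith
    have hint := integral_mono (μ := μ) (by fun_prop) hIind hp
    rw [hind] at hint
    have hcalc : ∫ x, (1 - (1 / (1 + v) ^ 2) * (Y x ^ 2 + 2 * v * Y x + v ^ 2)) ∂μ =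
        1 - (1 / (1 + v) ^ 2) * (v + v ^ 2) := by
      rw [integral_sub (by fun_prop) (by fun_prop), integral_const_mul,
        integral_add (by fun_prop) (by fun_prop), integral_add (by fun_prop) (by fun_prop),
        integral_const_mul, h1, h2]
      simp
    rw [hcalc] at hint
    have : 1 - (1 / (1 + v) ^ 2) * (v + v ^ 2) = 1 / (1 + v) := by
      field_simp; ring
    rw [this] at hint
    have : (1 : ℝ) / 9 ≤ 1 / (1 + v) := by
      apply one_div_le_one_div_of_le <;> linarith
    linarith
  · push Not at hv1
    -- The quartic used below is -Y(Y - κ)²(Y + 2κ), which is nonpositive for Y ≥ 0 and never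
    -- exceeds 5κ⁴. Its mean is at least 3κ²v - 4v², and κ² = 8v/3 maximizes the ratio to 5κ⁴; the
    -- result is 9/80, just above 1/9.
    set κ := Real.sqrt (8 * v / 3) with hκ
    have hκ2 : κ ^ 2 = 8 * v / 3 := Real.sq_sqrt (by positivity)
    have hκ0 : 0 ≤ κ := Real.sqrt_nonneg _
    have hp : ∀ x, 3 * κ ^ 2 * Y x ^ 2 - Y x ^ 4 - 2 * κ ^ 3 * Y x ≤
        5 * κ ^ 4 * {x | Y x ≤ 1}.indicator (fun _ => (1 : ℝ)) x := by
      intro x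
      by_cases hx : Y x ≤ 1
      · rw [indicator_of_mem (by exact hx)]
        have h := add_nonneg (sq_nonneg (Y x ^ 2 - 2 * κ ^ 2)) (sq_nonneg (κ * (Y x + κ)))
        nlinarith
      · rw [indicator_of_notMem (by exact hx)]
        push Not at hx
        have h : 0 ≤ Y x * ((Y x - κ) ^ 2 * (Y x + 2 * κ)) := by
          have : 0 ≤ Y x := by linarith
          positivity
        nlinarith
    have hint := integral_mono (μ := μ) (by fun_prop) (hIind.const_mul _) hp
    rw [integral_const_mul, hind] at hint
    have hcalc : ∫ x, (3 * κ ^ 2 * Y x ^ 2 - Y x ^ 4 - 2 * κ ^ 3 * Y x) ∂μ =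
        3 * κ ^ 2 * v - ∫ x, Y x ^ 4 ∂μ := by
      rw [integral_sub (by fun_prop) (by fun_prop), integral_sub (by fun_prop) (by fun_prop),
        integral_const_mul, integral_const_mul, h1, h2]
      simp
    rw [hcalc] at hint
    have e4 : κ ^ 4 = (8 * v / 3) ^ 2 := by rw [← hκ2]; ring
    rw [hκ2, e4] at hint
    have h6 : 4 * v ^ 2 ≤ 5 * (8 * v / 3) ^ 2 * μ.real {x | Y x ≤ 1} := by nlinarith
    have h7 : 0 < v ^ 2 := by positivity
    by_contra hcon
    push Not at hcon
    nlinarith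

/-- First, second and fourth moments of sums of independent centered variables. -/
theorem moments_sum_pi {Z : Type*} [MeasurableSpace Z] (P : Measure Z) [IsProbabilityMeasure P]
    {φ : Z → ℝ} (hφ : Measurable φ) (hb : ∀ z, |φ z| ≤ 1) (h0 : ∫ z, φ z ∂P = 0) (n : ℕ) :
    (∫ z, (∑ i, φ (z i)) ∂(Measure.pi fun _ : Fin n => P)) = 0 ∧
    (∫ z, (∑ i, φ (z i)) ^ 2 ∂(Measure.pi fun _ : Fin n => P)) = n * ∫ z, φ z ^ 2 ∂P ∧
    (∫ z, (∑ i, φ (z i)) ^ 4 ∂(Measure.pi fun _ : Fin n => P)) ≤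
      3 * (n * ∫ z, φ z ^ 2 ∂P) ^ 2 + n * ∫ z, φ z ^ 2 ∂P := by
  induction n with
  | zero => simp
  | succ n ih =>
    obtain ⟨ih1, ih2, ih4⟩ := ih
    set w := ∫ z, φ z ^ 2 ∂P with hw
    set μ := (Measure.pi fun _ : Fin n => P) with hμ
    set S : (Fin n → Z) → ℝ := fun z => ∑ i, φ (z i) with hS
    have hSm : Measurable S := by fun_prop
    have hSb : ∀ z, |S z| ≤ n := fun z => by
      refine (Finset.abs_sum_le_sum_abs _ _).trans ?_
      refine (Finset.sum_le_sum fun i _ => hb (z i)).trans ?_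
      simp
    have hSp : ∀ k : ℕ, Integrable (fun z => S z ^ k) μ := fun k =>
      integrable_of_abs_le (B := (n : ℝ) ^ k) (hSm.pow_const k) fun x => by
        rw [abs_pow]; exact pow_le_pow_left₀ (abs_nonneg _) (hSb x) k
    have hφp : ∀ k : ℕ, Integrable (fun z => φ z ^ k) P := fun k =>
      integrable_of_abs_le (B := 1) (hφ.pow_const k) fun x => by
        rw [abs_pow]; exact pow_le_one₀ (abs_nonneg _) (hb x)
    have hmix : ∀ j k : ℕ, Integrable (fun p : Z × (Fin n → Z) => φ p.1 ^ j * S p.2 ^ k)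
        (P.prod μ) := fun j k => (hφp j).mul_prod (hSp k)
    have hprod : ∀ j k : ℕ, ∫ p : Z × (Fin n → Z), φ p.1 ^ j * S p.2 ^ k ∂(P.prod μ) =
        (∫ z, φ z ^ j ∂P) * ∫ s, S s ^ k ∂μ := fun j k =>
      integral_prod_mul (μ := P) (ν := μ) (fun z => φ z ^ j) (fun s => S s ^ k)
    have htr : ∀ k : ℕ, (∫ z, (∑ i, φ (z i)) ^ k ∂(Measure.pi fun _ : Fin (n + 1) => P)) =
        ∫ p : Z × (Fin n → Z), (φ p.1 + S p.2) ^ k ∂(P.prod μ) := by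
      intro k
      have hmp := measurePreserving_piFinSuccAbove (fun _ : Fin (n + 1) => P) 0
      rw [← hmp.integral_comp']
      refine integral_congr_ae (Filter.Eventually.of_forall fun z => ?_)
      simp [hS, Fin.sum_univ_succ, MeasurableEquiv.piFinSuccAbove, Fin.tail]
    have e1 : ∫ s, S s ^ 1 ∂μ = 0 := by simpa using ih1
    have e1' : ∫ z, φ z ^ 1 ∂P = 0 := by simpa using h0
    have hφ4 : ∫ z, φ z ^ 4 ∂P ≤ w := by
      refine integral_mono (hφp 4) (hφp 2) fun z => ?_
      have : φ z ^ 2 ≤ 1 := by rw [← sq_abs]; exact pow_le_one₀ (abs_nonneg _) (hb z)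
      nlinarith [sq_nonneg (φ z)]
    have hw0 : 0 ≤ w := integral_nonneg fun z => sq_nonneg _
    refine ⟨?_, ?_, ?_⟩
    · have := htr 1
      simp only [pow_one] at this
      rw [this]
      have : ∀ p : Z × (Fin n → Z), φ p.1 + S p.2 =
          φ p.1 ^ 1 * S p.2 ^ 0 + φ p.1 ^ 0 * S p.2 ^ 1 := fun p => by ring
      simp_rw [this]
      rw [integral_add (hmix _ _) (hmix _ _), hprod, hprod, e1, e1']
      simp
    · rw [htr 2]
      have : ∀ p : Z × (Fin n → Z), (φ p.1 + S p.2) ^ 2 =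
          φ p.1 ^ 2 * S p.2 ^ 0 + 2 * (φ p.1 ^ 1 * S p.2 ^ 1) + φ p.1 ^ 0 * S p.2 ^ 2 :=
        fun p => by ring
      simp_rw [this]
      have i12 : Integrable (fun p : Z × (Fin n → Z) =>
          φ p.1 ^ 2 * S p.2 ^ 0 + 2 * (φ p.1 ^ 1 * S p.2 ^ 1)) (P.prod μ) :=
        (hmix _ _).add ((hmix _ _).const_mul _)
      rw [integral_add i12 (hmix _ _), integral_add (hmix _ _) ((hmix _ _).const_mul _),
        integral_const_mul, hprod, hprod,
        hprod, e1, e1', ih2]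
      simp
      ring
    · rw [htr 4]
      have : ∀ p : Z × (Fin n → Z), (φ p.1 + S p.2) ^ 4 =
          φ p.1 ^ 4 * S p.2 ^ 0 + 4 * (φ p.1 ^ 3 * S p.2 ^ 1) + 6 * (φ p.1 ^ 2 * S p.2 ^ 2) +
            4 * (φ p.1 ^ 1 * S p.2 ^ 3) + φ p.1 ^ 0 * S p.2 ^ 4 :=
        fun p => by ring
      simp_rw [this]
      have i1 := hmix 4 0
      have i2 := (hmix 3 1).const_mul 4
      have i3 := (hmix 2 2).const_mul 6
      have i4 := (hmix 1 3).const_mul 4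
      have i5 := hmix 0 4
      have i12 : Integrable (fun p : Z × (Fin n → Z) =>
          φ p.1 ^ 4 * S p.2 ^ 0 + 4 * (φ p.1 ^ 3 * S p.2 ^ 1)) (P.prod μ) := i1.add i2
      have i13 : Integrable (fun p : Z × (Fin n → Z) =>
          φ p.1 ^ 4 * S p.2 ^ 0 + 4 * (φ p.1 ^ 3 * S p.2 ^ 1) + 6 * (φ p.1 ^ 2 * S p.2 ^ 2))
          (P.prod μ) := i12.add i3
      have i14 : Integrable (fun p : Z × (Fin n → Z) =>
          φ p.1 ^ 4 * S p.2 ^ 0 + 4 * (φ p.1 ^ 3 * S p.2 ^ 1) + 6 * (φ p.1 ^ 2 * S p.2 ^ 2) +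
            4 * (φ p.1 ^ 1 * S p.2 ^ 3)) (P.prod μ) := i13.add i4
      rw [integral_add i14 i5, integral_add i13 i4, integral_add i12 i3, integral_add i1 i2,
        integral_const_mul, integral_const_mul,
        integral_const_mul, hprod, hprod, hprod, hprod, hprod, e1, e1', ih2]
      simp only [pow_zero, integral_const, probReal_univ, smul_eq_mul, mul_one, mul_zero,
        add_zero, zero_mul, one_mul, Nat.cast_add, Nat.cast_one]
      nlinarith [mul_nonneg hw0 hw0]

/-- The number of draws that fall in `A`. -/
def hits {Z ι : Type*} [Fintype ι] (g : Z → Bool) (z : ι → Z) : ℕ :=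
  ∑ i, (g (z i)).toNat

theorem cast_toNat_eq_indicator {Z : Type*} (g : Z → Bool) (z : Z) :
    ((g z).toNat : ℝ) = {z | g z = true}.indicator (fun _ => (1 : ℝ)) z := by
  cases h : g z <;> simp [h]

theorem moments_hits {Z : Type*} [MeasurableSpace Z] (P : Measure Z) [IsProbabilityMeasure P]
    {g : Z → Bool} (hg : Measurable g) (n : ℕ) :
    1 / 9 ≤ (Measure.pi fun _ : Fin n => P).real
        {z | (hits g z : ℝ) ≤ n * P.real {z | g z = true} + 1} ∧
    1 / 9 ≤ (Measure.pi fun _ : Fin n => P).real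
        {z | n * P.real {z | g z = true} - 1 ≤ (hits g z : ℝ)} := by
  set p := P.real {z | g z = true} with hp
  have hA : MeasurableSet {z | g z = true} := hg (measurableSet_singleton true)
  have hp1 : p ≤ 1 := measureReal_le_one
  have hp0 : 0 ≤ p := measureReal_nonneg
  set φ : Z → ℝ := fun z => ((g z).toNat : ℝ) - p with hφd
  have hmt : Measurable fun z => ((g z).toNat : ℝ) := by
    simp_rw [cast_toNat_eq_indicator]
    exact measurable_const.indicator hA
  have hφ : Measurable φ := hmt.sub_const _
  have hb : ∀ z, |φ z| ≤ 1 := fun z => by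
    simp only [hφd]; cases g z <;> simp [abs_le] <;> constructor <;> linarith
  have h0 : ∫ z, φ z ∂P = 0 := by
    simp only [hφd, cast_toNat_eq_indicator]
    rw [integral_sub ((integrable_const _).indicator hA) (integrable_const _),
      integral_indicator_const _ hA]
    simp [hp]
  have hsum : ∀ z : Fin n → Z, ∑ i, φ (z i) = hits g z - n * p := fun z => by
    simp [hφd, hits, Finset.sum_sub_distrib]
  obtain ⟨m1, m2, m4⟩ := moments_sum_pi P hφ hb h0 n
  have hSb : ∀ z : Fin n → Z, |∑ i, φ (z i)| ≤ n := fun z => by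
    refine (Finset.abs_sum_le_sum_abs _ _).trans ?_
    refine (Finset.sum_le_sum fun i _ => hb (z i)).trans ?_
    simp
  constructor
  · have := prob_le_one_of_moments (by fun_prop) hSb m1 m2 m4
    convert this using 4
    rw [hsum]
    constructor <;> intro h <;> linarith
  · have := prob_le_one_of_moments (Y := fun z : Fin n → Z => -∑ i, φ (z i)) (by fun_prop)
      (B := n) (fun z => by simpa using hSb z) (by rw [integral_neg, m1, neg_zero])
      (by simpa using m2) (by simpa [Even.neg_pow (by decide : Even 4)] using m4)
    convert this using 4
    rw [hsum]
    constructor <;> intro h <;> linarith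

/-- Chernoff's bound for independent indicators. -/
theorem chernoff_count {Z : Type*} [MeasurableSpace Z] (P : Measure Z) [IsProbabilityMeasure P]
    {g : ℕ → Z → Bool} (hg : ∀ i, Measurable (g i)) (M : ℕ) (t : ℝ) :
    (Measure.infinitePi fun _ : ℕ => P)
      {ω | t ≤ ∑ i ∈ Finset.range M, ((g i (ω i)).toNat : ℝ)} ≤
      ENNReal.ofReal (Real.exp
        (-t + (Real.exp 1 - 1) * ∑ i ∈ Finset.range M, P.real {z | g i z = true})) := by
  have hmt : ∀ i, Measurable fun z => ((g i z).toNat : ℝ) := fun i => by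
    simp_rw [cast_toNat_eq_indicator]
    exact measurable_const.indicator (hg i (measurableSet_singleton true))
  have hmp := measurePreserving_comp_injective P (e := fun i : Fin M => (i : ℕ))
    Fin.val_injective
  set μ := Measure.pi fun _ : Fin M => P
  have hms : MeasurableSet {z : Fin M → Z | t ≤ ∑ i : Fin M, ((g i (z i)).toNat : ℝ)} := by
    refine measurableSet_le measurable_const (Finset.measurable_sum _ fun i _ => ?_)
    exact (hmt i).comp (measurable_pi_apply i)
  have h1 : (Measure.infinitePi fun _ : ℕ => P)
      {ω | t ≤ ∑ i ∈ Finset.range M, ((g i (ω i)).toNat : ℝ)} =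
      μ {z : Fin M → Z | t ≤ ∑ i : Fin M, ((g i (z i)).toNat : ℝ)} := by
    rw [← hmp.measure_preimage hms.nullMeasurableSet]
    congr 1
    ext ω
    simp [Finset.sum_range]
  rw [h1]
  set f : Fin M → Z → ℝ := fun i z => Real.exp ((g i z).toNat : ℝ) with hf
  have hfm : ∀ i, Measurable (f i) := fun i => (hmt i).exp
  have hE : ∀ i, ∫ z, f i z ∂P = 1 + (Real.exp 1 - 1) * P.real {z | g i z = true} := by
    intro i
    have hA : MeasurableSet {z | g i z = true} := hg i (measurableSet_singleton true)
    have : ∀ z, f i z = 1 + (Real.exp 1 - 1) *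
        {z | g i z = true}.indicator (fun _ => (1 : ℝ)) z := by
      intro z
      simp only [hf]
      cases h : g i z <;> simp [h]
    simp_rw [this]
    rw [integral_add (integrable_const _) (((integrable_const _).indicator hA).const_mul _),
      integral_const_mul, integral_indicator_const _ hA]
    simp
  have hprod := integral_fintype_prod_eq_prod (μ := fun _ : Fin M => P) (𝕜 := ℝ) f
  have hint : Integrable (fun z : Fin M → Z => ∏ i, f i (z i)) μ := by
    refine Integrable.fintype_prod fun i => ?_
    refine integrable_of_abs_le (hfm i) (B := Real.exp 1) fun z => ?_
    rw [abs_of_pos (Real.exp_pos _)]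
    refine Real.exp_le_exp.2 ?_
    exact_mod_cast Bool.toNat_le _
  have hmar := mul_meas_ge_le_integral_of_nonneg (μ := μ)
    (f := fun z : Fin M → Z => ∏ i, f i (z i))
    (Filter.Eventually.of_forall fun z => Finset.prod_nonneg fun i _ => (Real.exp_pos _).le)
    hint (Real.exp t)
  have hset : {z : Fin M → Z | t ≤ ∑ i : Fin M, ((g i (z i)).toNat : ℝ)} =
      {z | Real.exp t ≤ ∏ i, f i (z i)} := by
    ext z
    simp only [hf, mem_ofPred_eq, ← Real.exp_sum, Real.exp_le_exp]
  rw [hset, ← ofReal_measureReal]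
  apply ENNReal.ofReal_le_ofReal
  rw [hprod] at hmar
  have hb : ∏ i, ∫ z, f i z ∂P ≤
      Real.exp ((Real.exp 1 - 1) * ∑ i ∈ Finset.range M, P.real {z | g i z = true}) := by
    rw [Finset.mul_sum, Finset.sum_range, Real.exp_sum]
    refine Finset.prod_le_prod (fun i _ => integral_nonneg fun z => (Real.exp_pos _).le) ?_
    intro i _
    rw [hE, add_comm]
    exact Real.add_one_le_exp _
  rw [Real.exp_add, Real.exp_neg, ← div_eq_inv_mul, le_div_iff₀ (Real.exp_pos t), mul_comm]
  exact hmar.trans hb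

/-! ### Symmetrization and uniform relative deviation bounds. -/

/-- Hoeffding's bound for Rademacher sums, as a count of sign patterns. -/
theorem card_rademacher_le {m : ℕ} (w : Fin m → ℝ) {s τ : ℝ} (hs : 0 < s) (hτ : 0 ≤ τ)
    (hw : ∑ i, w i ^ 2 ≤ s) :
    ((Finset.univ.filter fun σ : Fin m → Bool =>
      τ ≤ ∑ i, (if σ i then w i else -w i)).card : ℝ) ≤ 2 ^ m * Real.exp (-τ ^ 2 / (2 * s)) := by
  -- The parameter that optimizes the exponential Markov bound.
  set l := τ / s with hl
  have hl0 : 0 ≤ l := by positivity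
  have h1 : ((Finset.univ.filter fun σ : Fin m → Bool =>
      τ ≤ ∑ i, (if σ i then w i else -w i)).card : ℝ) * Real.exp (l * τ) ≤
      ∑ σ : Fin m → Bool, Real.exp (l * ∑ i, (if σ i then w i else -w i)) := by
    rw [← nsmul_eq_mul, ← Finset.sum_const]
    refine (Finset.sum_le_sum fun σ hσ => ?_).trans
      (Finset.sum_le_sum_of_subset_of_nonneg (Finset.filter_subset _ _)
        fun _ _ _ => (Real.exp_pos _).le)
    exact Real.exp_le_exp.2 (mul_le_mul_of_nonneg_left (Finset.mem_filter.1 hσ).2 hl0)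
  have h2 : ∑ σ : Fin m → Bool, Real.exp (l * ∑ i, (if σ i then w i else -w i)) =
      ∏ i, (2 * Real.cosh (l * w i)) := by
    have : ∀ i, 2 * Real.cosh (l * w i) =
        ∑ b : Bool, Real.exp (l * (if b then w i else -w i)) := by
      intro i
      rw [Real.cosh_eq]
      simp
      ring
    simp_rw [this]
    rw [Finset.prod_univ_sum]
    simp only [Fintype.piFinset_univ]
    refine Finset.sum_congr rfl fun σ _ => ?_
    rw [Finset.mul_sum, Real.exp_sum]
  have h3 : ∏ i, (2 * Real.cosh (l * w i)) ≤ 2 ^ m * Real.exp (l ^ 2 * s / 2) := by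
    rw [Finset.prod_mul_distrib]
    simp only [Finset.prod_const, Finset.card_univ, Fintype.card_fin]
    refine mul_le_mul_of_nonneg_left ?_ (by positivity)
    calc ∏ i, Real.cosh (l * w i) ≤ ∏ i, Real.exp ((l * w i) ^ 2 / 2) :=
          Finset.prod_le_prod (fun i _ => (Real.cosh_pos _).le)
            fun i _ => Real.cosh_le_exp_half_sq _
      _ = Real.exp (l ^ 2 * (∑ i, w i ^ 2) / 2) := by
          rw [← Real.exp_sum, Finset.mul_sum, Finset.sum_div]
          congr 1
          exact Finset.sum_congr rfl fun i _ => by ring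
      _ ≤ Real.exp (l ^ 2 * s / 2) := by gcongr
  have h4 := (h1.trans_eq h2).trans h3
  rw [← le_div_iff₀ (Real.exp_pos _), mul_div_assoc, ← Real.exp_sub] at h4
  have h5 : l ^ 2 * s / 2 - l * τ = -τ ^ 2 / (2 * s) := by
    rw [hl]
    field_simp
    ring
  rwa [h5] at h4

/-- Exchange of the `i`-th draw of a sample with that of the ghost sample, where `σ i = false`. -/
def swapBlocks {m : ℕ} (σ : Fin m → Bool) : Fin m ⊕ Fin m → Fin m ⊕ Fin m
  | Sum.inl i => if σ i then Sum.inl i else Sum.inr i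
  | Sum.inr i => if σ i then Sum.inr i else Sum.inl i

theorem swapBlocks_involutive {m : ℕ} (σ : Fin m → Bool) :
    Function.Involutive (swapBlocks σ) := by
  rintro (i | i) <;> cases h : σ i <;> simp [swapBlocks, h]

/-- The patterns of `0`s and `1`s on a sample and its ghost for which the counts differ by much
in the direction `κ`. -/
def deviant (m : ℕ) (A κ : ℝ) : Set (Fin m ⊕ Fin m → Bool) :=
  {y | A - 1 ≤ ∑ i, ((y i).toNat : ℝ) ∧
    Real.sqrt (A * (∑ i, ((y i).toNat : ℝ)) / 2) - 1 ≤
      κ * ((∑ i, ((y (Sum.inl i)).toNat : ℝ)) - ∑ i, ((y (Sum.inr i)).toNat : ℝ))}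

open Classical in
-- Swaps preserve the total count s and turn the difference of the two counts into a Rademacher sum
-- whose squared weights add up to at most s. Hoeffding at level √(As/2) - 1 gives the exponent
-- -A/4, and the subtracted 1 costs the term 3/4.
theorem card_swapBlocks_deviant_le {m : ℕ} {A κ : ℝ} (hA : 9 ≤ A) (hκ : κ ^ 2 = 1)
    (y : Fin m ⊕ Fin m → Bool) :
    ((Finset.univ.filter fun σ : Fin m → Bool => ∃ y' ∈ deviant m A κ,
      y' = y ∘ swapBlocks σ).card : ℝ) ≤ 2 ^ m * Real.exp (-A / 4 + 3 / 4) := by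
  set s : ℝ := ∑ i, ((y i).toNat : ℝ) with hs
  have hsum : ∀ σ : Fin m → Bool, ∑ i, (((y ∘ swapBlocks σ) i).toNat : ℝ) = s := fun σ =>
    Equiv.sum_comp (swapBlocks_involutive σ).toPerm (fun i => ((y i).toNat : ℝ))
  set w : Fin m → ℝ := fun i =>
    κ * (((y (Sum.inl i)).toNat : ℝ) - ((y (Sum.inr i)).toNat : ℝ)) with hw
  have hdiff : ∀ σ : Fin m → Bool,
      κ * ((∑ i, (((y ∘ swapBlocks σ) (Sum.inl i)).toNat : ℝ)) -
        ∑ i, (((y ∘ swapBlocks σ) (Sum.inr i)).toNat : ℝ)) =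
      ∑ i, (if σ i then w i else -w i) := by
    intro σ
    rw [← Finset.sum_sub_distrib, Finset.mul_sum]
    refine Finset.sum_congr rfl fun i _ => ?_
    cases h : σ i <;> simp [swapBlocks, h, hw]
    ring
  by_cases hsA : A - 1 ≤ s
  · have hs0 : 0 < s := by linarith
    have hq : 0 ≤ A * s / 2 := by positivity
    set r := Real.sqrt (A * s / 2) with hr
    have hr2 : r ^ 2 = A * s / 2 := Real.sq_sqrt hq
    have hr0 : 0 ≤ r := Real.sqrt_nonneg _
    have hr1 : 1 ≤ r := by
      rw [hr, Real.one_le_sqrt]; nlinarith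
    -- Here A ≥ 9 matters: it gives s ≥ A - 1 ≥ 8A/9.
    have hr3 : r ≤ 3 / 4 * s := by
      rw [hr, Real.sqrt_le_left (by positivity)]; nlinarith
    have hw2 : ∑ i, w i ^ 2 ≤ s := by
      rw [hs, Fintype.sum_sum_type, ← Finset.sum_add_distrib]
      refine Finset.sum_le_sum fun i _ => ?_
      simp only [hw, mul_pow, hκ]
      cases y (Sum.inl i) <;> cases y (Sum.inr i) <;> norm_num
    have key := card_rademacher_le w hs0 (sub_nonneg.2 hr1) hw2
    refine le_trans ?_ (key.trans ?_)
    · norm_cast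
      refine Finset.card_le_card fun σ hσ => ?_
      simp only [Finset.mem_filter, Finset.mem_univ, true_and] at hσ ⊢
      obtain ⟨y', ⟨-, h2⟩, rfl⟩ := hσ
      rwa [hsum, hdiff] at h2
    · refine mul_le_mul_of_nonneg_left (Real.exp_le_exp.2 ?_) (by positivity)
      rw [div_le_iff₀ (by positivity)]
      nlinarith
  · have : (Finset.univ.filter fun σ : Fin m → Bool => ∃ y' ∈ deviant m A κ,
      y' = y ∘ swapBlocks σ) = ∅ := by
      ext σ
      simp only [Finset.mem_filter, Finset.mem_univ, true_and, Finset.notMem_empty, iff_false]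
      rintro ⟨y', ⟨h1, -⟩, rfl⟩
      rw [hsum] at h1
      exact hsA h1
    rw [this]
    simp only [Finset.card_empty, Nat.cast_zero]
    positivity

theorem sum_toNat_elim {Z : Type*} {m : ℕ} (g : Z → Bool) (x t : Fin m → Z) :
    (∑ i, (((g ∘ Sum.elim x t) i).toNat : ℝ)) = hits g x + hits g t := by
  simp [hits, Fintype.sum_sum_type]

section Deviation

variable {Z : Type*} [MeasurableSpace Z] {P : Measure Z} [IsProbabilityMeasure P]
  {G : Set (Z → Bool)} {m N : ℕ} {A κ : ℝ}

/-- All swaps preserve the measure, so the probability is the average over swaps. For fixed points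
this average is bounded by a union over at most `N` traces. -/
theorem prob_deviant_le (hA : 9 ≤ A) (hκ : κ ^ 2 = 1)
    (hnull : ∀ y : Fin m ⊕ Fin m → Bool,
      NullMeasurableSet {z : Fin m ⊕ Fin m → Z | ∃ g ∈ G, ∀ i, g (z i) = y i}
        (Measure.pi fun _ => P))
    (hcard : ∀ z : Fin m ⊕ Fin m → Z,
      {y : Fin m ⊕ Fin m → Bool | ∃ g ∈ G, ∀ i, g (z i) = y i}.ncard ≤ N) :
    NullMeasurableSet {z : Fin m ⊕ Fin m → Z | ∃ g ∈ G, g ∘ z ∈ deviant m A κ}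
        (Measure.pi fun _ => P) ∧
    (Measure.pi fun _ => P) {z : Fin m ⊕ Fin m → Z | ∃ g ∈ G, g ∘ z ∈ deviant m A κ} ≤
      ENNReal.ofReal (N * Real.exp (-A / 4 + 3 / 4)) := by
  classical
  set μ := Measure.pi fun _ : Fin m ⊕ Fin m => P with hμ
  set B := {z : Fin m ⊕ Fin m → Z | ∃ g ∈ G, g ∘ z ∈ deviant m A κ} with hB
  have hBn : NullMeasurableSet B μ := by
    have : B = ⋃ y ∈ deviant m A κ,
        {z : Fin m ⊕ Fin m → Z | ∃ g ∈ G, ∀ i, g (z i) = y i} := by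
      ext z
      simp only [hB, mem_ofPred_eq, mem_iUnion, exists_prop]
      constructor
      · rintro ⟨g, hg, h⟩
        exact ⟨_, h, g, hg, fun _ => rfl⟩
      · rintro ⟨y, hy, g, hg, h⟩
        obtain rfl : g ∘ z = y := funext h
        exact ⟨g, hg, hy⟩
    rw [this]
    exact NullMeasurableSet.biUnion (to_countable _) fun y _ => hnull y
  refine ⟨hBn, ?_⟩
  have hmp : ∀ σ : Fin m → Bool, MeasurePreserving
      (fun (z : Fin m ⊕ Fin m → Z) i => z (swapBlocks σ i)) μ μ := fun σ =>
    measurePreserving_pi_comp_injective P (swapBlocks_involutive σ).injective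
  set c : ℝ := Real.exp (-A / 4 + 3 / 4) with hc
  have hpt : ∀ z : Fin m ⊕ Fin m → Z,
      ∑ σ : Fin m → Bool, B.indicator (fun _ => (1 : ENNReal)) (fun i => z (swapBlocks σ i)) ≤
        ENNReal.ofReal (2 ^ m * (N * c)) := by
    intro z
    set Y := (finite_univ.subset
      (subset_univ {y : Fin m ⊕ Fin m → Bool | ∃ g ∈ G, ∀ i, g (z i) = y i})).toFinset with hY
    have hYc : Y.card ≤ N := by
      rw [← ncard_eq_toFinset_card]; exact hcard z
    have hs : ∑ σ : Fin m → Bool,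
        B.indicator (fun _ => (1 : ENNReal)) (fun i => z (swapBlocks σ i)) =
        ((Finset.univ.filter fun σ : Fin m → Bool =>
          (fun i => z (swapBlocks σ i)) ∈ B).card : ENNReal) := by
      rw [Finset.card_filter]
      push_cast
      refine Finset.sum_congr rfl fun σ _ => ?_
      simp [indicator_apply]
    have hle : ((Finset.univ.filter fun σ : Fin m → Bool =>
          (fun i => z (swapBlocks σ i)) ∈ B).card : ℝ) ≤ 2 ^ m * (N * c) := by
      have hsub : (Finset.univ.filter fun σ : Fin m → Bool =>
          (fun i => z (swapBlocks σ i)) ∈ B) ⊆ Y.biUnion fun y =>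
          Finset.univ.filter fun σ : Fin m → Bool => ∃ y' ∈ deviant m A κ,
            y' = y ∘ swapBlocks σ := by
        intro σ hσ
        simp only [Finset.mem_filter, Finset.mem_univ, true_and, Finset.mem_biUnion, hB,
          mem_ofPred_eq] at hσ ⊢
        obtain ⟨g, hg, h⟩ := hσ
        refine ⟨g ∘ z, ?_, _, h, rfl⟩
        simp only [hY, Finite.mem_toFinset, mem_ofPred_eq]
        exact ⟨g, hg, fun _ => rfl⟩
      calc ((Finset.univ.filter fun σ : Fin m → Bool =>
          (fun i => z (swapBlocks σ i)) ∈ B).card : ℝ) ≤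
          ∑ y ∈ Y, ((Finset.univ.filter fun σ : Fin m → Bool => ∃ y' ∈ deviant m A κ,
            y' = y ∘ swapBlocks σ).card : ℝ) := by
            exact_mod_cast (Finset.card_le_card hsub).trans Finset.card_biUnion_le
        _ ≤ ∑ _y ∈ Y, 2 ^ m * c :=
            Finset.sum_le_sum fun y _ => card_swapBlocks_deviant_le hA hκ y
        _ = Y.card * (2 ^ m * c) := by simp
        _ ≤ N * (2 ^ m * c) := by gcongr
        _ = _ := by ring
    rw [hs, ← ENNReal.ofReal_natCast]
    exact ENNReal.ofReal_le_ofReal hle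
  have hind : ∀ σ : Fin m → Bool,
      ∫⁻ z, B.indicator (fun _ => (1 : ENNReal)) (fun i => z (swapBlocks σ i)) ∂μ = μ B := by
    intro σ
    have h := (hmp σ).measure_preimage hBn
    rw [← h, ← lintegral_indicator_one₀ (hBn.preimage (hmp σ).quasiMeasurePreserving)]
    rfl
  have htot : (2 : ENNReal) ^ m * μ B ≤ ENNReal.ofReal (2 ^ m * (N * c)) := by
    have h1 : ∑ σ : Fin m → Bool, ∫⁻ z, B.indicator (fun _ => (1 : ENNReal))
        (fun i => z (swapBlocks σ i)) ∂μ = 2 ^ m * μ B := by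
      simp [hind]
    rw [← h1, ← lintegral_finsetSum']
    · refine (lintegral_mono hpt).trans ?_
      simp
    · intro σ _
      exact (aemeasurable_const (b := (1 : ENNReal))).indicator₀
        (hBn.preimage (hmp σ).quasiMeasurePreserving)
  rw [ENNReal.ofReal_mul (by positivity), ENNReal.ofReal_pow (by norm_num),
    ENNReal.ofReal_ofNat] at htot
  exact (ENNReal.mul_le_mul_iff_right (by simp) (by simp)).1 htot

/-- A bad first half becomes a deviant pair with conditional probability at least 1/9 over the ghost
half, by Fubini and Markov, whence the factor 9. The set `S` need not be measurable. -/
theorem prob_exists_deviation_le (hA : 9 ≤ A) (hκ : κ ^ 2 = 1)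
    (hnull : ∀ y : Fin m ⊕ Fin m → Bool,
      NullMeasurableSet {z : Fin m ⊕ Fin m → Z | ∃ g ∈ G, ∀ i, g (z i) = y i}
        (Measure.pi fun _ => P))
    (hcard : ∀ z : Fin m ⊕ Fin m → Z,
      {y : Fin m ⊕ Fin m → Bool | ∃ g ∈ G, ∀ i, g (z i) = y i}.ncard ≤ N)
    {S : Set (Fin m → Z)}
    (hS : ∀ x ∈ S, ∃ g ∈ G, 1 / 9 ≤ (Measure.pi fun _ : Fin m => P).real
      {t | g ∘ Sum.elim x t ∈ deviant m A κ}) :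
    (Measure.pi fun _ => P) S ≤ ENNReal.ofReal (9 * N * Real.exp (-A / 4 + 3 / 4)) := by
  obtain ⟨hBn, hB⟩ := prob_deviant_le hA hκ hnull hcard
  obtain ⟨hm, hE⟩ := pi_sum_apply P hBn
  rw [hE] at hB
  have hmar := mul_meas_ge_le_lintegral₀ hm (ENNReal.ofReal (1 / 9))
  have hsub : S ⊆ {x | ENNReal.ofReal (1 / 9) ≤ (Measure.pi fun _ : Fin m => P)
      {t | Sum.elim x t ∈ {z : Fin m ⊕ Fin m → Z | ∃ g ∈ G, g ∘ z ∈ deviant m A κ}}} := by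
    intro x hx
    obtain ⟨g, hg, h⟩ := hS x hx
    have h2 := ENNReal.ofReal_le_ofReal h
    rw [ofReal_measureReal] at h2
    exact h2.trans (measure_mono fun t ht => ⟨g, hg, ht⟩)
  have h1 : ENNReal.ofReal (1 / 9) * (Measure.pi fun _ => P) S ≤
      ENNReal.ofReal (1 / 9) * ENNReal.ofReal (9 * N * Real.exp (-A / 4 + 3 / 4)) := by
    refine ((mul_le_mul_right (measure_mono hsub) _).trans (hmar.trans hB)).trans_eq ?_
    rw [← ENNReal.ofReal_mul (by norm_num)]
    congr 1
    ring
  refine (ENNReal.mul_le_mul_iff_right ?_ ENNReal.ofReal_ne_top).1 h1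
  simp

/-- With probability at least 1/9 the ghost count exceeds its mean by at most 1. It is then below
the sample count, so the average of the two counts under the root is at most the sample count. -/
theorem prob_upper_deviation_le (hA : 9 ≤ A) (hG : ∀ g ∈ G, Measurable g)
    (hnull : ∀ y : Fin m ⊕ Fin m → Bool,
      NullMeasurableSet {z : Fin m ⊕ Fin m → Z | ∃ g ∈ G, ∀ i, g (z i) = y i}
        (Measure.pi fun _ => P))
    (hcard : ∀ z : Fin m ⊕ Fin m → Z,
      {y : Fin m ⊕ Fin m → Bool | ∃ g ∈ G, ∀ i, g (z i) = y i}.ncard ≤ N) :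
    (Measure.pi fun _ : Fin m => P) {x | ∃ g ∈ G,
      Real.sqrt (A * hits g x) < hits g x - m * P.real {z | g z = true}} ≤
      ENNReal.ofReal (9 * N * Real.exp (-A / 4 + 3 / 4)) := by
  refine prob_exists_deviation_le (κ := 1) hA (by norm_num) hnull hcard ?_
  rintro x ⟨g, hg, hx⟩
  refine ⟨g, hg, (moments_hits P (hG g hg) m).1.trans (measureReal_mono fun t ht => ?_)⟩
  set μ := (m : ℝ) * P.real {z | g z = true} with hμ
  have hμ0 : 0 ≤ μ := by positivity
  set c : ℝ := ((hits g x : ℕ) : ℝ) with hc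
  set c' : ℝ := ((hits g t : ℕ) : ℝ) with hc'
  have hc0 : 0 ≤ c := by positivity
  have hc0' : 0 ≤ c' := by positivity
  have ht' : c' ≤ μ + 1 := ht
  have hsq : Real.sqrt (A * c) ^ 2 = A * c := Real.sq_sqrt (by positivity)
  have hs0 := Real.sqrt_nonneg (A * c)
  have hcA : A ≤ c := by
    by_contra h
    push Not at h
    have : c ≤ Real.sqrt (A * c) := Real.le_sqrt_of_sq_le (by nlinarith)
    linarith
  refine ⟨?_, ?_⟩
  · rw [sum_toNat_elim]
    linarith
  · rw [sum_toNat_elim]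
    have e : Real.sqrt (A * (c + c') / 2) ≤ Real.sqrt (A * c) := by
      apply Real.sqrt_le_sqrt
      have h36 : 6 ≤ Real.sqrt (A * c) := Real.le_sqrt_of_sq_le (by nlinarith)
      have : c' ≤ c := by linarith
      nlinarith
    have : ∀ a b : ℝ, 1 * (a - b) = a - b := fun a b => by ring
    rw [this]
    have e1 : (∑ i, (((g ∘ Sum.elim x t) (Sum.inl i)).toNat : ℝ)) = c := by simp [hc, hits]
    have e2 : (∑ i, (((g ∘ Sum.elim x t) (Sum.inr i)).toNat : ℝ)) = c' := by simp [hc', hits]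
    rw [e1, e2]
    linarith

theorem prob_lower_deviation_le (hA : 9 ≤ A) (hG : ∀ g ∈ G, Measurable g)
    (hnull : ∀ y : Fin m ⊕ Fin m → Bool,
      NullMeasurableSet {z : Fin m ⊕ Fin m → Z | ∃ g ∈ G, ∀ i, g (z i) = y i}
        (Measure.pi fun _ => P))
    (hcard : ∀ z : Fin m ⊕ Fin m → Z,
      {y : Fin m ⊕ Fin m → Bool | ∃ g ∈ G, ∀ i, g (z i) = y i}.ncard ≤ N) :
    (Measure.pi fun _ : Fin m => P) {x | ∃ g ∈ G,
      Real.sqrt (A * (m * P.real {z | g z = true})) <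
        m * P.real {z | g z = true} - hits g x} ≤
      ENNReal.ofReal (9 * N * Real.exp (-A / 4 + 3 / 4)) := by
  refine prob_exists_deviation_le (κ := -1) hA (by norm_num) hnull hcard ?_
  rintro x ⟨g, hg, hx⟩
  refine ⟨g, hg, (moments_hits P (hG g hg) m).2.trans (measureReal_mono fun t ht => ?_)⟩
  set μ := (m : ℝ) * P.real {z | g z = true} with hμ
  have hμ0 : 0 ≤ μ := by positivity
  set c : ℝ := ((hits g x : ℕ) : ℝ) with hc
  set c' : ℝ := ((hits g t : ℕ) : ℝ) with hc'
  have hc0 : 0 ≤ c := by positivity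
  have hc0' : 0 ≤ c' := by positivity
  have ht' : μ - 1 ≤ c' := ht
  have hsq : Real.sqrt (A * μ) ^ 2 = A * μ := Real.sq_sqrt (by positivity)
  have hs0 := Real.sqrt_nonneg (A * μ)
  have hμA : A ≤ μ := by
    by_contra h
    push Not at h
    have : μ ≤ Real.sqrt (A * μ) := Real.le_sqrt_of_sq_le (by nlinarith)
    linarith
  refine ⟨?_, ?_⟩
  · rw [sum_toNat_elim]
    linarith
  · rw [sum_toNat_elim]
    have : ∀ a b : ℝ, -1 * (a - b) = b - a := fun a b => by ring
    rw [this]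
    have e1 : (∑ i, (((g ∘ Sum.elim x t) (Sum.inl i)).toNat : ℝ)) = c := by simp [hc, hits]
    have e2 : (∑ i, (((g ∘ Sum.elim x t) (Sum.inr i)).toNat : ℝ)) = c' := by simp [hc', hits]
    rw [e1, e2]
    have hd : 0 ≤ c' + 1 - c := by linarith
    suffices h : Real.sqrt (A * (c + c') / 2) ≤ c' + 1 - c by linarith
    rw [Real.sqrt_le_left hd]
    set r := Real.sqrt (A * μ) with hr
    have hAr : A ≤ r := Real.le_sqrt_of_sq_le (by nlinarith)
    have h1 : r ≤ c' + 1 - c := by linarith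
    -- the difference is monotone in `c'` above the mean
    have h2 : 0 ≤ c' + 1 - μ := by linarith
    have h3 : c ≤ μ - r := by linarith
    nlinarith [mul_nonneg h2 (sub_nonneg.2 h1), mul_nonneg h2 (sub_nonneg.2 hAr),
      mul_nonneg h2 h2]

end Deviation

/-! ### Compression sets and the measure of disagreement regions. -/

/-- The disagreement region of the agnostic version space of a sample. -/
def disRegion (F : Set (X → Bool)) (f : X → Bool) {ι : Type*} (S : ι → X × Bool) :
    Set (X × Bool) :=
  {z | ∃ h ∈ F, (∀ i, h (S i).1 = f (S i).1) ∧ h z.1 ≠ f z.1}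

/-- The pairs of samples such that the second one meets the disagreement region of the first. -/
def meetsDis (F : Set (X → Bool)) (f : X → Bool) (α β : Type*) : Set (α ⊕ β → X × Bool) :=
  {z | ∃ j, z (Sum.inr j) ∈ disRegion F f (z ∘ Sum.inl)}

/-- The compression set is recorded by indices rather than by points, because the exchangeability
argument permutes positions. -/
theorem exists_compression {F : Set (X → Bool)} {f : X → Bool} {m b : ℕ} {S : Fin m → X × Bool} (h : compressionSize F f S ≤ b) :
    ∃ J : Finset (Fin m), J.card ≤ b ∧
      ∀ g ∈ F, (∀ i ∈ J, g (S i).1 = f (S i).1) → ∀ i, g (S i).1 = f (S i).1 := by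
  classical
  have hne : {k | ∃ C ⊆ range S,
      versionSpace F f C = versionSpace F f (range S) ∧ C.ncard = k}.Nonempty :=
    ⟨_, range S, subset_rfl, rfl, rfl⟩
  obtain ⟨C, hC, hV, hk⟩ := Nat.sInf_mem hne
  have hCf : C.Finite := (finite_range S).subset hC
  have := hCf.fintype
  choose e he using fun z : C => hC z.2
  refine ⟨Finset.univ.image e, ?_, ?_⟩
  · refine Finset.card_image_le.trans ?_
    rw [Finset.card_univ, ← Nat.card_eq_fintype_card, Nat.card_coe_set_eq, hk]
    exact h
  · intro g hg hJ i
    have : g ∈ versionSpace F f C := ⟨hg, fun z hz => by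
      have := hJ (e ⟨z, hz⟩) (Finset.mem_image_of_mem _ (Finset.mem_univ _))
      rwa [he ⟨z, hz⟩] at this⟩
    rw [hV] at this
    exact this.2 _ (mem_range_self i)

section

variable [MeasurableSpace X] {F : Set (X → Bool)} {P : Measure (X × Bool)}
  [IsProbabilityMeasure P] {f : X → Bool}

theorem nullMeasurableSet_meetsDis (hT : TraceMeasurable F P) (hf : Measurable f)
    (α β : Type*) [Fintype α] [Fintype β] :
    NullMeasurableSet (meetsDis F f α β) (Measure.pi fun _ => P) := by
  have hfi : ∀ (i : α ⊕ β) (b : Bool),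
      MeasurableSet {z : α ⊕ β → X × Bool | b = f (z i).1} := fun i b =>
    measurableSet_eq_fun measurable_const (hf.comp (measurable_fst.comp (measurable_pi_apply i)))
  have h := nullMeasurableSet_trace_of (ι := α ⊕ β) hT
    (fun y => (⋂ i : α, {z | y (Sum.inl i) = f (z (Sum.inl i)).1}) ∩
      ⋃ j : β, {z | y (Sum.inr j) = f (z (Sum.inr j)).1}ᶜ)
    (fun y => (MeasurableSet.iInter fun i => hfi _ _).inter
      (MeasurableSet.iUnion fun j => (hfi _ _).compl))
  convert h using 1
  ext z
  simp only [meetsDis, disRegion, mem_ofPred_eq, mem_inter_iff, mem_iInter, mem_iUnion,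
    mem_compl_iff, Function.comp]
  constructor
  · rintro ⟨j, h, hF, h1, h2⟩
    exact ⟨h, hF, h1, j, h2⟩
  · rintro ⟨h, hF, h1, j, h2⟩
    exact ⟨j, h, hF, h1, h2⟩

/-- By exchangeability, a random block of a sample with a small compression set is likely to
avoid the disagreement region of the rest of the sample. -/
theorem le_prob_compl_meetsDis (hT : TraceMeasurable F P) (hf : Measurable f) {k t b : ℕ}
    (ht : 0 < t) {q : ENNReal}
    (hq : q ≤ Measure.pi (fun _ : Fin (k + t) => P) {S | compressionSize F f S ≤ b}) :
    ((k + t - b * t : ℕ) : ENNReal) * q ≤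
      (k + t : ℕ) * (Measure.pi fun _ => P) (meetsDis F f (Fin k) (Fin t))ᶜ := by
  classical
  have : NeZero (k + t) := ⟨by omega⟩
  set E := (meetsDis F f (Fin k) (Fin t))ᶜ with hE
  have hEn : NullMeasurableSet E (Measure.pi fun _ => P) :=
    (nullMeasurableSet_meetsDis hT hf _ _).compl
  -- The cyclic shifts of the sample suffice in place of all permutations: each position visits
  -- every index exactly once.
  set e : Fin (k + t) → (Fin k ⊕ Fin t ≃ Fin (k + t)) := fun s =>
    finSumFinEquiv.trans (Equiv.addRight s) with he
  have hmp : ∀ s, MeasurePreserving (fun (z : Fin (k + t) → X × Bool) i => z (e s i))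
      (Measure.pi fun _ => P) (Measure.pi fun _ => P) := fun s =>
    measurePreserving_pi_comp_injective P (e s).injective
  have hind : ∀ s, ∫⁻ z, E.indicator (fun _ => (1 : ENNReal)) (fun i => z (e s i))
      ∂(Measure.pi fun _ => P) = (Measure.pi fun _ => P) E := by
    intro s
    rw [← (hmp s).measure_preimage hEn,
      ← lintegral_indicator_one₀ (hEn.preimage (hmp s).quasiMeasurePreserving)]
    rfl
  have hae : ∀ s, AEMeasurable (fun z : Fin (k + t) → X × Bool =>
      E.indicator (fun _ => (1 : ENNReal)) (fun i => z (e s i))) (Measure.pi fun _ => P) := by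
    intro s
    exact (aemeasurable_const (b := (1 : ENNReal))).indicator₀
        (hEn.preimage (hmp s).quasiMeasurePreserving)
  have htot : ∫⁻ z, ∑ s, E.indicator (fun _ => (1 : ENNReal)) (fun i => z (e s i))
      ∂(Measure.pi fun _ => P) = (k + t : ℕ) * (Measure.pi fun _ => P) E := by
    rw [lintegral_finsetSum' _ fun s _ => hae s]
    simp [hind]
  rw [← htot]
  refine le_trans ?_ (mul_meas_ge_le_lintegral₀
    (Finset.aemeasurable_fun_sum _ fun s _ => hae s) ((k + t - b * t : ℕ) : ENNReal))
  refine mul_le_mul_right (hq.trans (measure_mono fun S hS => ?_)) _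
  obtain ⟨J, hJ, hcomp⟩ := exists_compression hS
  have hs : ∑ s, E.indicator (fun _ => (1 : ENNReal)) (fun i => S (e s i)) =
      ((Finset.univ.filter fun s => (fun i => S (e s i)) ∈ E).card : ENNReal) := by
    rw [Finset.card_filter]
    push_cast
    refine Finset.sum_congr rfl fun σ _ => ?_
    simp [indicator_apply]
  simp only [mem_ofPred_eq]
  rw [hs, Nat.cast_le, Nat.sub_le_iff_le_add]
  -- A shift is bad only if an index of `J` lands in the block of length `t`, which happens for at
  -- most `b` shifts per position. Otherwise `J` lies in the first part, and hypotheses that agree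
  -- with `f` there agree with it on the whole sample.
  have hbad : (Finset.univ.filter fun s => ¬ (fun i => S (e s i)) ∈ E).card ≤ b * t := by
    have hsub : (Finset.univ.filter fun s => ¬ (fun i => S (e s i)) ∈ E) ⊆
        (Finset.univ : Finset (Fin t)).biUnion fun j =>
          Finset.univ.filter fun s => e s (Sum.inr j) ∈ J := by
      intro s hs
      simp only [Finset.mem_filter, Finset.mem_univ, true_and, Finset.mem_biUnion] at hs ⊢
      by_contra hcon
      push Not at hcon
      refine hs ?_
      rintro ⟨j, g, hg, h1, h2⟩
      refine h2 (hcomp g hg (fun i hi => ?_) (e s (Sum.inr j)))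
      obtain ⟨a | a, rfl⟩ := (e s).surjective i
      · exact h1 a
      · exact absurd hi (hcon a)
    refine (Finset.card_le_card hsub).trans (Finset.card_biUnion_le.trans ?_)
    have : ∀ j : Fin t, (Finset.univ.filter fun s => e s (Sum.inr j) ∈ J).card ≤ b := by
      intro j
      refine le_trans ?_ hJ
      refine Finset.card_le_card_of_injOn (fun s => e s (Sum.inr j)) (fun s hs => ?_) ?_
      · exact (Finset.mem_filter.1 hs).2
      · intro s _ s' _ h
        simpa [he] using h
    refine (Finset.sum_le_sum fun j _ => this j).trans ?_
    simp [mul_comm]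
  have hcard := Finset.card_filter_add_card_filter_not
    (s := (Finset.univ : Finset (Fin (k + t)))) (fun s => (fun i => S (e s i)) ∈ E)
  rw [Finset.card_univ, Fintype.card_fin] at hcard
  omega

/-- By Bernoulli, (1 + tv)(1 - v)^t ≤ (1 - v²)^t ≤ 1. The bound is put in a form affine in `v`, so
that it can be integrated. -/
theorem pow_add_mul_le_one {v p : ℝ} (hv0 : 0 ≤ v) (hvp : v ≤ p) (hv1 : v ≤ 1) (t : ℕ) :
    (1 - v) ^ t + t / (1 + t * p) * v ≤ 1 := by
  have ht : (0 : ℝ) ≤ t := t.cast_nonneg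
  have h1 : (1 + t * v) * (1 - v) ^ t ≤ 1 := by
    have hb := one_add_mul_le_pow (a := v) (by linarith) t
    calc (1 + t * v) * (1 - v) ^ t ≤ (1 + v) ^ t * (1 - v) ^ t := by
          have : 0 ≤ (1 - v) ^ t := pow_nonneg (by linarith) t
          gcongr
      _ = (1 - v ^ 2) ^ t := by rw [← mul_pow]; congr 1; ring
      _ ≤ 1 := pow_le_one₀ (by nlinarith) (by nlinarith)
  have hpos : 0 < 1 + t * v := by positivity
  have h2 : (1 - v) ^ t ≤ 1 / (1 + t * v) := by
    rw [le_div_iff₀ hpos]; linarith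
  have h3 : t / (1 + t * p) * v ≤ t * v / (1 + t * v) := by
    rw [div_mul_eq_mul_div]
    gcongr
  have h4 : 1 / (1 + t * v) + t * v / (1 + t * v) = 1 := by field_simp
  linarith

/-- A measurable set that contains the points of disagreement of all hypotheses close to `f`,
of measure controlled by the probability that a block of `t` draws avoids the disagreement
region of a sample of size `k`. -/
theorem exists_disagreement_set (hT : TraceMeasurable F P) (hF : ∀ h ∈ F, Measurable h)
    (hf : Measurable f) (k t : ℕ) :
    ∃ D : Set (X × Bool), MeasurableSet D ∧
      (∀ h ∈ F, 3 / 4 ≤ (1 - P.real {z | h z.1 ≠ f z.1}) ^ k → ∀ z, h z.1 ≠ f z.1 → z ∈ D) ∧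
      (Measure.pi fun _ => P) (meetsDis F f (Fin k) (Fin t))ᶜ +
        ENNReal.ofReal (t / (1 + t * P.real D)) * (ENNReal.ofReal (3 / 4) * P D) ≤ 1 := by
  set μ := Measure.pi fun _ : Fin k => P with hμ
  set R : Set ((Fin k → X × Bool) × (X × Bool)) := {q | q.2 ∈ disRegion F f q.1} with hR
  have hRn : NullMeasurableSet R (μ.prod P) := by
    have h1 := measurePreserving_sumPiEquivProdPi_symm (fun _ : Fin k ⊕ Unit => P)
    have h2 : MeasurePreserving (fun (z : X × Bool) (_ : Unit) => z) P
        (Measure.pi fun _ : Unit => P) := by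
      refine ⟨by fun_prop, (Measure.pi_eq fun s hs => ?_).symm⟩
      rw [Measure.map_apply (by fun_prop) (MeasurableSet.univ_pi hs)]
      simp only [Finset.univ_unique, Finset.prod_singleton]
      congr 1
      ext x
      exact ⟨fun h => h () (mem_univ _), fun h i _ => h⟩
    have h3 := (MeasurePreserving.id μ).prod h2
    have h4 := (nullMeasurableSet_meetsDis hT hf (Fin k) Unit).preimage
      (h1.comp h3).quasiMeasurePreserving
    convert h4 using 1
    ext q
    simp only [hR, meetsDis, mem_preimage, mem_ofPred_eq]
    constructor
    · intro h
      exact ⟨(), h⟩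
    · rintro ⟨_, h⟩
      exact h
  obtain ⟨R₁, hRR, hR₁, hae⟩ := hRn.exists_measurable_superset_ae_eq
  have hq : Measurable fun z => μ ((fun S => (S, z)) ⁻¹' R₁) :=
    measurable_measure_prodMk_right hR₁
  -- The points that lie in the disagreement region of a random sample with probability at least
  -- 3/4. The measurable superset `R₁` makes this set measurable.
  set D : Set (X × Bool) := {z | ENNReal.ofReal (3 / 4) ≤ μ ((fun S => (S, z)) ⁻¹' R₁)} with hD
  have hDm : MeasurableSet D := measurableSet_le measurable_const hq
  refine ⟨D, hDm, ?_, ?_⟩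
  · intro h hhF hk z hz
    have hms : MeasurableSet {z : X × Bool | h z.1 ≠ f z.1} :=
      (measurableSet_eq_fun ((hF h hhF).comp measurable_fst) (hf.comp measurable_fst)).compl
    have h1 : P.real {z : X × Bool | h z.1 = f z.1} = 1 - P.real {z | h z.1 ≠ f z.1} := by
      rw [← probReal_compl_eq_one_sub hms]
      congr 1
      ext z
      simp
    have h2 : μ (Set.pi univ fun _ => {z : X × Bool | h z.1 = f z.1}) =
        ENNReal.ofReal ((1 - P.real {z | h z.1 ≠ f z.1}) ^ k) := by
      rw [hμ, Measure.pi_pi, ← h1, ENNReal.ofReal_pow measureReal_nonneg, ofReal_measureReal]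
      simp
    refine (ENNReal.ofReal_le_ofReal hk).trans (h2.symm.le.trans (measure_mono ?_))
    intro S hS
    refine hRR ?_
    exact ⟨h, hhF, fun i => hS i (mem_univ i), hz⟩
  -- Intersecting with `D` keeps `v` below the measure of `D`, as the affine bound requires, while
  -- Fubini still gives mean at least 3/4 of that measure.
  · set v : (Fin k → X × Bool) → ENNReal := fun S => P (Prod.mk S ⁻¹' (R₁ ∩ univ ×ˢ D)) with hv
    have hR₂ : MeasurableSet (R₁ ∩ univ ×ˢ D) := hR₁.inter (MeasurableSet.univ.prod hDm)
    have hvm : Measurable v := measurable_measure_prodMk_left hR₂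
    have hint : ENNReal.ofReal (3 / 4) * P D ≤ ∫⁻ S, v S ∂μ := by
      rw [hv, ← Measure.prod_apply hR₂, Measure.prod_apply_symm hR₂,
        ← lintegral_indicator_const hDm]
      refine lintegral_mono fun z => ?_
      by_cases hz : z ∈ D
      · rw [indicator_of_mem hz]
        refine le_trans hz (measure_mono fun S hS => ⟨hS, mem_univ _, hz⟩)
      · rw [indicator_of_notMem hz]
        exact zero_le
    set c := ENNReal.ofReal (t / (1 + t * P.real D)) with hc
    have hsec : ∀ᵐ S ∂μ, (Measure.pi fun _ : Fin t => P)
        {T | Sum.elim S T ∈ (meetsDis F f (Fin k) (Fin t))ᶜ} + c * v S ≤ 1 := by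
      filter_upwards [Measure.ae_ae_of_ae_prod hae] with S hS
      have e1 : {T | Sum.elim S T ∈ (meetsDis F f (Fin k) (Fin t))ᶜ} =
          Set.pi univ fun _ : Fin t => (disRegion F f S)ᶜ := by
        ext T
        simp [meetsDis]
      have e2 : P (disRegion F f S)ᶜ = P (Prod.mk S ⁻¹' R₁)ᶜ := by
        refine measure_congr ?_
        have : (disRegion F f S) =ᵐ[P] (Prod.mk S ⁻¹' R₁) := by
          filter_upwards [hS] with z hz
          exact hz.symm
        exact this.compl
      have hm : MeasurableSet (Prod.mk S ⁻¹' R₁) := measurable_prodMk_left hR₁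
      rw [e1, Measure.pi_pi, e2, Finset.prod_const, Finset.card_univ, Fintype.card_fin]
      have e3 : P (Prod.mk S ⁻¹' R₁)ᶜ ≤ ENNReal.ofReal (1 - (v S).toReal) := by
        rw [← ofReal_measureReal, probReal_compl_eq_one_sub hm]
        refine ENNReal.ofReal_le_ofReal (sub_le_sub_left ?_ _)
        exact measureReal_mono (preimage_mono inter_subset_left)
      have hv1 : (v S).toReal ≤ 1 := measureReal_le_one
      have e4 : v S = ENNReal.ofReal (v S).toReal :=
        (ENNReal.ofReal_toReal (measure_ne_top _ _)).symm
      have hvp : (v S).toReal ≤ P.real D := measureReal_mono fun z hz => hz.2.2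
      calc P (Prod.mk S ⁻¹' R₁)ᶜ ^ t + c * v S
          ≤ ENNReal.ofReal (1 - (v S).toReal) ^ t + c * ENNReal.ofReal (v S).toReal := by
            rw [← e4]
            gcongr
        _ = ENNReal.ofReal ((1 - (v S).toReal) ^ t +
              t / (1 + t * P.real D) * (v S).toReal) := by
            rw [hc, ENNReal.ofReal_add (pow_nonneg (by linarith) _) (by positivity),
              ENNReal.ofReal_pow (by linarith), ENNReal.ofReal_mul (by positivity)]
        _ ≤ 1 := by
            rw [← ENNReal.ofReal_one]
            exact ENNReal.ofReal_le_ofReal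
              (pow_add_mul_le_one ENNReal.toReal_nonneg hvp hv1 t)
    obtain ⟨-, hE⟩ := pi_sum_apply P (nullMeasurableSet_meetsDis hT hf (Fin k) (Fin t)).compl
    calc _ ≤ (∫⁻ S, (Measure.pi fun _ : Fin t => P)
            {T | Sum.elim S T ∈ (meetsDis F f (Fin k) (Fin t))ᶜ} ∂μ) + ∫⁻ S, c * v S ∂μ := by
          rw [hE, lintegral_const_mul _ hvm]
          gcongr
      _ = ∫⁻ S, ((Measure.pi fun _ : Fin t => P)
            {T | Sum.elim S T ∈ (meetsDis F f (Fin k) (Fin t))ᶜ} + c * v S) ∂μ := by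
          rw [lintegral_add_right _ (hvm.const_mul c)]
      _ ≤ ∫⁻ _S, 1 ∂μ := lintegral_mono_ae hsec
      _ = 1 := by simp

theorem le_prob_compressionBound (F : Set (X → Bool)) (f : X → Bool) (m : ℕ) {δ : ℝ}
    (hδ : 0 ≤ δ) :
    ENNReal.ofReal (1 - δ) ≤ Measure.pi (fun _ : Fin m => P)
      {S | compressionSize F f S ≤ compressionBound F P f m δ} ∧
    compressionBound F P f m δ ≤ m := by
  have hm : m ∈ {b | ENNReal.ofReal (1 - δ) ≤
      Measure.pi (fun _ : Fin m => P) {S | compressionSize F f S ≤ b}} := by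
    have : {S : Fin m → X × Bool | compressionSize F f S ≤ m} = univ := by
      refine eq_univ_of_forall fun S => ?_
      have hmem : (range S).ncard ∈ {k | ∃ C ⊆ range S,
          versionSpace F f C = versionSpace F f (range S) ∧ C.ncard = k} :=
        ⟨range S, subset_rfl, rfl, rfl⟩
      refine (Nat.sInf_le hmem).trans ?_
      rw [← image_univ]
      refine (ncard_image_le finite_univ).trans ?_
      simp [ncard_univ]
    simp only [mem_ofPred_eq] at this ⊢
    rw [this, measure_univ, ← ENNReal.ofReal_one]
    exact ENNReal.ofReal_le_ofReal (by linarith)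
  exact ⟨Nat.sInf_mem ⟨m, hm⟩, Nat.sInf_le hm⟩

theorem compressionBound_le_max (F : Set (X → Bool)) (f : X → Bool) {r₀ r : ℝ} (h0 : 0 < r₀)
    (hr : r₀ < r) :
    compressionBound F P f ⌈1 / r⌉₊ (1 / 20) ≤ maxCompressionBound F P f r₀ := by
  -- Without this bound the supremum in ℕ would take the default value 0.
  have hbdd : BddAbove (range fun r : Ioi r₀ =>
      compressionBound F P f ⌈1 / (r : ℝ)⌉₊ (1 / 20)) := by
    refine ⟨⌈1 / r₀⌉₊, ?_⟩
    rintro _ ⟨⟨s, hs⟩, rfl⟩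
    refine (le_prob_compressionBound F f _ (by norm_num)).2.trans (Nat.ceil_mono ?_)
    exact one_div_le_one_div_of_le h0 (le_of_lt hs)
  exact le_ciSup hbdd (⟨r, hr⟩ : Ioi r₀)

/-- The disagreement region of a ball around `f` has measure of the order of the radius times
the compression bound. -/
theorem exists_disagreement_set_le (hT : TraceMeasurable F P) (hF : ∀ h ∈ F, Measurable h)
    (hf : Measurable f) {r₀ r : ℝ} (h0 : 0 < r₀) (hr : r₀ < r) :
    ∃ D : Set (X × Bool), MeasurableSet D ∧
      P.real D ≤ 80 * ((maxCompressionBound F P f r₀ : ℝ) + 1) * r ∧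
      ∀ h ∈ F, P.real {z | h z.1 ≠ f z.1} ≤ r → ∀ z, h z.1 ≠ f z.1 → z ∈ D := by
  have hr0 : 0 < r := h0.trans hr
  -- The compression bound is used at radius 4r; with fewer than 1/(4r) conditioning draws,
  -- Bernoulli yields agreement with probability at least 3/4.
  set m := ⌈1 / (4 * r)⌉₊ with hm
  set B := maxCompressionBound F P f r₀ with hB
  have hm1 : 1 / (4 * r) ≤ m := Nat.le_ceil _
  have hm2 : (m : ℝ) < 1 / (4 * r) + 1 := Nat.ceil_lt_add_one (by positivity)
  rw [div_le_iff₀ (by positivity)] at hm1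
  set t := m / (10 * (B + 1)) with ht
  have htm : t * (10 * (B + 1)) ≤ m := Nat.div_mul_le_self _ _
  have hmt : m < (t + 1) * (10 * (B + 1)) := by
    rw [mul_comm]
    exact Nat.lt_mul_div_succ m (show 0 < 10 * (B + 1) by positivity)
  rcases Nat.eq_zero_or_pos t with ht0 | ht0
  -- No block fits, so m ≤ 10(B + 1) and the claimed bound already exceeds 1.
  · refine ⟨univ, MeasurableSet.univ, ?_, fun _ _ _ _ _ => mem_univ _⟩
    rw [ht0] at hmt
    have : (m : ℝ) ≤ 10 * (B + 1) := by
      have : m ≤ 10 * (B + 1) := by omega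
      exact_mod_cast this
    rw [probReal_univ]
    nlinarith
  · have hbt : 10 * (B * t) + 10 * t ≤ m := by nlinarith
    obtain ⟨k, hk⟩ : ∃ k, m = k + t := ⟨m - t, by omega⟩
    obtain ⟨D, hDm, hD1, hD2⟩ := exists_disagreement_set (P := P) hT hF hf k t
    have hkm : (k : ℝ) + 1 ≤ m := by
      have : k + 1 ≤ m := by omega
      exact_mod_cast this
    have hkr : (k : ℝ) * r ≤ 1 / 4 := by
      have h1 : (k : ℝ) ≤ 1 / (4 * r) := by linarith
      rw [le_div_iff₀ (by positivity)] at h1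
      linarith
    have hk1 : (1 : ℝ) ≤ k := by
      have : 1 ≤ k := by omega
      exact_mod_cast this
    refine ⟨D, hDm, ?_, ?_⟩
    · have hBm : compressionBound F P f (k + t) (1 / 20) ≤ B := by
        rw [← hk, hm]
        exact compressionBound_le_max F f h0 (by linarith)
      have hq : ENNReal.ofReal (1 - 1 / 20) ≤ Measure.pi (fun _ : Fin (k + t) => P)
          {S | compressionSize F f S ≤ B} :=
        (le_prob_compressionBound (P := P) F f (k + t) (by norm_num)).1.trans
          (measure_mono fun S (hS : compressionSize F f S ≤ _) => hS.trans hBm)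
      have hle := le_prob_compl_meetsDis hT hf ht0 (b := B) hq
      set e := (Measure.pi fun _ => P) (meetsDis F f (Fin k) (Fin t))ᶜ with he
      have he1 : e ≠ ⊤ := measure_ne_top _ _
      have e0 : e = ENNReal.ofReal e.toReal := (ENNReal.ofReal_toReal he1).symm
      have p0 : P D = ENNReal.ofReal (P.real D) := (ofReal_measureReal).symm
      have hp0 : 0 ≤ P.real D := measureReal_nonneg
      set p := P.real D with hp
      rw [e0, p0, ← ENNReal.ofReal_mul (by norm_num), ← ENNReal.ofReal_mul (by positivity),
        ← ENNReal.ofReal_add ENNReal.toReal_nonneg (by positivity), ENNReal.ofReal_le_one] at hD2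
      rw [e0, ← ENNReal.ofReal_natCast, ← ENNReal.ofReal_natCast,
        ← ENNReal.ofReal_mul (by positivity), ← ENNReal.ofReal_mul (by positivity),
        ENNReal.ofReal_le_ofReal_iff (by positivity), Nat.cast_sub (by nlinarith)] at hle
      push_cast at hle
      have hmR : (m : ℝ) = k + t := by exact_mod_cast hk
      have ht1 : (1 : ℝ) ≤ t := by exact_mod_cast ht0
      have hbtR : 10 * ((B : ℝ) * t) ≤ m := by
        have : 10 * (B * t) ≤ m := by omega
        exact_mod_cast this
      have hmtR : (m : ℝ) ≤ (t + 1) * (10 * (B + 1)) := by exact_mod_cast hmt.le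
      have hm0 : (0 : ℝ) < m := by linarith
      have hB0 : (0 : ℝ) ≤ B := by positivity
      -- At most a tenth of the shifts are bad, and the compression bound holds with probability
      -- 0.95: 0.9 · 0.95 = 0.855. If `t * p` exceeded 1, the second term of `hD2` would be at least
      -- 3/8, which is too much.
      have hE : 0.855 ≤ e.toReal := by
        by_contra hcon
        push Not at hcon
        rw [← hmR] at hle
        nlinarith
      have htp : t * p ≤ 1 := by
        by_contra hcon
        push Not at hcon
        have : (1 : ℝ) / 2 ≤ t / (1 + t * p) * p := by
          rw [div_mul_eq_mul_div, div_le_div_iff₀ (by norm_num) (by positivity)]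
          linarith
        nlinarith
      have h20 : (m : ℝ) ≤ 20 * (B + 1) * t := by nlinarith
      have h80 : 1 ≤ 80 * (B + 1) * r * t := by nlinarith
      by_contra hcon
      push Not at hcon
      nlinarith
    · intro h hh hdis
      refine hD1 h hh ?_
      have hp0 : 0 ≤ P.real {z : X × Bool | h z.1 ≠ f z.1} := measureReal_nonneg
      have hp1 : P.real {z : X × Bool | h z.1 ≠ f z.1} ≤ 1 := measureReal_le_one
      have := one_add_mul_le_pow (a := -P.real {z : X × Bool | h z.1 ≠ f z.1}) (by linarith) k
      rw [← sub_eq_add_neg] at this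
      nlinarith

end

/-! ### Consistency of the run and the form of its decisions. -/

section Learner

variable {F : Set (X → Bool)} {learn : List (X × Bool) → List (X × Bool) → Option (X → Bool)}

theorem IsLearner.exists_eq_some (hl : IsLearner F learn) {S T : List (X × Bool)}
    (h : ∃ g ∈ F, Consistent g S) : ∃ g ∈ F, Consistent g S ∧ learn S T = some g := by
  obtain ⟨g, hg, hc⟩ := h
  cases hS : learn S T with
  | none => exact absurd hc ((hl S T).2 hS g hg)
  | some k => exact ⟨k, ((hl S T).1 k hS).1, ((hl S T).1 k hS).2.1, rfl⟩

theorem consistent_cons {h : X → Bool} {z : X × Bool} {S : List (X × Bool)} :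
    Consistent h (z :: S) ↔ h z.1 = z.2 ∧ Consistent h S := by
  simp [Consistent]

/-- If no consistent hypothesis gave the label `y`, the call for `y` would fail while the one for
the opposite label succeeds, and the opposite label would be inferred. -/
theorem IsLearner.exists_consistent_of_decide (hl : IsLearner F learn) {δ : ℝ} {s : State X}
    {x : X} {y : Bool} (hs : ∃ g ∈ F, Consistent g s.inferred)
    (hd : dhmDecide F learn δ s x = some y) :
    ∃ g ∈ F, Consistent g ((x, y) :: s.inferred) := by
  obtain ⟨g, hg, hc⟩ := hs
  by_contra hcon
  have hgy : g x = !y := by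
    by_contra hne
    refine hcon ⟨g, hg, consistent_cons.2 ⟨?_, hc⟩⟩
    revert hne
    cases g x <;> cases y <;> simp
  have hy : learn ((x, y) :: s.inferred) s.queried = none := by
    cases hS : learn ((x, y) :: s.inferred) s.queried with
    | none => rfl
    | some k => exact absurd ⟨k, ((hl _ _).1 k hS).1, ((hl _ _).1 k hS).2.1⟩ hcon
  obtain ⟨k, -, -, hk⟩ := hl.exists_eq_some (T := s.queried)
    ⟨g, hg, (consistent_cons (z := (x, !y))).2 ⟨hgy, hc⟩⟩
  cases y
  · simp only [Bool.not_false] at hk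
    simp [dhmDecide, hk, hy] at hd
  · simp only [Bool.not_true] at hk
    simp [dhmDecide, hk, hy] at hd

theorem IsLearner.exists_consistent_state (hl : IsLearner F learn) (hF : F.Nonempty) (δ : ℝ)
    (n : ℕ) (ω : ℕ → X × Bool) (u : ℕ) :
    (dhmState F learn δ n ω u).queried.length ≤ n ∧
      ∃ g ∈ F, Consistent g (dhmState F learn δ n ω u).inferred := by
  induction u with
  | zero =>
    obtain ⟨g, hg⟩ := hF
    exact ⟨by simp [dhmState], g, hg, by simp [dhmState, Consistent]⟩
  | succ u ih =>
    rw [dhmState, dhmStep]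
    split_ifs with hn
    · exact ih
    · split
      · next y hd => exact ⟨ih.1, hl.exists_consistent_of_decide ih.2 hd⟩
      · exact ⟨by simp only [List.length_cons]; omega, ih.2⟩

theorem IsLearner.requests_le_and_output (hl : IsLearner F learn) (hF : F.Nonempty) (δ : ℝ)
    (n : ℕ) (ω : ℕ → X × Bool) (u : ℕ) :
    dhmRequests F learn δ n u ω ≤ n ∧ ∃ h ∈ F, dhmOutput F learn δ n u ω = some h := by
  obtain ⟨h1, h2⟩ := hl.exists_consistent_state hF δ n ω u
  obtain ⟨g, hg, -, h3⟩ := hl.exists_eq_some (T := (dhmState F learn δ n ω u).queried) h2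
  exact ⟨h1, g, hg, h3⟩

theorem decide_eq_none {δ : ℝ} {s : State X} {x : X}
    (hd : dhmDecide F learn δ s x = none) (y : Bool) :
    ∃ h₁ h₂, learn ((x, y) :: s.inferred) s.queried = some h₁ ∧
      learn ((x, !y) :: s.inferred) s.queried = some h₂ ∧
      empErr h₂ s.all - empErr h₁ s.all ≤ dhmDelta F δ s h₁ h₂ := by
  unfold dhmDecide at hd
  split at hd
  · simp at hd
  · simp at hd
  · next hp hm e1 e2 =>
    split_ifs at hd with c1 c2
    push Not at c1 c2
    cases y
    · refine ⟨hm, hp, e2, e1, c2.trans_eq ?_⟩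
      unfold dhmDelta; ring
    · exact ⟨hp, hm, e1, e2, c1⟩

theorem decide_eq_some {δ : ℝ} {s : State X} {x : X} {y : Bool}
    (hd : dhmDecide F learn δ s x = some y) :
    learn ((x, !y) :: s.inferred) s.queried = none ∨
    ∃ h₁ h₂, learn ((x, y) :: s.inferred) s.queried = some h₁ ∧
      learn ((x, !y) :: s.inferred) s.queried = some h₂ ∧
      dhmDelta F δ s h₁ h₂ < empErr h₂ s.all - empErr h₁ s.all := by
  unfold dhmDecide at hd
  split at hd
  · next e1 =>
    cases hd
    exact Or.inl e1
  · next e1 e2 =>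
    cases hd
    exact Or.inl e1
  · next hp hm e1 e2 =>
    split_ifs at hd with c1 c2
    · cases hd
      exact Or.inr ⟨hp, hm, e1, e2, c1⟩
    · cases hd
      refine Or.inr ⟨hm, hp, e2, e1, lt_of_eq_of_lt ?_ c2⟩
      unfold dhmDelta; ring

end Learner

/-! ### Empirical errors when the inferred labels follow f*. -/

/-- The event that `h` errs and `h'` does not. -/
def errPair (h h' : X → Bool) (z : X × Bool) : Bool :=
  (h z.1 != z.2) && (h' z.1 == z.2)

theorem hits_eq_countP {Z : Type*} (g : Z → Bool) (ω : ℕ → Z) (m : ℕ) :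
    hits g (fun i : Fin m => ω i) = ((List.range m).map ω).countP g := by
  induction m with
  | zero => simp [hits]
  | succ m ih =>
    rw [List.range_succ, List.map_append, List.countP_append, ← ih]
    simp only [hits, Fin.sum_univ_castSucc, Fin.val_castSucc, Fin.val_last, List.map_cons,
      List.map_nil, List.countP_singleton]
    cases g (ω m) <;> simp

theorem countP_errPair_add (h h' : X → Bool) (Z : List (X × Bool)) :
    Z.countP (fun z => h z.1 != z.2) + Z.countP (errPair h' h) =
      Z.countP (fun z => h' z.1 != z.2) + Z.countP (errPair h h') := by
  induction Z with
  | nil => simp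
  | cons z Z ih =>
    rcases z with ⟨x, y⟩
    simp only [List.countP_cons]
    have e : ∀ a b : X → Bool, errPair a b (x, y) = ((a x != y) && (b x == y)) := fun _ _ => rfl
    rw [e, e]
    cases h x <;> cases h' x <;> cases y <;> simp <;> omega

theorem empErr_le_one (h : X → Bool) (Z : List (X × Bool)) : empErr h Z ≤ 1 := by
  unfold empErr
  refine div_le_one_of_le₀ ?_ (by positivity)
  exact_mod_cast List.countP_le_length

theorem empErr_nonneg (h : X → Bool) (Z : List (X × Bool)) : 0 ≤ empErr h Z := by
  unfold empErr; positivity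

theorem countP_le_of_empErr_le {h h' : X → Bool} {T : List (X × Bool)}
    (hle : empErr h T ≤ empErr h' T) :
    T.countP (fun z => h z.1 != z.2) ≤ T.countP (fun z => h' z.1 != z.2) := by
  rcases Nat.eq_zero_or_pos T.length with h0 | h0
  · rw [List.length_eq_zero_iff] at h0
    simp [h0]
  · unfold empErr at hle
    have : (0 : ℝ) < T.length := by exact_mod_cast h0
    rw [div_le_div_iff_of_pos_right this] at hle
    exact_mod_cast hle

/-- The state `s` is obtained from the first `m` examples of `ω`, and all the inferred labels
agree with `f`. -/
structure Faithful (f : X → Bool) (ω : ℕ → X × Bool) (m : ℕ) (s : State X) : Prop where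
  exists_list : ∃ I : List (X × Bool), I.map (fun z => (z.1, f z.1)) = s.inferred ∧
    (I ++ s.queried).Perm ((List.range m).map ω)

namespace Faithful

variable {f : X → Bool} {ω : ℕ → X × Bool} {m : ℕ} {s : State X}

theorem length_all (hs : Faithful f ω m s) : s.all.length = m := by
  obtain ⟨I, h1, h2⟩ := hs.exists_list
  have := h2.length_eq
  simp only [List.length_append, List.length_map, List.length_range] at this
  simp [State.all, ← h1, this]

theorem consistent (hs : Faithful f ω m s) {g : X → Bool}
    (hg : ∀ i < m, g (ω i).1 = f (ω i).1) : Consistent g s.inferred := by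
  obtain ⟨I, h1, h2⟩ := hs.exists_list
  intro z hz
  rw [← h1, List.mem_map] at hz
  obtain ⟨w, hw, rfl⟩ := hz
  have : w ∈ (List.range m).map ω := h2.subset (List.mem_append_left _ hw)
  rw [List.mem_map] at this
  obtain ⟨i, hi, rfl⟩ := this
  exact hg i (List.mem_range.1 hi)

theorem empErr_all (hs : Faithful f ω m s) {h : X → Bool} (hc : Consistent h s.inferred) :
    empErr h s.all = (s.queried.countP (fun z => h z.1 != z.2) : ℝ) / m := by
  unfold empErr
  rw [hs.length_all, State.all, List.countP_append]
  have : s.inferred.countP (fun z => h z.1 != z.2) = 0 := by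
    rw [List.countP_eq_zero]
    intro z hz
    simp [hc z hz]
  rw [this, zero_add]

theorem hits_eq (hs : Faithful f ω m s) {g : X × Bool → Bool}
    (hg : ∀ z : X × Bool, (z.1, f z.1) ∈ s.inferred → g z = false) :
    hits g (fun i : Fin m => ω i) = s.queried.countP g := by
  obtain ⟨I, h1, h2⟩ := hs.exists_list
  rw [hits_eq_countP, ← h2.countP_eq, List.countP_append]
  have : I.countP g = 0 := by
    rw [List.countP_eq_zero]
    intro z hz
    rw [hg z]
    · simp
    · rw [← h1, List.mem_map]
      exact ⟨z, hz, rfl⟩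
  rw [this, zero_add]

/-- Two hypotheses consistent with the inferred examples agree there, so the event never occurs on
them, whatever their true labels. -/
theorem hits_errPair (hs : Faithful f ω m s) {h h' : X → Bool}
    (hc : Consistent h s.inferred) (hc' : Consistent h' s.inferred) :
    hits (errPair h h') (fun i : Fin m => ω i) = s.queried.countP (errPair h h') := by
  refine hs.hits_eq fun z hz => ?_
  have e1 := hc _ hz
  have e2 := hc' _ hz
  simp only at e1 e2
  simp only [errPair, e1, e2]
  cases f z.1 <;> cases z.2 <;> rfl

theorem hits_errPair_le (hs : Faithful f ω m s) {h h' : X → Bool}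
    (hc : Consistent h s.inferred) (hc' : Consistent h' s.inferred) :
    (hits (errPair h h') (fun i : Fin m => ω i) : ℝ) / m ≤ empErr h s.all := by
  rw [hs.empErr_all hc, hs.hits_errPair hc hc']
  gcongr
  refine List.countP_mono_left fun z _ hz => ?_
  simp only [errPair, Bool.and_eq_true] at hz
  exact hz.1

/-- The bias caused by inferred labels cancels in differences. This is what allows deviation bounds
for the true sample to govern the algorithm's comparisons. -/
theorem empErr_sub (hs : Faithful f ω m s) {h h' : X → Bool}
    (hc : Consistent h s.inferred) (hc' : Consistent h' s.inferred) :
    empErr h s.all - empErr h' s.all =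
      (hits (errPair h h') (fun i : Fin m => ω i) : ℝ) / m -
        (hits (errPair h' h) (fun i : Fin m => ω i) : ℝ) / m := by
  rw [hs.empErr_all hc, hs.empErr_all hc', hs.hits_errPair hc hc', hs.hits_errPair hc' hc]
  have := countP_errPair_add h h' s.queried
  rw [← sub_div, ← sub_div]
  congr 1
  have h2 : ((s.queried.countP (fun z => h z.1 != z.2) + s.queried.countP (errPair h' h) : ℕ) : ℝ)
    = (s.queried.countP (fun z => h' z.1 != z.2) + s.queried.countP (errPair h h') : ℕ) := by
    rw [this]
  push_cast at h2
  linarith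

/-- Replacing true labels by those of `f` can only remove errors of a hypothesis that agrees with
`f` on the sample. -/
theorem empErr_le_hits (hs : Faithful f ω m s) {g : X → Bool}
    (hg : ∀ i < m, g (ω i).1 = f (ω i).1) :
    empErr g s.all ≤ (hits (fun z => f z.1 != z.2) (fun i : Fin m => ω i) : ℝ) / m := by
  rw [hs.empErr_all (hs.consistent hg)]
  have e : hits (fun z : X × Bool => f z.1 != z.2) (fun i : Fin m => ω i) =
      hits (fun z : X × Bool => g z.1 != z.2) (fun i : Fin m => ω i) := by
    unfold hits
    exact Finset.sum_congr rfl fun i _ => by simp only [hg i i.2]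
  rw [e, hits_eq_countP]
  obtain ⟨I, h1, h2⟩ := hs.exists_list
  rw [← h2.countP_eq, List.countP_append]
  gcongr
  omega

theorem learn_minimal (hs : Faithful f ω m s) {F : Set (X → Bool)}
    {learn : List (X × Bool) → List (X × Bool) → Option (X → Bool)} (hl : IsLearner F learn)
    {S : List (X × Bool)} (hS : s.inferred ⊆ S) {h g : X → Bool}
    (hh : learn S s.queried = some h) (hg : g ∈ F) (hc : Consistent g S) :
    empErr h s.all ≤ empErr g s.all := by
  obtain ⟨-, h2, h3⟩ := (hl S s.queried).1 h hh
  rw [hs.empErr_all fun z hz => h2 z (hS hz), hs.empErr_all fun z hz => hc z (hS hz)]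
  have := countP_le_of_empErr_le (h3 g hg hc)
  gcongr

end Faithful

/-- The lower deviation bound is self-referential: p - a ≤ β√p. Solving it gives √p ≤ β + √a, so p
may be replaced by its empirical counterpart a at the cost of β². -/
theorem le_add_of_deviation {m β c₁ p₁ c₂ p₂ e₁ e₂ : ℝ} (hm : 0 < m) (hβ : 0 ≤ β)
    (hc₁ : 0 ≤ c₁) (hc₂ : 0 ≤ c₂) (hp₂ : 0 ≤ p₂)
    (h1 : c₁ - m * p₁ ≤ Real.sqrt (m * β ^ 2 * c₁))
    (h2 : m * p₂ - c₂ ≤ Real.sqrt (m * β ^ 2 * (m * p₂)))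
    (he₁ : c₁ / m ≤ e₁) (he₂ : c₂ / m ≤ e₂) :
    c₁ / m - c₂ / m ≤ p₁ - p₂ + β ^ 2 + β * (Real.sqrt e₁ + Real.sqrt e₂) := by
  obtain ⟨a₁, rfl⟩ : ∃ a, c₁ = m * a := ⟨c₁ / m, by field_simp⟩
  obtain ⟨a₂, rfl⟩ : ∃ a, c₂ = m * a := ⟨c₂ / m, by field_simp⟩
  have ha₁ : 0 ≤ a₁ := nonneg_of_mul_nonneg_right hc₁ hm
  have ha₂ : 0 ≤ a₂ := nonneg_of_mul_nonneg_right hc₂ hm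
  rw [mul_div_cancel_left₀ _ hm.ne'] at he₁ he₂ ⊢
  rw [mul_div_cancel_left₀ _ hm.ne']
  have key : ∀ a : ℝ, Real.sqrt (m * β ^ 2 * (m * a)) = m * (β * Real.sqrt a) := by
    intro a
    rw [show m * β ^ 2 * (m * a) = (m * β) ^ 2 * a by ring, Real.sqrt_mul (by positivity),
      Real.sqrt_sq (by positivity)]
    ring
  rw [key, ← mul_sub] at h1 h2
  have h1 := le_of_mul_le_mul_left h1 hm
  have h2 := le_of_mul_le_mul_left h2 hm
  have s1 : Real.sqrt a₁ ≤ Real.sqrt e₁ := Real.sqrt_le_sqrt he₁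
  have s2 : Real.sqrt a₂ ≤ Real.sqrt e₂ := Real.sqrt_le_sqrt he₂
  have h3 : Real.sqrt p₂ ≤ β + Real.sqrt a₂ := by
    by_contra hcon
    push Not at hcon
    have q1 := Real.sq_sqrt hp₂
    have q2 := Real.sq_sqrt ha₂
    have q3 := Real.sqrt_nonneg a₂
    nlinarith
  nlinarith [mul_le_mul_of_nonneg_left h3 hβ, mul_le_mul_of_nonneg_left s1 hβ,
    mul_le_mul_of_nonneg_left s2 hβ]

theorem dhmBeta_nonneg (F : Set (X → Bool)) (δ : ℝ) (m : ℕ) : 0 ≤ dhmBeta F δ m :=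
  Real.sqrt_nonneg _

/-! ### The run on a favourable outcome. -/

section Run

variable [MeasurableSpace X]

theorem errPair_real_sub {P : Measure (X × Bool)} [IsProbabilityMeasure P] {h h' : X → Bool}
    (hh : Measurable h) (hh' : Measurable h') :
    P.real {z | errPair h h' z = true} - P.real {z | errPair h' h z = true} =
      er P h - er P h' := by
  have hm : ∀ {h : X → Bool}, Measurable h → MeasurableSet {z : X × Bool | h z.1 ≠ z.2} :=
    fun hh => (measurableSet_eq_fun (hh.comp measurable_fst) measurable_snd).compl
  have e : ∀ h h' : X → Bool, {z : X × Bool | errPair h h' z = true} =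
      {z | h z.1 ≠ z.2} \ {z | h' z.1 ≠ z.2} := by
    intro h h'
    ext z
    simp [errPair]
  have h1 := measureReal_sdiff_add_inter (μ := P) (s := {z : X × Bool | h z.1 ≠ z.2}) (hm hh')
  have h2 := measureReal_sdiff_add_inter (μ := P) (s := {z : X × Bool | h' z.1 ≠ z.2}) (hm hh)
  rw [inter_comm] at h2
  rw [e, e]
  unfold er
  linarith

/-- The favourable outcomes: relative deviation bounds for the differences of the errors, a bound
on the empirical error of `f`, approximation of `f` on finite samples. -/
structure Favourable (F : Set (X → Bool)) (P : Measure (X × Bool)) (f : X → Bool) (δ : ℝ)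
    (ω : ℕ → X × Bool) : Prop where
  upper : ∀ m : ℕ, 1 ≤ m → dhmBeta F δ m < 1 → ∀ h ∈ F, ∀ h' ∈ F,
    (hits (errPair h h') (fun i : Fin m => ω i) : ℝ) - m * P.real {z | errPair h h' z = true} ≤
      Real.sqrt (m * dhmBeta F δ m ^ 2 * hits (errPair h h') (fun i : Fin m => ω i))
  lower : ∀ m : ℕ, 1 ≤ m → dhmBeta F δ m < 1 → ∀ h ∈ F, ∀ h' ∈ F,
    m * P.real {z | errPair h h' z = true} - (hits (errPair h h') (fun i : Fin m => ω i) : ℝ) ≤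
      Real.sqrt (m * dhmBeta F δ m ^ 2 * (m * P.real {z | errPair h h' z = true}))
  hits_le : ∀ m : ℕ, 1 ≤ m → dhmBeta F δ m < 1 →
    (hits (fun z => f z.1 != z.2) (fun i : Fin m => ω i) : ℝ) ≤
      m * (2 * er P f + dhmBeta F δ m ^ 2)
  approx : ∀ (M : ℕ) (η : ℝ), 0 < η →
    ∃ g ∈ F, (∀ i < M, g (ω i).1 = f (ω i).1) ∧ er P g ≤ er P f + η

variable {F : Set (X → Bool)} {P : Measure (X × Bool)} {f : X → Bool}
  {δ : ℝ} {ω : ℕ → X × Bool} {m n : ℕ} {s : State X}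
  {learn : List (X × Bool) → List (X × Bool) → Option (X → Bool)}

theorem Favourable.empErr_le (hG : Favourable F P f δ ω)
    (hs : Faithful f ω m s) (hm : 1 ≤ m) (hβ : dhmBeta F δ m < 1) {g : X → Bool}
    (hg : ∀ i < m, g (ω i).1 = f (ω i).1) :
    empErr g s.all ≤ 2 * er P f + dhmBeta F δ m ^ 2 := by
  refine (hs.empErr_le_hits hg).trans ?_
  have : (0 : ℝ) < m := by exact_mod_cast hm
  rw [div_le_iff₀ this, mul_comm]
  exact hG.hits_le m hm hβ

variable [IsProbabilityMeasure P]

theorem Favourable.empErr_sub_le (hG : Favourable F P f δ ω) (hF : ∀ h ∈ F, Measurable h)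
    (hs : Faithful f ω m s) (hm : 1 ≤ m) (hβ : dhmBeta F δ m < 1) {h h' : X → Bool}
    (hh : h ∈ F) (hh' : h' ∈ F) (hc : Consistent h s.inferred)
    (hc' : Consistent h' s.inferred) :
    empErr h s.all - empErr h' s.all ≤ er P h - er P h' + dhmBeta F δ m ^ 2 +
      dhmBeta F δ m * (Real.sqrt (empErr h s.all) + Real.sqrt (empErr h' s.all)) := by
  rw [hs.empErr_sub hc hc', ← errPair_real_sub (hF h hh) (hF h' hh')]
  exact le_add_of_deviation (by exact_mod_cast hm) (dhmBeta_nonneg _ _ _) (by positivity)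
    (by positivity) measureReal_nonneg (hG.upper m hm hβ h hh h' hh')
    (hG.lower m hm hβ h' hh' h hh) (hs.hits_errPair_le hc hc') (hs.hits_errPair_le hc' hc)

/-- On favourable outcomes the inferred labels agree with `f`. -/
theorem Favourable.decide_eq (hG : Favourable F P f δ ω) (hF : ∀ h ∈ F, Measurable h)
    (hf : IsInfimal F P f) (hl : IsLearner F learn) (hs : Faithful f ω m s) {y : Bool}
    (hd : dhmDecide F learn δ s (ω m).1 = some y) : y = f (ω m).1 := by
  by_contra hne
  have hy : (!y) = f (ω m).1 := by
    revert hne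
    cases y <;> cases f (ω m).1 <;> simp
  have hcons : ∀ g : X → Bool, (∀ i < m + 1, g (ω i).1 = f (ω i).1) →
      Consistent g (((ω m).1, !y) :: s.inferred) := fun g hg =>
    consistent_cons.2 ⟨by rw [hy]; exact hg m (by omega),
      hs.consistent fun i hi => hg i (by omega)⟩
  rcases decide_eq_some hd with h0 | ⟨h₁, h₂, e1, e2, hlt⟩
  · obtain ⟨g, hg, hgf, -⟩ := hG.approx (m + 1) 1 one_pos
    exact (hl _ _).2 h0 g hg (hcons g hgf)
  · set β := dhmBeta F δ m with hβd
    have hβ0 : 0 ≤ β := dhmBeta_nonneg _ _ _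
    have hD : dhmDelta F δ s h₁ h₂ =
        β ^ 2 + β * (Real.sqrt (empErr h₁ s.all) + Real.sqrt (empErr h₂ s.all)) := by
      unfold dhmDelta
      rw [hs.length_all]
    rw [hD] at hlt
    have q1 := Real.sqrt_nonneg (empErr h₁ s.all)
    have q2 := Real.sqrt_nonneg (empErr h₂ s.all)
    have n1 := empErr_nonneg h₁ s.all
    have n2 := empErr_nonneg h₂ s.all
    have l2 := empErr_le_one h₂ s.all
    -- For β ≥ 1 the threshold is at least 1, and no difference of empirical errors exceeds it.
    have hβ1 : β < 1 := by
      by_contra hcon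
      push Not at hcon
      nlinarith [mul_nonneg hβ0 (add_nonneg q1 q2)]
    -- On the empty sample all empirical errors are 0 by convention, so a comparison cannot lead to
    -- an inference.
    have hm : 1 ≤ m := by
      by_contra hcon
      have hlen := hs.length_all
      have hm0 : m = 0 := by omega
      rw [hm0, List.length_eq_zero_iff] at hlen
      rw [hlen] at hlt
      simp only [empErr, List.countP_nil, List.length_nil, Nat.cast_zero, div_zero,
        Real.sqrt_zero] at hlt
      nlinarith
    -- The strict excess over the threshold absorbs the error made in approximating `f` from within
    -- `F`.
    set gap := empErr h₂ s.all - empErr h₁ s.all -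
      (β ^ 2 + β * (Real.sqrt (empErr h₁ s.all) + Real.sqrt (empErr h₂ s.all))) with hgap
    have hgap0 : 0 < gap := by linarith
    obtain ⟨g, hg, hgf, hger⟩ := hG.approx (m + 1) (gap / 2) (by positivity)
    obtain ⟨m1, m2, -⟩ := (hl _ _).1 h₁ e1
    have hK := hG.empErr_sub_le hF hs hm hβ1 hg m1
      (hs.consistent fun i hi => hgf i (by omega)) (consistent_cons.1 m2).2
    have hmin := hs.learn_minimal hl (by simp) e2 hg (hcons g hgf)
    have hinf : er P f ≤ er P h₁ := hf.isGLB_er.1 ⟨h₁, m1, rfl⟩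
    -- monotonicity of `a ↦ a - β √a` above `β²`
    have hmono : empErr h₂ s.all - β * Real.sqrt (empErr h₂ s.all) ≤
        empErr g s.all - β * Real.sqrt (empErr g s.all) := by
      have r1 := Real.sq_sqrt n2
      have r2 := Real.sq_sqrt (n2.trans hmin)
      have r3 := Real.sqrt_le_sqrt hmin
      have r4 : β ≤ Real.sqrt (empErr h₂ s.all) := by
        apply Real.le_sqrt_of_sq_le
        nlinarith [mul_nonneg hβ0 (add_nonneg q1 q2)]
      nlinarith
    nlinarith

/-- On favourable outcomes, if a label is requested then some hypothesis near `f` disagrees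
with `f` at the instance. -/
theorem Favourable.decide_none (hG : Favourable F P f δ ω) (hF : ∀ h ∈ F, Measurable h)
    (hl : IsLearner F learn) (hs : Faithful f ω m s) {η : ℝ}
    (hη : 0 < η) (hd : dhmDecide F learn δ s (ω m).1 = none) :
    ∃ h ∈ F, h (ω m).1 ≠ f (ω m).1 ∧ (m = 0 ∨
      P.real {z | h z.1 ≠ f z.1} ≤ 10 * er P f + η + 12 * dhmBeta F δ m ^ 2) := by
  obtain ⟨h₁, h₂, e1, e2, hle⟩ := decide_eq_none hd (f (ω m).1)
  obtain ⟨m1, m1c, -⟩ := (hl _ _).1 h₁ e1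
  obtain ⟨m2, m2c, -⟩ := (hl _ _).1 h₂ e2
  rw [consistent_cons] at m1c m2c
  refine ⟨h₂, m2, ?_, ?_⟩
  · rw [m2c.1]
    cases f (ω m).1 <;> simp
  rcases Nat.eq_zero_or_pos m with hm0 | hm
  · exact Or.inl hm0
  right
  set β := dhmBeta F δ m with hβd
  have hβ0 : 0 ≤ β := dhmBeta_nonneg _ _ _
  have hν0 : 0 ≤ er P f := measureReal_nonneg
  by_cases hβ1 : β < 1
  · have hD : dhmDelta F δ s h₁ h₂ =
        β ^ 2 + β * (Real.sqrt (empErr h₁ s.all) + Real.sqrt (empErr h₂ s.all)) := by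
      unfold dhmDelta
      rw [hs.length_all]
    rw [hD] at hle
    obtain ⟨g, hg, hgf, hger⟩ := hG.approx (m + 1) η hη
    have hgc : Consistent g s.inferred := hs.consistent fun i hi => hgf i (by omega)
    have hmin := hs.learn_minimal hl (by simp) e1 hg (consistent_cons.2 ⟨hgf m (by omega), hgc⟩)
    have hK := hG.empErr_sub_le hF hs hm hβ1 hg m2 hgc m2c.2
    have he := hG.empErr_le hs hm hβ1 fun i hi => hgf i (by omega)
    rw [← hβd] at hK he
    have tri : P.real {z : X × Bool | h₂ z.1 ≠ f z.1} ≤ er P h₂ + er P f := by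
      refine (measureReal_mono (fun z hz => ?_)).trans (measureReal_union_le _ _)
      by_contra hcon
      simp only [mem_union, mem_ofPred_eq, not_or, not_not] at hcon hz
      exact hz (hcon.1.trans hcon.2.symm)
    set a := empErr h₂ s.all
    set e := empErr g s.all
    set e₁ := empErr h₁ s.all
    have a0 : 0 ≤ a := empErr_nonneg _ _
    have e0 : 0 ≤ e := empErr_nonneg _ _
    have r1 := Real.sq_sqrt a0
    have r2 := Real.sq_sqrt e0
    have r3 : Real.sqrt e₁ ≤ Real.sqrt e := Real.sqrt_le_sqrt hmin
    have b3 := mul_le_mul_of_nonneg_left r3 hβ0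
    have b1 : β * Real.sqrt a ≤ (β ^ 2 + a) / 2 := by
      nlinarith [sq_nonneg (β - Real.sqrt a)]
    have b2 : β * Real.sqrt e ≤ (β ^ 2 + e) / 2 := by
      nlinarith [sq_nonneg (β - Real.sqrt e)]
    -- The threshold gives a ≤ 3e + 4β², then the deviation bound gives er h₂ ≤ er g + 4e + 8β².
    -- With e ≤ 2ν + β², er g ≤ ν + η and the triangle inequality, the total is 10ν + η + 12β².
    nlinarith
  · push Not at hβ1
    have : P.real {z : X × Bool | h₂ z.1 ≠ f z.1} ≤ 1 := measureReal_le_one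
    nlinarith

/-- The run of the algorithm on a favourable outcome. -/
theorem Favourable.exists_faithful (hG : Favourable F P f δ ω) (hF : ∀ h ∈ F, Measurable h)
    (hf : IsInfimal F P f) (hl : IsLearner F learn) {η : ℝ} (hη : 0 < η)
    {D : ℕ → X × Bool → Bool}
    (hD : ∀ m, ∀ h ∈ F, (m = 0 ∨
      P.real {z | h z.1 ≠ f z.1} ≤ 10 * er P f + η + 12 * dhmBeta F δ m ^ 2) →
      ∀ z, h z.1 ≠ f z.1 → D m z = true) (n u : ℕ) :
    ∃ m ≤ u, Faithful f ω m (dhmState F learn δ n ω u) ∧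
      ((dhmState F learn δ n ω u).queried.length ≠ n → m = u) ∧
      (dhmState F learn δ n ω u).queried.length ≤ ∑ i ∈ Finset.range m, (D i (ω i)).toNat := by
  induction u with
  | zero =>
    exact ⟨0, le_rfl, ⟨[], by simp [dhmState], by simp [dhmState]⟩, by simp, by simp [dhmState]⟩
  | succ u ih =>
    obtain ⟨m, hmu, hs, hproc, hq⟩ := ih
    rw [dhmState, dhmStep]
    split_ifs with hn
    · exact ⟨m, by omega, hs, fun h => absurd hn h, hq⟩
    · obtain rfl := hproc hn
      obtain ⟨I, h1, h2⟩ := hs.exists_list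
      have hr : (List.range (m + 1)).map ω = (List.range m).map ω ++ [ω m] := by
        rw [List.range_succ]; simp
      refine ⟨m + 1, le_rfl, ?_, fun _ => rfl, ?_⟩
      · split
        · next y hd =>
          obtain rfl := hG.decide_eq hF hf hl hs hd
          refine ⟨ω m :: I, by simp [h1], ?_⟩
          rw [hr]
          exact (h2.cons (ω m)).trans (List.perm_append_singleton _ _).symm
        · refine ⟨I, h1, ?_⟩
          rw [hr]
          exact List.perm_middle.trans
            ((h2.cons (ω m)).trans (List.perm_append_singleton _ _).symm)
      · rw [Finset.sum_range_succ]
        split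
        · exact hq.trans (Nat.le_add_right _ _)
        · next hd =>
          obtain ⟨h, hh, hne, hP⟩ := hG.decide_none hF hl hs hη hd
          have := hD m h hh hP (ω m) hne
          simp only [List.length_cons, this, Bool.toNat_true]
          omega

/-- The error rate of the classifier produced on a favourable outcome. -/
theorem Favourable.er_le (hG : Favourable F P f δ ω) (hF : ∀ h ∈ F, Measurable h)
    (hl : IsLearner F learn) (hs : Faithful f ω m s) (hm : 1 ≤ m)
    (hβ : dhmBeta F δ m < 1) {h : X → Bool} (hh : learn s.inferred s.queried = some h) :
    er P h ≤ er P f + dhmBeta F δ m ^ 2 +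
      2 * dhmBeta F δ m * Real.sqrt (2 * er P f + dhmBeta F δ m ^ 2) := by
  refine le_of_forall_pos_le_add fun η hη => ?_
  obtain ⟨g, hg, hgf, hger⟩ := hG.approx m η hη
  have hgc := hs.consistent hgf
  obtain ⟨m1, m2, -⟩ := (hl _ _).1 h hh
  have hmin := hs.learn_minimal hl (List.Subset.refl _) hh hg hgc
  have hK := hG.empErr_sub_le hF hs hm hβ hg m1 hgc m2
  have he := hG.empErr_le hs hm hβ hgf
  have r1 := Real.sqrt_le_sqrt hmin
  have r2 := Real.sqrt_le_sqrt he
  have hβ0 := dhmBeta_nonneg F δ m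
  nlinarith [mul_le_mul_of_nonneg_left (r1.trans r2) hβ0, mul_le_mul_of_nonneg_left r2 hβ0]

end Run

/-! ### The growth function. -/

section Growth

variable {F : Set (X → Bool)}

theorem ncard_le_growth (F : Set (X → Bool)) {k : ℕ} (x : Fin k → X) :
    ({y : Fin k → Bool | ∃ h ∈ F, ∀ i, h (x i) = y i}).ncard ≤ growth F k := by
  refine le_ciSup (f := fun x : Fin k → X =>
    ({y : Fin k → Bool | ∃ h ∈ F, ∀ i, h (x i) = y i}).ncard) ⟨2 ^ k, ?_⟩ x
  rintro _ ⟨x, rfl⟩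
  refine (ncard_le_ncard (subset_univ _) finite_univ).trans ?_
  simp [ncard_univ]

theorem growth_pos [Nonempty X] (hF : F.Nonempty) (k : ℕ) : 0 < growth F k := by
  obtain ⟨h, hh⟩ := hF
  obtain ⟨x⟩ := ‹Nonempty X›
  refine lt_of_lt_of_le ?_ (ncard_le_growth F fun _ : Fin k => x)
  rw [ncard_pos (toFinite _)]
  exact ⟨_, h, hh, fun _ => rfl⟩

theorem card_le_of_shatters {d : ℕ} (hd : vcDim F = d) {A : Finset X} (hA : Shatters F A) :
    A.card ≤ d := by
  have : (A.card : ℕ∞) ≤ vcDim F :=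
    le_iSup₂ (f := fun (A : Finset X) (_ : A ∈ {A : Finset X | Shatters F A}) =>
      (A.card : ℕ∞)) A hA
  rw [hd] at this
  exact_mod_cast this

theorem subsingleton_of_vcDim_eq_zero (hd : vcDim F = 0) : F.Subsingleton := by
  intro h hh h' hh'
  by_contra hne
  obtain ⟨x, hx⟩ := Function.ne_iff.1 hne
  have : Shatters F {x} := by
    intro g
    by_cases hg : h x = g x
    · exact ⟨h, hh, by simpa using hg⟩
    · refine ⟨h', hh', ?_⟩
      simp only [Finset.mem_singleton, forall_eq]
      revert hx hg
      cases h x <;> cases h' x <;> cases g x <;> simp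
  have := card_le_of_shatters (d := 0) (by simpa using hd) this
  simp at this

/-- The Sauer-Shelah bound on the growth function. -/
theorem growth_le_sum_choose {d : ℕ} (hd : vcDim F = d) (k : ℕ) :
    growth F k ≤ ∑ i ∈ Finset.range (d + 1), k.choose i := by
  classical
  -- Over an empty index type the supremum defining the growth function is 0.
  rcases isEmpty_or_nonempty (Fin k → X) with hX | hX
  · unfold growth
    rw [ciSup_of_empty]
    exact bot_le
  refine ciSup_le fun x => ?_
  set Y := {y : Fin k → Bool | ∃ h ∈ F, ∀ i, h (x i) = y i} with hY
  have hYf : Y.Finite := toFinite _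
  set T : (Fin k → Bool) → Finset (Fin k) := fun y => Finset.univ.filter fun i => y i = true
  have hT : Function.Injective T := by
    intro y y' h
    funext i
    have := Finset.ext_iff.1 h i
    simp only [T, Finset.mem_filter, Finset.mem_univ, true_and] at this
    exact Bool.eq_iff_iff.2 this
  set 𝒜 := hYf.toFinset.image T with h𝒜
  have hc : Y.ncard = 𝒜.card := by
    rw [Finset.card_image_of_injective _ hT, ncard_eq_toFinset_card _ hYf]
  have hvc : 𝒜.vcDim ≤ d := by
    refine Finset.sup_le fun s hs => ?_
    rw [Finset.mem_shatterer] at hs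
    have hmem : ∀ g : Fin k → Bool, ∃ h ∈ F, ∀ i ∈ s, h (x i) = g i := by
      intro g
      obtain ⟨u, hu, hsu⟩ := hs (Finset.filter_subset (fun i => g i = true) s)
      simp only [h𝒜, Finset.mem_image, Finite.mem_toFinset, hY, mem_ofPred_eq] at hu
      obtain ⟨y, ⟨h, hh, hy⟩, rfl⟩ := hu
      refine ⟨h, hh, fun i hi => ?_⟩
      rw [hy i]
      have := Finset.ext_iff.1 hsu i
      simp only [T, Finset.mem_inter, Finset.mem_filter, Finset.mem_univ, true_and, hi] at this
      exact Bool.eq_iff_iff.2 this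
    -- A shattered set of indices carries distinct points, since some pattern separates any two of
    -- them.
    have hinj : InjOn x s := by
      intro i hi j hj hij
      by_contra hne
      obtain ⟨h, -, hh⟩ := hmem fun l => decide (l = i)
      have h1 := hh i hi
      have h2 := hh j hj
      rw [hij, h2] at h1
      simp [Ne.symm hne] at h1
    have hsh : Shatters F (s.image x) := by
      intro g
      obtain ⟨h, hh, hg⟩ := hmem fun i => g (x i)
      exact ⟨h, hh, by simpa using hg⟩
    have := card_le_of_shatters hd hsh
    rwa [Finset.card_image_of_injOn hinj] at this
  rw [hc]
  refine 𝒜.card_le_card_shatterer.trans (Finset.card_shatterer_le_sum_vcDim.trans ?_)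
  rw [Fintype.card_fin]
  refine Finset.sum_le_sum_of_subset fun i hi => ?_
  simp only [Finset.mem_Iic, Finset.mem_range] at hi ⊢
  omega

/-- Multiply the Sauer-Shelah sum by x^d and compare with the expansion of (1 + x)^k ≤ exp(kx).
Leaving `x` free gives a bound affine in `k`, valid for all `k` at once. -/
theorem log_growth_le {d : ℕ} (hd : vcDim F = d) {k : ℕ} (hpos : 0 < growth F k) {x : ℝ}
    (hx : 0 < x) (hx1 : x ≤ 1) :
    Real.log (growth F k) ≤ d * Real.log (1 / x) + k * x := by
  have h1 : x ^ d * growth F k ≤ Real.exp (k * x) := by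
    calc x ^ d * growth F k ≤ x ^ d * ∑ i ∈ Finset.range (d + 1), (k.choose i : ℝ) := by
          gcongr
          exact_mod_cast growth_le_sum_choose hd k
      _ = ∑ i ∈ Finset.range (d + 1), x ^ d * (k.choose i : ℝ) := by rw [Finset.mul_sum]
      _ ≤ ∑ i ∈ Finset.range (d + 1), x ^ i * (k.choose i : ℝ) := by
          refine Finset.sum_le_sum fun i hi => ?_
          have : x ^ d ≤ x ^ i :=
            pow_le_pow_of_le_one hx.le hx1 (by simp only [Finset.mem_range] at hi; omega)
          gcongr
      _ ≤ ∑ i ∈ Finset.range (max d k + 1), x ^ i * (k.choose i : ℝ) := by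
          refine Finset.sum_le_sum_of_subset_of_nonneg (fun i hi => ?_)
            fun i _ _ => by positivity
          simp only [Finset.mem_range] at hi ⊢
          omega
      _ = ∑ i ∈ Finset.range (k + 1), x ^ i * (k.choose i : ℝ) := by
          symm
          refine Finset.sum_subset (fun i hi => ?_) fun i _ hi => ?_
          · simp only [Finset.mem_range] at hi ⊢
            omega
          · simp only [Finset.mem_range, not_lt] at hi
            rw [Nat.choose_eq_zero_of_lt (by omega)]
            simp
      _ = (x + 1) ^ k := by
          rw [add_pow]
          simp
      _ ≤ Real.exp x ^ k := by
          gcongr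
          exact Real.add_one_le_exp x
      _ = Real.exp (k * x) := by rw [← Real.exp_nat_mul]
  have hg : (0 : ℝ) < growth F k := by exact_mod_cast hpos
  have h2 := Real.log_le_log (by positivity) h1
  rw [Real.log_exp, Real.log_mul (by positivity) hg.ne', Real.log_pow] at h2
  rw [one_div, Real.log_inv]
  linarith

end Growth

/-! ### The size of β. -/

/-- The logarithm that occurs in `dhmBeta`. -/
def dhmLog (F : Set (X → Bool)) (δ : ℝ) (m : ℕ) : ℝ :=
  Real.log (8 * ((m : ℝ) ^ 2 + m) * (growth F (2 * m) : ℝ) ^ 2 / δ)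

section Log

variable {F : Set (X → Bool)} {δ ε ν : ℝ} {m d : ℕ}

theorem log_32_le_dhmLog (hg : 0 < growth F (2 * m)) (hm : 1 ≤ m) (hδ : 0 < δ)
    (hδ1 : δ < 1 / 2) : Real.log 32 ≤ dhmLog F δ m := by
  refine Real.log_le_log (by norm_num) ?_
  have h1 : (1 : ℝ) ≤ m := by exact_mod_cast hm
  have h2 : (1 : ℝ) ≤ growth F (2 * m) := by exact_mod_cast hg
  rw [le_div_iff₀ hδ]
  have h3 : (2 : ℝ) ≤ (m : ℝ) ^ 2 + m := by nlinarith
  have h4 : (1 : ℝ) ≤ (growth F (2 * m) : ℝ) ^ 2 := by nlinarith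
  nlinarith

theorem mul_dhmBeta_sq (hg : 0 < growth F (2 * m)) (hm : 1 ≤ m) (hδ : 0 < δ)
    (hδ1 : δ < 1 / 2) : m * dhmBeta F δ m ^ 2 = 4 * dhmLog F δ m := by
  have h := log_32_le_dhmLog hg hm hδ hδ1
  have h0 : 0 ≤ Real.log 32 := Real.log_nonneg (by norm_num)
  have hm0 : (0 : ℝ) < m := by exact_mod_cast hm
  have e : dhmBeta F δ m = Real.sqrt (4 / m * dhmLog F δ m) := rfl
  rw [e, Real.sq_sqrt (mul_nonneg (by positivity) (h0.trans h))]
  field_simp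

theorem exp_neg_dhmLog (hg : 0 < growth F (2 * m)) (hm : 1 ≤ m) (hδ : 0 < δ) :
    Real.exp (-dhmLog F δ m) = δ / (8 * ((m : ℝ) ^ 2 + m) * (growth F (2 * m) : ℝ) ^ 2) := by
  have hm0 : (0 : ℝ) < m := by exact_mod_cast hm
  have hg0 : (0 : ℝ) < growth F (2 * m) := by exact_mod_cast hg
  unfold dhmLog
  rw [Real.exp_neg, Real.exp_log (by positivity), inv_div]

/-- The affine bounds for the logarithms of `m` and of the growth function are anchored at the scale
`W` (with x = d/W). One inequality then covers both regimes: order L up to `W`, and order Lm/W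
beyond. -/
theorem dhmLog_le (hd : vcDim F = d) (hd1 : 1 ≤ d) (hg : 0 < growth F (2 * m)) (hm : 1 ≤ m)
    (hδ : 0 < δ) (hδ1 : δ < 1 / 2) (hε : 0 < ε) (hε1 : ε < 1 / 2) (hν : 0 ≤ ν) (hν1 : ν ≤ 1)
    {L W : ℝ} (hL : L = d * Real.log (1 / ε) + Real.log (1 / δ))
    (hW : W = 4096 * L * (ν + ε) / ε ^ 2) :
    dhmLog F δ m ≤ 74 * L + 9 * L * (m / W) := by
  have hln := Real.log_two_gt_d9
  have hln' := Real.log_two_lt_d9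
  set l := Real.log (1 / ε) with hl
  set q := Real.log (1 / δ) with hq
  have hl2 : Real.log 2 ≤ l := Real.log_le_log (by norm_num) (by
    rw [le_div_iff₀ hε]; linarith)
  have hq2 : Real.log 2 ≤ q := Real.log_le_log (by norm_num) (by
    rw [le_div_iff₀ hδ]; linarith)
  have hdR : (1 : ℝ) ≤ d := by exact_mod_cast hd1
  have hm0 : (1 : ℝ) ≤ m := by exact_mod_cast hm
  have hg0 : (0 : ℝ) < growth F (2 * m) := by exact_mod_cast hg
  have hdl : d * Real.log 2 ≤ d * l := by gcongr
  have hd2 : Real.log 2 ≤ d * Real.log 2 := le_mul_of_one_le_left (by linarith) hdR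
  have hdL : d * Real.log 2 ≤ L - Real.log 2 := by linarith
  have hL0 : 0 < L := by linarith
  have hd145 : (d : ℝ) ≤ 1.45 * L := by nlinarith
  have hε2 : 1 / ε ≤ (ν + ε) / ε ^ 2 := by
    rw [div_le_div_iff₀ hε (by positivity)]; nlinarith
  have h2ε : 2 ≤ 1 / ε := by rw [le_div_iff₀ hε]; linarith
  have hWL : W = 4096 * L * ((ν + ε) / ε ^ 2) := by rw [hW]; ring
  have hWd : d ≤ W := by
    rw [hWL]
    have : 2 ≤ (ν + ε) / ε ^ 2 := h2ε.trans hε2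
    nlinarith
  have hW0 : 0 < W := by linarith
  have hd0 : (0 : ℝ) < d := by linarith
  -- Dividing L by d leaves log(1/ε) + log(1/δ)/d inside the logarithm. Bounding that logarithm
  -- linearly makes the factor d cancel, so that no product of d with log(1/δ) appears.
  have hWdlog : d * Real.log (W / d) ≤ 17 * L := by
    have hle : W / d ≤ 8192 * ((1 / ε) ^ 2 * (l + q / d)) := by
      rw [div_le_iff₀ hd0]
      have e : 8192 * ((1 / ε) ^ 2 * (l + q / d)) * d = 4096 * L * (2 / ε ^ 2) := by
        rw [hL]; field_simp; ring
      rw [e, hWL]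
      gcongr
      linarith
    have hlq : 0 < l + q / d := by
      have : 0 < q / d := div_pos (by linarith) hd0
      linarith
    have h1 := Real.log_le_log (by positivity) hle
    rw [Real.log_mul (by norm_num) (by positivity), Real.log_mul (by positivity) hlq.ne',
      Real.log_pow, ← hl] at h1
    have h2 := Real.log_le_sub_one_of_pos hlq
    have h3 : Real.log 8192 = 13 * Real.log 2 := by
      rw [show (8192 : ℝ) = 2 ^ 13 by norm_num, Real.log_pow]; norm_num
    rw [h3] at h1
    have h4 : Real.log (W / d) ≤ 13 * Real.log 2 + 3 * l + q / d := by
      push_cast at h1; linarith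
    have h5 : d * Real.log (W / d) ≤ d * (13 * Real.log 2 + 3 * l + q / d) := by gcongr
    have h6 : d * (13 * Real.log 2 + 3 * l + q / d) = 13 * (d * Real.log 2) + 3 * (d * l) + q := by
      field_simp
    rw [h6] at h5
    linarith
  have hlogd : Real.log d ≤ d := (Real.log_le_sub_one_of_pos hd0).trans (by linarith)
  have hlogW : Real.log W ≤ 18.45 * L := by
    have e : W = d * (W / d) := by field_simp
    have e2 : Real.log W = Real.log d + Real.log (W / d) := by
      rw [← Real.log_mul hd0.ne' (by positivity), ← e]
    have h7 : 0 ≤ Real.log (W / d) := Real.log_nonneg (by rw [le_div_iff₀ hd0]; linarith)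
    have h8 : Real.log (W / d) ≤ d * Real.log (W / d) := le_mul_of_one_le_left h7 hdR
    linarith
  have hlogm : Real.log m ≤ Real.log W + m / W := by
    have e : Real.log m = Real.log W + Real.log (m / W) := by
      rw [← Real.log_mul hW0.ne' (by positivity)]
      congr 1; field_simp
    have := Real.log_le_sub_one_of_pos (show 0 < m / W by positivity)
    linarith
  have hG := log_growth_le hd hg (x := d / W) (by positivity) (by
    rw [div_le_one hW0]; exact hWd)
  rw [one_div_div] at hG
  push_cast at hG
  have hexp : dhmLog F δ m ≤ Real.log 16 + 2 * Real.log m + q +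
      2 * Real.log (growth F (2 * m)) := by
    have : Real.log 16 + 2 * Real.log m + q + 2 * Real.log (growth F (2 * m)) =
        Real.log (16 * (m : ℝ) ^ 2 * (growth F (2 * m) : ℝ) ^ 2 * (1 / δ)) := by
      rw [Real.log_mul (by positivity) (by positivity),
        Real.log_mul (by positivity) (by positivity),
        Real.log_mul (by positivity) (by positivity), Real.log_pow, Real.log_pow, ← hq]
      push_cast
      ring
    rw [this]
    refine Real.log_le_log (by positivity) ?_
    rw [mul_one_div]
    have : (m : ℝ) ≤ (m : ℝ) ^ 2 := by nlinarith
    have : 8 * ((m : ℝ) ^ 2 + m) ≤ 16 * (m : ℝ) ^ 2 := by linarith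
    gcongr
  have h16 : Real.log 16 = 4 * Real.log 2 := by
    rw [show (16 : ℝ) = 2 ^ 4 by norm_num, Real.log_pow]; norm_num
  have hL2 : 2 * Real.log 2 ≤ L := by linarith
  have hql : q ≤ L - d * Real.log 2 := by linarith
  have hmW : 0 ≤ m / W := by positivity
  have h8 : 2 * (m : ℝ) * (d / W) = 2 * d * (m / W) := by ring
  rw [h8] at hG
  have h9 : 2 * (m / W) + 4 * d * (m / W) ≤ 9 * L * (m / W) := by
    rw [← add_mul]
    gcongr
    linarith
  rw [h16] at hexp
  linarith

/-- The correction 1/a - 1/b shifts the sum by one index, so that each step needs only 1/(b + 1) ≤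
log((b + 1)/b). -/
theorem sum_one_div_le {a b : ℕ} (ha : 1 ≤ a) (hab : a ≤ b) :
    ∑ i ∈ Finset.Ico a b, (1 : ℝ) / i ≤ 1 / a - 1 / b + Real.log (b / a) := by
  have ha0 : (0 : ℝ) < a := by exact_mod_cast ha
  induction b, hab using Nat.le_induction with
  | base => simp [div_self ha0.ne']
  | succ b hab ih =>
    have hb0 : (0 : ℝ) < b := by exact_mod_cast ha.trans hab
    rw [Finset.sum_Ico_succ_top hab]
    have h1 := Real.one_sub_inv_le_log_of_pos (show (0 : ℝ) < (b + 1) / b by positivity)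
    have h2 : Real.log (((b + 1 : ℕ) : ℝ) / a) = Real.log (b / a) + Real.log ((b + 1) / b) := by
      rw [← Real.log_mul (by positivity) (by positivity)]
      congr 1
      push_cast
      field_simp
    have h3 : 1 - ((b + 1 : ℝ) / b)⁻¹ = 1 / ((b + 1 : ℕ) : ℝ) := by
      push_cast
      field_simp
      ring
    rw [h2]
    linarith

end Log

/-! ### The probability of favourable outcomes. -/

theorem ncard_trace_le_growth (F : Set (X → Bool)) {ι : Type*} [Fintype ι] {k : ℕ}
    (hk : Fintype.card ι = k) (x : ι → X) :
    ({y : ι → Bool | ∃ h ∈ F, ∀ i, h (x i) = y i}).ncard ≤ growth F k := by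
  have e := (Fintype.equivFinOfCardEq hk).symm
  refine le_trans ?_ (ncard_le_growth F fun i => x (e i))
  refine ncard_le_ncard_of_injOn (fun y i => y (e i)) ?_ ?_ (toFinite _)
  · rintro y ⟨h, hh, hy⟩
    exact ⟨h, hh, fun i => hy (e i)⟩
  · intro y _ y' _ h
    funext i
    simpa using congrFun h (e.symm i)

/-- For fixed examples the pattern is determined by the two label patterns of `h` and `h'`; hence
the square of the growth function in β. -/
theorem ncard_errPair_le (F : Set (X → Bool)) {m : ℕ} (z : Fin m ⊕ Fin m → X × Bool) :
    ({y : Fin m ⊕ Fin m → Bool | ∃ g ∈ image2 errPair F F, ∀ i, g (z i) = y i}).ncard ≤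
      growth F (2 * m) ^ 2 := by
  set T := {y : Fin m ⊕ Fin m → Bool | ∃ h ∈ F, ∀ i, h (z i).1 = y i} with hT
  have hTc : T.ncard ≤ growth F (2 * m) :=
    ncard_trace_le_growth F (by simp; ring) fun i => (z i).1
  have hsub : {y : Fin m ⊕ Fin m → Bool | ∃ g ∈ image2 errPair F F, ∀ i, g (z i) = y i} ⊆
      (fun p : (Fin m ⊕ Fin m → Bool) × (Fin m ⊕ Fin m → Bool) =>
        fun i => (p.1 i != (z i).2) && (p.2 i == (z i).2)) '' (T ×ˢ T) := by
    rintro y ⟨_, ⟨h, hh, h', hh', rfl⟩, hy⟩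
    exact ⟨(fun i => h (z i).1, fun i => h' (z i).1),
      ⟨⟨h, hh, fun _ => rfl⟩, ⟨h', hh', fun _ => rfl⟩⟩, funext hy⟩
  refine (ncard_le_ncard hsub (toFinite _)).trans ((ncard_image_le (toFinite _)).trans ?_)
  rw [ncard_prod, sq]
  exact Nat.mul_le_mul hTc hTc

section

variable [MeasurableSpace X] {F : Set (X → Bool)} {P : Measure (X × Bool)}
  [IsProbabilityMeasure P] {f : X → Bool}

theorem measurable_errPair {h h' : X → Bool} (hh : Measurable h) (hh' : Measurable h') :
    Measurable (errPair h h') := by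
  have : Measurable fun p : Bool × Bool × Bool => (p.1 != p.2.2) && (p.2.1 == p.2.2) :=
    measurable_of_finite _
  exact this.comp ((hh.comp measurable_fst).prodMk
    ((hh'.comp measurable_fst).prodMk measurable_snd))

theorem nullMeasurableSet_errPair (hT : TraceMeasurable F P) {ι : Type*} [Fintype ι]
    (y : ι → Bool) :
    NullMeasurableSet {z : ι → X × Bool | ∃ g ∈ image2 errPair F F, ∀ i, g (z i) = y i}
      (Measure.pi fun _ => P) := by
  have : {z : ι → X × Bool | ∃ g ∈ image2 errPair F F, ∀ i, g (z i) = y i} =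
      ⋃ p : (ι → Bool) × (ι → Bool),
        ({z : ι → X × Bool | ∃ h ∈ F, ∀ i, h (z i).1 = p.1 i} ∩
          {z : ι → X × Bool | ∃ h ∈ F, ∀ i, h (z i).1 = p.2 i}) ∩
          ⋂ i, {z | ((p.1 i != (z i).2) && (p.2 i == (z i).2)) = y i} := by
    ext z
    simp only [mem_ofPred_eq, mem_iUnion, mem_inter_iff, mem_iInter]
    constructor
    · rintro ⟨_, ⟨h, hh, h', hh', rfl⟩, hy⟩
      exact ⟨(fun i => h (z i).1, fun i => h' (z i).1),
        ⟨⟨h, hh, fun _ => rfl⟩, ⟨h', hh', fun _ => rfl⟩⟩, hy⟩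
    · rintro ⟨⟨a, b⟩, ⟨⟨h, hh, ha⟩, ⟨h', hh', hb⟩⟩, hy⟩
      obtain rfl : (fun i => h (z i).1) = a := funext ha
      obtain rfl : (fun i => h' (z i).1) = b := funext hb
      exact ⟨_, ⟨h, hh, h', hh', rfl⟩, hy⟩
  rw [this]
  refine NullMeasurableSet.iUnion fun p =>
    ((nullMeasurableSet_trace hT p.1).inter (nullMeasurableSet_trace hT p.2)).inter
      (MeasurableSet.iInter fun i => ?_).nullMeasurableSet
  have h1 : Measurable fun b : Bool => (p.1 i != b) && (p.2 i == b) := measurable_of_finite _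
  exact (h1.comp (measurable_snd.comp (measurable_pi_apply i))) (measurableSet_singleton (y i))

/-- Draws almost surely cannot distinguish `f` from hypotheses of `F` close to it. -/
theorem ae_exists_approx (hf : IsInfimal F P f) :
    ∀ᵐ ω ∂(Measure.infinitePi fun _ : ℕ => P), ∀ (M : ℕ) (η : ℝ), 0 < η →
      ∃ g ∈ F, (∀ i < M, g (ω i).1 = f (ω i).1) ∧ er P g ≤ er P f + η := by
  have hex : ∀ k : ℕ, ∃ g ∈ F, P.real {z | g z.1 ≠ f z.1} < (1 / 2 : ℝ) ^ k := by
    intro k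
    by_contra hcon
    push Not at hcon
    have : (1 / 2 : ℝ) ^ k ≤ 0 := hf.isGLB_dist.2 (by
      rintro _ ⟨g, hg, rfl⟩
      exact hcon g hg)
    have h2 : (0 : ℝ) < (1 / 2 : ℝ) ^ k := by positivity
    linarith
  choose g hg hgP using hex
  -- Borel-Cantelli: along this sequence the hypotheses eventually agree with `f` at almost every
  -- point, hence at every draw.
  have hsum : ∑' k, P {z : X × Bool | g k z.1 ≠ f z.1} ≠ ⊤ := by
    have hle : ∀ k, P {z : X × Bool | g k z.1 ≠ f z.1} ≤ ENNReal.ofReal ((1 / 2 : ℝ) ^ k) := by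
      intro k
      rw [← ofReal_measureReal]
      exact ENNReal.ofReal_le_ofReal (hgP k).le
    refine ne_top_of_le_ne_top ?_ (ENNReal.tsum_le_tsum hle)
    exact (summable_geometric_two.tsum_ofReal_lt_top).ne
  have hae : ∀ᵐ z ∂P, ∀ᶠ k in Filter.atTop, g k z.1 = f z.1 := by
    filter_upwards [ae_eventually_notMem hsum] with z hz
    filter_upwards [hz] with k hk
    by_contra hne
    exact hk hne
  have hall : ∀ᵐ ω ∂(Measure.infinitePi fun _ : ℕ => P), ∀ i : ℕ,
      ∀ᶠ k in Filter.atTop, g k (ω i).1 = f (ω i).1 := by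
    rw [ae_all_iff]
    intro i
    exact (measurePreserving_eval_infinitePi (fun _ : ℕ => P) i).quasiMeasurePreserving.ae hae
  filter_upwards [hall] with ω hω M η hη
  have h1 : ∀ᶠ k in Filter.atTop, ∀ i ∈ Finset.range M, g k (ω i).1 = f (ω i).1 :=
    (Filter.eventually_all_finset _).2 fun i _ => hω i
  have h2 : ∀ᶠ k in Filter.atTop, (1 / 2 : ℝ) ^ k < η :=
    (tendsto_pow_atTop_nhds_zero_of_lt_one (by norm_num) (by norm_num)).eventually_lt_const hη
  obtain ⟨k, hk1, hk2⟩ := (h1.and h2).exists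
  refine ⟨g k, hg k, fun i hi => hk1 i (Finset.mem_range.2 hi), ?_⟩
  have tri : er P (g k) ≤ er P f + P.real {z : X × Bool | g k z.1 ≠ f z.1} := by
    refine (measureReal_mono (fun z hz => ?_)).trans (measureReal_union_le _ _)
    by_contra hcon
    simp only [mem_union, mem_ofPred_eq, not_or, not_not] at hcon hz
    exact hz (hcon.2.trans hcon.1)
  linarith [hgP k]

variable {δ : ℝ} {m : ℕ}

/-- The outcomes for which a deviation bound fails after `m` examples. -/
def deviationFails (F : Set (X → Bool)) (P : Measure (X × Bool)) (f : X → Bool) (δ : ℝ) (m : ℕ) :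
    Set (ℕ → X × Bool) :=
  {ω | (∃ g ∈ image2 errPair F F,
      Real.sqrt (m * dhmBeta F δ m ^ 2 * hits g (fun i : Fin m => ω i)) <
        hits g (fun i : Fin m => ω i) - m * P.real {z | g z = true}) ∨
    (∃ g ∈ image2 errPair F F,
      Real.sqrt (m * dhmBeta F δ m ^ 2 * (m * P.real {z | g z = true})) <
        m * P.real {z | g z = true} - hits g (fun i : Fin m => ω i)) ∨
    m * (2 * er P f + dhmBeta F δ m ^ 2) ≤
      hits (fun z => f z.1 != z.2) (fun i : Fin m => ω i)}

theorem exp_three_quarters_lt : Real.exp (3 / 4) < 2.13 := by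
  have h := Real.exp_one_lt_d9
  have h4 : Real.exp (3 / 4) ^ 4 = Real.exp 1 ^ 3 := by
    rw [← Real.exp_nat_mul, ← Real.exp_nat_mul]; norm_num
  by_contra hcon
  push Not at hcon
  have h5 : (2.13 : ℝ) ^ 4 ≤ Real.exp (3 / 4) ^ 4 := by gcongr
  have h6 : Real.exp 1 ^ 3 ≤ 2.7182818286 ^ 3 := by gcongr
  rw [h4] at h5
  norm_num at h5 h6
  linarith

theorem prob_deviationFails_le (hT : TraceMeasurable F P) (hF : ∀ h ∈ F, Measurable h)
    (hf : Measurable f) (hg : 0 < growth F (2 * m)) (hm : 1 ≤ m) (hδ : 0 < δ)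
    (hδ1 : δ < 1 / 2) :
    (Measure.infinitePi fun _ : ℕ => P) (deviationFails F P f δ m) ≤
      ENNReal.ofReal (5 * δ / ((m : ℝ) * (m + 1))) := by
  set G := growth F (2 * m) with hGd
  have hG1 : (1 : ℝ) ≤ G := by exact_mod_cast hg
  have hmR : (1 : ℝ) ≤ m := by exact_mod_cast hm
  set Λ := dhmLog F δ m with hΛ
  have hΛ32 := log_32_le_dhmLog hg hm hδ hδ1
  have hl32 : Real.log 32 = 5 * Real.log 2 := by
    rw [show (32 : ℝ) = 2 ^ 5 by norm_num, Real.log_pow]; norm_num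
  have hΛ3 : 3 ≤ Λ := by linarith [Real.log_two_gt_d9]
  have hA := mul_dhmBeta_sq hg hm hδ hδ1
  have hexp := exp_neg_dhmLog hg hm hδ
  rw [← hΛ] at hA hexp
  rw [← hGd] at hexp
  set q := δ / ((m : ℝ) * (m + 1)) with hq
  have hq0 : 0 < q := by positivity
  have hq1 : q ≤ 1 := by
    rw [hq, div_le_one (by positivity)]
    nlinarith
  have hexpG : (G : ℝ) ^ 2 * Real.exp (-Λ) = q / 8 := by
    rw [hexp, hq]
    field_simp
  have hexp0 : Real.exp (-Λ) ≤ q / 8 := by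
    rw [← hexpG]
    exact le_mul_of_one_le_left (Real.exp_pos _).le (by nlinarith)
  have hA9 : 9 ≤ 4 * Λ := by linarith
  have hmeas : ∀ g ∈ image2 errPair F F, Measurable g := by
    rintro _ ⟨h, hh, h', hh', rfl⟩
    exact measurable_errPair (hF h hh) (hF h' hh')
  -- With A = mβ² = 4Λ the factor exp(-A/4) cancels the number of traces exactly, leaving (9/8)
  -- exp(3/4) q < 2.4 q.
  have hbound : 9 * ((G ^ 2 : ℕ) : ℝ) * Real.exp (-(4 * Λ) / 4 + 3 / 4) ≤ 2.4 * q := by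
    rw [show -(4 * Λ) / 4 + 3 / 4 = -Λ + 3 / 4 by ring, Real.exp_add]
    push_cast
    have e := exp_three_quarters_lt
    have : 9 * (G : ℝ) ^ 2 * (Real.exp (-Λ) * Real.exp (3 / 4)) =
        9 * (q / 8) * Real.exp (3 / 4) := by rw [← hexpG]; ring
    rw [this]
    nlinarith
  have hmp := measurePreserving_comp_injective P (e := fun i : Fin m => (i : ℕ))
    Fin.val_injective
  have hpre : ∀ S : Set (Fin m → X × Bool),
      (Measure.infinitePi fun _ : ℕ => P) ((fun ω (i : Fin m) => ω i) ⁻¹' S) ≤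
        (Measure.pi fun _ => P) S := fun S => by
    rw [← hmp.map_eq]
    exact Measure.le_map_apply hmp.measurable.aemeasurable S
  have hu := (hpre _).trans ((prob_upper_deviation_le (P := P) (m := m) hA9 hmeas
    (fun y => nullMeasurableSet_errPair hT y) (ncard_errPair_le F)).trans
      (ENNReal.ofReal_le_ofReal hbound))
  have hlo := (hpre _).trans ((prob_lower_deviation_le (P := P) (m := m) hA9 hmeas
    (fun y => nullMeasurableSet_errPair hT y) (ncard_errPair_le F)).trans
      (ENNReal.ofReal_le_ofReal hbound))
  have hfm : Measurable fun z : X × Bool => f z.1 != z.2 := by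
    have : Measurable fun p : Bool × Bool => p.1 != p.2 := measurable_of_finite _
    exact this.comp ((hf.comp measurable_fst).prodMk measurable_snd)
  have hch := chernoff_count P (g := fun _ z => f z.1 != z.2) (fun _ => hfm) m
    (m * (2 * er P f + dhmBeta F δ m ^ 2))
  have her : P.real {z : X × Bool | (f z.1 != z.2) = true} = er P f := by
    unfold er
    congr 1
    ext z
    simp
  have hch2 : -(m * (2 * er P f + dhmBeta F δ m ^ 2)) + (Real.exp 1 - 1) *
      ∑ _i ∈ Finset.range m, P.real {z : X × Bool | (f z.1 != z.2) = true} ≤ -Λ := by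
    rw [her, mul_add, hA]
    simp only [Finset.sum_const, Finset.card_range, nsmul_eq_mul]
    have h := Real.exp_one_lt_d9
    have : 0 ≤ m * er P f := mul_nonneg (by positivity) measureReal_nonneg
    nlinarith
  have hcq : Real.exp (-(m * (2 * er P f + dhmBeta F δ m ^ 2)) + (Real.exp 1 - 1) *
      ∑ _i ∈ Finset.range m, P.real {z : X × Bool | (f z.1 != z.2) = true}) ≤ 0.2 * q :=
    (Real.exp_le_exp.2 hch2).trans (by linarith)
  have hc := hch.trans (ENNReal.ofReal_le_ofReal hcq)
  have hsplit : 5 * δ / ((m : ℝ) * (m + 1)) = 2.4 * q + (2.4 * q + 0.2 * q) := by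
    rw [hq]; ring
  rw [hsplit, ENNReal.ofReal_add (by positivity) (by positivity),
    ENNReal.ofReal_add (by positivity) (by positivity)]
  refine (measure_union_le _ _).trans (add_le_add ?_ ((measure_union_le _ _).trans
    (add_le_add ?_ ?_)))
  · rw [hA]
    exact hu
  · rw [hA]
    exact hlo
  · refine le_trans (measure_mono fun ω hω => ?_) hc
    refine le_trans (b := ((hits (fun z : X × Bool => f z.1 != z.2)
      (fun i : Fin m => ω i) : ℕ) : ℝ)) hω (le_of_eq ?_)
    simp [hits, Finset.sum_range]

theorem sum_one_div_mul_succ (a : ℕ) (ha : 0 < a) (N : ℕ) :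
    ∑ k ∈ Finset.range N, 1 / (((k + a : ℕ) : ℝ) * ((k + a : ℕ) + 1)) =
      1 / a - 1 / (N + a) := by
  have ha0 : (0 : ℝ) < a := by exact_mod_cast ha
  induction N with
  | zero => simp
  | succ N ih =>
    rw [Finset.sum_range_succ, ih]
    push_cast
    field_simp
    ring

theorem prob_not_favourable_le (hT : TraceMeasurable F P) (hF : ∀ h ∈ F, Measurable h)
    (hf : IsInfimal F P f) (hg : ∀ k, 0 < growth F k) (hδ : 0 < δ) (hδ1 : δ < 1 / 2) :
    (Measure.infinitePi fun _ : ℕ => P) {ω | ¬ Favourable F P f δ ω} ≤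
      ENNReal.ofReal (δ / 2) := by
  set μ := Measure.infinitePi fun _ : ℕ => P with hμ
  have hae := ae_exists_approx hf
  have hsub : {ω | ¬ Favourable F P f δ ω} ⊆
      {ω | ¬ ∀ (M : ℕ) (η : ℝ), 0 < η →
        ∃ g ∈ F, (∀ i < M, g (ω i).1 = f (ω i).1) ∧ er P g ≤ er P f + η} ∪
      ⋃ k : ℕ, deviationFails F P f δ (k + 14) := by
    intro ω hω
    by_contra hcon
    rw [mem_union, not_or, mem_iUnion, not_exists] at hcon
    obtain ⟨h1, h2⟩ := hcon
    have hbig : ∀ m : ℕ, 1 ≤ m → dhmBeta F δ m < 1 → ω ∉ deviationFails F P f δ m := by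
      intro m hm hβ
      have h32 := log_32_le_dhmLog (hg (2 * m)) hm hδ hδ1
      have hl32 : Real.log 32 = 5 * Real.log 2 := by
        rw [show (32 : ℝ) = 2 ^ 5 by norm_num, Real.log_pow]; norm_num
      have hA := mul_dhmBeta_sq (hg (2 * m)) hm hδ hδ1
      have hβ0 := dhmBeta_nonneg F δ m
      have hm0 : (0 : ℝ) < m := by exact_mod_cast hm
      -- β < 1 forces m ≥ 4 log 32 > 13. Starting the union bound at 14 makes the telescoping total
      -- at most 5δ/14 < δ/2.
      have h13 : (13 : ℝ) < m := by
        have : (m : ℝ) * dhmBeta F δ m ^ 2 ≤ m :=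
          mul_le_of_le_one_right hm0.le (by nlinarith)
        linarith [Real.log_two_gt_d9]
      have h14 : 14 ≤ m := by
        have : 13 < m := by exact_mod_cast h13
        omega
      have := h2 (m - 14)
      rwa [Nat.sub_add_cancel h14] at this
    refine hω ⟨fun m hm hβ h hh h' hh' => ?_, fun m hm hβ h hh h' hh' => ?_,
      fun m hm hβ => ?_, not_not.1 h1⟩
    · by_contra hcon
      push Not at hcon
      exact hbig m hm hβ (Or.inl ⟨_, ⟨h, hh, h', hh', rfl⟩, hcon⟩)
    · by_contra hcon
      push Not at hcon
      exact hbig m hm hβ (Or.inr (Or.inl ⟨_, ⟨h, hh, h', hh', rfl⟩, hcon⟩))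
    · by_contra hcon
      push Not at hcon
      exact hbig m hm hβ (Or.inr (Or.inr hcon.le))
  refine (measure_mono hsub).trans ((measure_union_le _ _).trans ?_)
  rw [show μ {ω | ¬ ∀ (M : ℕ) (η : ℝ), 0 < η →
        ∃ g ∈ F, (∀ i < M, g (ω i).1 = f (ω i).1) ∧ er P g ≤ er P f + η} = 0 from hae, zero_add]
  refine (measure_iUnion_le _).trans (ENNReal.tsum_le_of_sum_range_le fun N => ?_)
  refine (Finset.sum_le_sum fun k _ => prob_deviationFails_le hT hF hf.measurable
    (hg _) (by omega) hδ hδ1).trans ?_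
  rw [← ENNReal.ofReal_sum_of_nonneg fun k _ => by positivity]
  refine ENNReal.ofReal_le_ofReal ?_
  have h := sum_one_div_mul_succ 14 (by norm_num) N
  have e : ∀ k : ℕ, 5 * δ / (((k + 14 : ℕ) : ℝ) * ((k + 14 : ℕ) + 1)) =
      5 * δ * (1 / (((k + 14 : ℕ) : ℝ) * ((k + 14 : ℕ) + 1))) := fun k => by ring
  simp_rw [e]
  rw [← Finset.mul_sum, h]
  have : (0 : ℝ) < 1 / (N + (14 : ℕ)) := by positivity
  push_cast at this ⊢
  nlinarith

end

/-! ### Sample size and the expected number of requests. -/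

section Numeric

variable {F : Set (X → Bool)} {δ ε ν L W : ℝ} {m d : ℕ}

theorem dhmBeta_sq_le_of_le (hd : vcDim F = d) (hd1 : 1 ≤ d) (hg : 0 < growth F (2 * m))
    (hm : 1 ≤ m) (hδ : 0 < δ) (hδ1 : δ < 1 / 2) (hε : 0 < ε) (hε1 : ε < 1 / 2) (hν : 0 ≤ ν)
    (hν1 : ν ≤ 1) (hL : L = d * Real.log (1 / ε) + Real.log (1 / δ)) (hL0 : 0 < L)
    (hW : W = 4096 * L * (ν + ε) / ε ^ 2) (hmW : m ≤ W) :
    dhmBeta F δ m ^ 2 ≤ 332 * L * (1 / m) := by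
  have hm0 : (0 : ℝ) < m := by exact_mod_cast hm
  have h1 := dhmLog_le hd hd1 hg hm hδ hδ1 hε hε1 hν hν1 hL hW
  have h2 := mul_dhmBeta_sq hg hm hδ hδ1
  have h3 : m / W ≤ 1 := div_le_one_of_le₀ hmW (hm0.le.trans hmW)
  rw [mul_one_div, le_div_iff₀ hm0]
  nlinarith

/-- The constant 4096 in `W` is chosen so that 332/4096 ≤ 1/12, the form needed in `excess_le`. -/
theorem dhmBeta_sq_le_of_ge (hd : vcDim F = d) (hd1 : 1 ≤ d) (hg : 0 < growth F (2 * m))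
    (hm : 1 ≤ m) (hδ : 0 < δ) (hδ1 : δ < 1 / 2) (hε : 0 < ε) (hε1 : ε < 1 / 2) (hν : 0 ≤ ν)
    (hν1 : ν ≤ 1) (hL : L = d * Real.log (1 / ε) + Real.log (1 / δ)) (hL0 : 0 < L)
    (hW : W = 4096 * L * (ν + ε) / ε ^ 2) (hmW : W ≤ m) :
    dhmBeta F δ m ^ 2 * (ν + ε) ≤ ε ^ 2 / 12 := by
  have hm0 : (0 : ℝ) < m := by exact_mod_cast hm
  have h1 := dhmLog_le hd hd1 hg hm hδ hδ1 hε hε1 hν hν1 hL hW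
  have h2 := mul_dhmBeta_sq hg hm hδ hδ1
  have hW0 : 0 < W := by rw [hW]; positivity
  have h3 : 1 ≤ m / W := by rw [le_div_iff₀ hW0]; linarith
  have h4 : m * dhmBeta F δ m ^ 2 ≤ m * (332 * L / W) := by
    have : (m : ℝ) * (332 * L / W) = 332 * L * (m / W) := by ring
    rw [h2, this]
    nlinarith
  have h5 := le_of_mul_le_mul_left h4 hm0
  have h6 : 332 * L / W * (ν + ε) = 332 / 4096 * ε ^ 2 := by
    rw [hW]
    field_simp
  have h7 : dhmBeta F δ m ^ 2 * (ν + ε) ≤ 332 * L / W * (ν + ε) := by gcongr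
  nlinarith [sq_nonneg ε]

/-- The hypothesis gives b² ≤ ε/12 and b²(2ν + b²) ≤ (1/6 + 1/144) ε² = (5ε/12)², so the total is at
most 11ε/12. -/
theorem excess_le {b : ℝ} (hε : 0 < ε) (hν : 0 ≤ ν)
    (h : b ^ 2 * (ν + ε) ≤ ε ^ 2 / 12) :
    b ^ 2 + 2 * b * Real.sqrt (2 * ν + b ^ 2) ≤ ε := by
  have h1 : b ^ 2 ≤ ε / 12 := by nlinarith [mul_nonneg (sq_nonneg b) hν]
  have h2 : b ^ 2 * ν ≤ ε ^ 2 / 12 := by nlinarith [mul_nonneg (sq_nonneg b) hε.le]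
  have h3 : b * Real.sqrt (2 * ν + b ^ 2) ≤ 5 / 12 * ε := by
    refine abs_le_of_sq_le_sq' ?_ (by positivity) |>.2
    rw [mul_pow, Real.sq_sqrt (by positivity)]
    nlinarith [mul_self_nonneg (b ^ 2), sq_nonneg b]
  linarith

/-- The first ⌈L⌉ terms are bounded by 1 each. The harmonic sum then starts at L and yields log(M/L)
instead of log M, which is bounded in terms of ε alone. -/
theorem sum_le_of_le_one_div {p : ℕ → ℝ} {B a l : ℝ} {M : ℕ} (hp1 : ∀ m, p m ≤ 1)
    (hB : 0 ≤ B) (ha : 0 ≤ a) (hL : 1 ≤ L)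
    (hp : ∀ m, 1 ≤ m → m < M → p m ≤ B * (a + 4000 * L * (1 / m)))
    (hl : 0 ≤ l) (hM : Real.log (M / L) ≤ l) :
    ∑ m ∈ Finset.range M, p m ≤ L + 1 + B * (a * M + 4000 * L * (1 + l)) := by
  set m₀ := ⌈L⌉₊ with hm₀
  have h1 : L ≤ m₀ := Nat.le_ceil _
  have h2 : (m₀ : ℝ) ≤ L + 1 := (Nat.ceil_lt_add_one (by linarith)).le
  have h10 : (1 : ℝ) ≤ m₀ := hL.trans h1
  have h11 : 1 ≤ m₀ := by exact_mod_cast h10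
  have hfirst : ∀ k : ℕ, k ≤ m₀ → ∑ m ∈ Finset.range k, p m ≤ L + 1 := by
    intro k hk
    have : ∑ m ∈ Finset.range k, p m ≤ ∑ _m ∈ Finset.range k, 1 :=
      Finset.sum_le_sum fun m _ => hp1 m
    simp only [Finset.sum_const, Finset.card_range, nsmul_eq_mul, mul_one] at this
    have hk' : (k : ℝ) ≤ m₀ := by exact_mod_cast hk
    linarith
  rcases le_total M m₀ with hMm | hMm
  · have := hfirst M hMm
    have : 0 ≤ B * (a * M + 4000 * L * (1 + l)) := by positivity
    linarith
  · rw [← Finset.sum_range_add_sum_Ico p hMm]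
    refine add_le_add (hfirst m₀ le_rfl) ?_
    have hM0 : (0 : ℝ) < M := by
      have : m₀ ≤ (M : ℝ) := by exact_mod_cast hMm
      linarith
    calc ∑ m ∈ Finset.Ico m₀ M, p m
        ≤ ∑ m ∈ Finset.Ico m₀ M, B * (a + 4000 * L * (1 / m)) := by
          refine Finset.sum_le_sum fun m hm => ?_
          rw [Finset.mem_Ico] at hm
          exact hp m (by omega) hm.2
      _ = B * (((M - m₀ : ℕ) : ℝ) * a + 4000 * L * ∑ m ∈ Finset.Ico m₀ M, (1 : ℝ) / m) := by
          rw [← Finset.mul_sum, Finset.sum_add_distrib, ← Finset.mul_sum]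
          simp
      _ ≤ B * (a * M + 4000 * L * (1 + l)) := by
          have e1 := sum_one_div_le h11 hMm
          have e2 : (1 : ℝ) / m₀ ≤ 1 := by rw [div_le_one (by linarith)]; exact h10
          have e3 : (0 : ℝ) ≤ 1 / M := by positivity
          have e4 : Real.log (M / m₀) ≤ l := by
            refine (Real.log_le_log (by positivity) ?_).trans hM
            gcongr
          have e5 : ((M - m₀ : ℕ) : ℝ) ≤ M := by exact_mod_cast Nat.sub_le _ _
          have e6 : ∑ m ∈ Finset.Ico m₀ M, (1 : ℝ) / m ≤ 1 + l := by linarith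
          have e7 : ((M - m₀ : ℕ) : ℝ) * a ≤ a * M := by rw [mul_comm]; gcongr
          gcongr

theorem log_ceil_div_le
    (hε : 0 < ε) (hε1 : ε < 1 / 2) (hν : 0 ≤ ν) (hν1 : ν ≤ 1) (hL1 : 1.38 ≤ L)
    (hW : W = 4096 * L * (ν + ε) / ε ^ 2) :
    1 ≤ W ∧ (⌈W⌉₊ : ℝ) ≤ 2 * W ∧ Real.log (⌈W⌉₊ / L) ≤ 16 * Real.log (1 / ε) := by
  have hl2 : Real.log 2 ≤ Real.log (1 / ε) := Real.log_le_log (by norm_num) (by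
    rw [le_div_iff₀ hε]; linarith)
  have hln := Real.log_two_gt_d9
  set M := ⌈W⌉₊
  have hεW : 2 ≤ (ν + ε) / ε ^ 2 := by
    rw [le_div_iff₀ (by positivity)]; nlinarith
  have hWL : W = 4096 * L * ((ν + ε) / ε ^ 2) := by rw [hW]; ring
  have hW1 : 1 ≤ W := by rw [hWL]; nlinarith
  have hM1 : W ≤ M := Nat.le_ceil _
  have hM2 : (M : ℝ) ≤ 2 * W := by
    have := Nat.ceil_lt_add_one (show 0 ≤ W by linarith)
    linarith
  refine ⟨hW1, hM2, ?_⟩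
  have h1 : M / L ≤ 2 ^ 14 * (1 / ε) ^ 2 := by
    rw [div_le_iff₀ (by linarith)]
    have h2 : (ν + ε) / ε ^ 2 ≤ 2 * (1 / ε) ^ 2 := by
      rw [div_pow, one_pow, mul_one_div]
      gcongr
      linarith
    have h3 : 2 * W ≤ 2 * (4096 * L * (2 * (1 / ε) ^ 2)) := by rw [hWL]; gcongr
    linarith
  have hM0 : (0 : ℝ) < M := by linarith
  refine (Real.log_le_log (by positivity) h1).trans ?_
  rw [Real.log_mul (by positivity) (by positivity), Real.log_pow, Real.log_pow]
  push_cast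
  linarith

/-- The constant part of the radius, of order ν + ε, times W is of order L(ν + ε)²/ε²; this is the
source of ν²/ε² + 1. The part in β² has coefficient 12 · 332 ≤ 4000 and gives the harmonic sum. -/
theorem sum_request_le {p : ℕ → ℝ} {B : ℝ}
    (hd : vcDim F = d) (hd1 : 1 ≤ d) (hg : ∀ k, 0 < growth F k) (hδ : 0 < δ) (hδ1 : δ < 1 / 2)
    (hε : 0 < ε) (hε1 : ε < 1 / 2) (hν : 0 ≤ ν) (hν1 : ν ≤ 1) (hL1 : 1.38 ≤ L)
    (hW : W = 4096 * L * (ν + ε) / ε ^ 2)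
    (hL : L = d * Real.log (1 / ε) + Real.log (1 / δ))
    (hp1 : ∀ m, p m ≤ 1) (hB : 0 ≤ B)
    (hp : ∀ m, 1 ≤ m → p m ≤ 80 * B * (10 * ν + 2 * ε + 12 * dhmBeta F δ m ^ 2)) :
    ∑ m ∈ Finset.range ⌈W⌉₊, p m ≤
      2 * L + 31974400 * (B * ((ν ^ 2 / ε ^ 2 + 1) * (L * Real.log (1 / ε)))) := by
  obtain ⟨hW1, hM2, hML⟩ := log_ceil_div_le hε hε1 hν hν1 hL1 hW
  have hln := Real.log_two_gt_d9
  have hl2 : Real.log 2 ≤ Real.log (1 / ε) := Real.log_le_log (by norm_num) (by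
    rw [le_div_iff₀ hε]; linarith)
  set l := Real.log (1 / ε)
  set M := ⌈W⌉₊
  set V := ν ^ 2 / ε ^ 2 + 1 with hV
  have hV1 : 1 ≤ V := by
    have : 0 ≤ ν ^ 2 / ε ^ 2 := by positivity
    linarith
  have hVLl : L * l ≤ V * (L * l) := le_mul_of_one_le_left (by nlinarith) hV1
  have hLl : L ≤ 2 * (L * l) := by nlinarith
  have h1 := sum_le_of_le_one_div (p := p) (B := 80 * B) (a := 10 * ν + 2 * ε) (L := L)
    (l := 16 * l) (M := M) hp1 (by positivity) (by positivity) (by linarith)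
    (fun m hm hmM => by
      have hmW : (m : ℝ) ≤ W := (Nat.lt_ceil.1 hmM).le
      have hb := dhmBeta_sq_le_of_le hd hd1 (hg _) hm hδ hδ1 hε hε1 hν hν1 hL
        (by linarith) hW hmW
      refine (hp m hm).trans ?_
      have hm0 : (0 : ℝ) ≤ 1 / m := by positivity
      have : 0 ≤ L * (1 / m) := mul_nonneg (by linarith) hm0
      gcongr 80 * B * ?_
      linarith)
    (by linarith) hML
  have h2 : (10 * ν + 2 * ε) * M ≤ 163840 * (V * L) := by
    have e1 : (10 * ν + 2 * ε) * M ≤ (10 * (ν + ε)) * (2 * W) := by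
      gcongr
      linarith
    have e2 : (10 * (ν + ε)) * (2 * W) = 81920 * L * ((ν + ε) ^ 2 / ε ^ 2) := by
      rw [hW]; ring
    have e3 : (ν + ε) ^ 2 / ε ^ 2 ≤ 2 * V := by
      rw [hV, div_le_iff₀ (by positivity)]
      have : 2 * (ν ^ 2 / ε ^ 2 + 1) * ε ^ 2 = 2 * (ν ^ 2 + ε ^ 2) := by field_simp
      rw [this]
      nlinarith [sq_nonneg (ν - ε)]
    have e4 : 81920 * L * ((ν + ε) ^ 2 / ε ^ 2) ≤ 81920 * L * (2 * V) := by gcongr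
    linarith
  have h3 : V * L ≤ V * (2 * (L * l)) := by gcongr
  have h4 : L * (1 + 16 * l) ≤ 18 * (V * (L * l)) := by linarith
  have h5 : (10 * ν + 2 * ε) * M + 4000 * L * (1 + 16 * l) ≤ 399680 * (V * (L * l)) := by
    linarith
  have h6 : 80 * B * ((10 * ν + 2 * ε) * M + 4000 * L * (1 + 16 * l)) ≤
      80 * B * (399680 * (V * (L * l))) := by gcongr
  have h7 : 80 * B * (399680 * (V * (L * l))) = 31974400 * (B * (V * (L * l))) := by ring
  linarith

end Numeric

/-! ### Assembly: the label budget and the final error. -/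

section

variable [MeasurableSpace X] {F : Set (X → Bool)} {P : Measure (X × Bool)} {f : X → Bool}

theorem IsInfimal.nonempty (hf : IsInfimal F P f) : F.Nonempty := by
  rw [nonempty_iff_ne_empty]
  rintro rfl
  have : er P f + 1 ≤ er P f := hf.isGLB_er.2 (by simp)
  linarith

theorem er_eq_of_subsingleton (hF : F.Subsingleton) (hf : IsInfimal F P f) {h : X → Bool}
    (hh : h ∈ F) : er P h = er P f := by
  refine IsGLB.unique ?_ hf.isGLB_er
  rw [hF.eq_singleton_of_mem hh, image_singleton]
  exact isGLB_singleton

variable [IsProbabilityMeasure P]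
  {learn : List (X × Bool) → List (X × Bool) → Option (X → Bool)} {δ ε : ℝ} {d n : ℕ}

/-- The slack 2ε makes the radius strictly larger than ν + ε, as the range of the maximal
compression bound demands. -/
theorem exists_request_region (hT : TraceMeasurable F P) (hF : ∀ h ∈ F, Measurable h)
    (hf : IsInfimal F P f) (hε : 0 < ε) (m : ℕ) :
    ∃ D : Set (X × Bool), MeasurableSet D ∧
      (1 ≤ m → P.real D ≤ 80 * ((maxCompressionBound F P f (er P f + ε) : ℝ) + 1) *
        (10 * er P f + 2 * ε + 12 * dhmBeta F δ m ^ 2)) ∧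
      ∀ h ∈ F, (m = 0 ∨ P.real {z | h z.1 ≠ f z.1} ≤
        10 * er P f + 2 * ε + 12 * dhmBeta F δ m ^ 2) → ∀ z, h z.1 ≠ f z.1 → z ∈ D := by
  -- At m = 0 the value of β is 0 by the convention on division, so the radius carries no
  -- information and the whole space is taken.
  rcases Nat.eq_zero_or_pos m with h0 | h0
  · exact ⟨univ, MeasurableSet.univ, fun h => by omega, fun _ _ _ _ _ => mem_univ _⟩
  · have hν0 : 0 ≤ er P f := measureReal_nonneg
    have hr : er P f + ε < 10 * er P f + 2 * ε + 12 * dhmBeta F δ m ^ 2 := by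
      linarith [sq_nonneg (dhmBeta F δ m)]
    obtain ⟨D, h1, h2, h3⟩ := exists_disagreement_set_le hT hF hf.measurable
      (by linarith : 0 < er P f + ε) hr
    exact ⟨D, h1, fun _ => h2, fun h hh hm => h3 h hh (hm.resolve_left (by omega))⟩

theorem Favourable.er_le_add {ω : ℕ → X × Bool} {m : ℕ} {s : State X} {h : X → Bool}
    (hG : Favourable F P f δ ω) (hF : ∀ h ∈ F, Measurable h) (hl : IsLearner F learn)
    (hs : Faithful f ω m s) (hm : 1 ≤ m) (hh : learn s.inferred s.queried = some h)
    (hε : 0 < ε) (hb : dhmBeta F δ m ^ 2 * (er P f + ε) ≤ ε ^ 2 / 12) (hε1 : ε < 1 / 2) :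
    er P h ≤ er P f + ε := by
  have hν0 : 0 ≤ er P f := measureReal_nonneg
  have hb1 : dhmBeta F δ m < 1 := by
    have : dhmBeta F δ m ^ 2 * ε ≤ ε / 12 * ε := by
      linarith [mul_nonneg (sq_nonneg (dhmBeta F δ m)) hν0]
    have := le_of_mul_le_mul_right this hε
    nlinarith
  linarith [hG.er_le hF hl hs hm hb1 hh, excess_le hε hν0 hb]

set_option maxHeartbeats 400000 in
-- Failure needs an unfavourable outcome (probability at most δ/2) or n visits of the stream to the
-- fixed request regions in its first ⌈W⌉ examples (at most δ/4). Neither event depends on the cap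
-- u, so all caps are handled at once.
theorem prob_not_er_le (hT : TraceMeasurable F P) (hF : ∀ h ∈ F, Measurable h)
    (hf : IsInfimal F P f) (hl : IsLearner F learn) (hε : ε ∈ Ioo (0 : ℝ) (1 / 2))
    (hδ : δ ∈ Ioo (0 : ℝ) (1 / 2)) (hd : vcDim F = d) (hd1 : 1 ≤ d)
    (hn : 10 ^ 8 * ((maxCompressionBound F P f (er P f + ε) : ℝ) + 1) *
      (er P f ^ 2 / ε ^ 2 + 1) * (d * Real.log (1 / ε) + Real.log (1 / δ)) *
        Real.log (1 / ε) ≤ n) :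
    Measure.infinitePi (fun _ : ℕ => P)
      {ω | ¬ ∀ u ≥ 2 ^ n, ∃ h, dhmOutput F learn δ n u ω = some h ∧
        er P h ≤ er P f + ε} ≤ ENNReal.ofReal δ := by
  classical
  obtain ⟨hε, hε1⟩ := hε
  obtain ⟨hδ, hδ1⟩ := hδ
  have hX : Nonempty X := (nonempty_of_isProbabilityMeasure P).map Prod.fst
  have hg : ∀ k, 0 < growth F k := growth_pos hf.nonempty
  have hln := Real.log_two_gt_d9
  have hln' := Real.log_two_lt_d9
  set ν := er P f with hν
  have hν0 : 0 ≤ ν := measureReal_nonneg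
  have hν1 : ν ≤ 1 := measureReal_le_one
  set l := Real.log (1 / ε) with hld
  set q := Real.log (1 / δ) with hqd
  have hl2 : Real.log 2 ≤ l := Real.log_le_log (by norm_num) (by
    rw [le_div_iff₀ hε]; linarith)
  have hq2 : Real.log 2 ≤ q := Real.log_le_log (by norm_num) (by
    rw [le_div_iff₀ hδ]; linarith)
  have hdR : (1 : ℝ) ≤ d := by exact_mod_cast hd1
  set L := d * l + q with hL
  have hlL : l + q ≤ L := by
    have : l ≤ d * l := le_mul_of_one_le_left (by linarith) hdR
    linarith
  have hL1 : 1.38 ≤ L := by linarith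
  set W := 4096 * L * (ν + ε) / ε ^ 2 with hW
  set B := (maxCompressionBound F P f (ν + ε) : ℝ) + 1 with hB
  have hB1 : 1 ≤ B := by rw [hB]; linarith [(maxCompressionBound F P f (ν + ε)).cast_nonneg (α := ℝ)]
  set V := ν ^ 2 / ε ^ 2 + 1 with hV
  have hV1 : 1 ≤ V := by
    have : 0 ≤ ν ^ 2 / ε ^ 2 := by positivity
    linarith
  set M := ⌈W⌉₊ with hM
  obtain ⟨hW1, -, hML⟩ := log_ceil_div_le hε hε1 hν0 hν1 hL1 hW
  have hM1 : W ≤ M := Nat.le_ceil _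
  set Q := B * V * L * l with hQ
  have hLl : L ≤ 2 * (L * l) := by nlinarith
  have hVLl : L * l ≤ V * (L * l) := le_mul_of_one_le_left (by nlinarith) hV1
  have hLlQ : V * (L * l) ≤ Q := by
    have : V * (L * l) ≤ B * (V * (L * l)) := le_mul_of_one_le_left (by nlinarith) hB1
    rw [hQ]; linarith
  have hnQ : 10 ^ 8 * Q ≤ n := by rw [hQ]; linarith
  choose D hDm hDP hDF using
    fun m => exists_request_region hT hF hf (δ := δ) hε m
  have hgm : ∀ m, Measurable fun z => decide (z ∈ D m) := fun m =>
    measurable_to_bool (by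
      have : (fun z => decide (z ∈ D m)) ⁻¹' {true} = D m := by ext; simp
      rw [this]
      exact hDm m)
  have hsum : ∑ m ∈ Finset.range M, P.real {z | decide (z ∈ D m) = true} ≤ 3.3 * 10 ^ 7 * Q := by
    have h := sum_request_le (p := fun m => P.real {z | decide (z ∈ D m) = true}) (B := B)
      hd hd1 hg hδ hδ1 hε hε1 hν0 hν1 hL1 hW hL (fun m => measureReal_le_one) (by linarith)
      (fun m hm => by
        have he : {z | decide (z ∈ D m) = true} = D m := by ext; simp
        rw [he]
        exact hDP m hm)
    have e : B * (V * (L * l)) = Q := by rw [hQ]; ring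
    rw [e] at h
    linarith
  have hcount := chernoff_count P (g := fun m z => decide (z ∈ D m)) hgm M n
  -- The mean number of visits is at most 3.3 · 10⁷ Q and e - 1 < 2, so the exponent is at most -3.4
  -- · 10⁷ Q, far below log(δ/4).
  have hexp : Real.exp (-(n : ℝ) + (Real.exp 1 - 1) *
      ∑ m ∈ Finset.range M, P.real {z | decide (z ∈ D m) = true}) ≤ δ / 4 := by
    have h1 := Real.exp_one_lt_d9
    have h2 := Real.exp_one_gt_d9
    have h3 : (Real.exp 1 - 1) * ∑ m ∈ Finset.range M, P.real {z | decide (z ∈ D m) = true} ≤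
        2 * (3.3 * 10 ^ 7 * Q) := by
      gcongr
      linarith
    have h4 : -Real.log (4 / δ) = Real.log (δ / 4) := by
      rw [← Real.log_inv, inv_div]
    have h5 : Real.log (4 / δ) = 2 * Real.log 2 + q := by
      rw [hqd, show (4 : ℝ) / δ = 2 ^ 2 * (1 / δ) by ring, Real.log_mul (by norm_num)
        (by positivity), Real.log_pow]
      norm_num
    rw [← Real.exp_log (show 0 < δ / 4 by positivity), ← h4]
    refine Real.exp_le_exp.2 ?_
    linarith
  have hMn : (M : ℝ) ≤ 2 ^ n := by
    have hM0 : (0 : ℝ) < M := by linarith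
    have e1 : Real.log M = Real.log (M / L) + Real.log L := by
      rw [← Real.log_mul (by positivity) (by linarith)]
      congr 1
      field_simp
    have e2 := Real.log_le_sub_one_of_pos (show 0 < L by linarith)
    have e3 : l ≤ L * l := le_mul_of_one_le_left (by linarith) (by linarith)
    have e4 : Real.log M ≤ Real.log (2 ^ n) := by
      rw [Real.log_pow]
      have hQ0 : 0 ≤ Q := by linarith
      have e5 : 10 ^ 8 * Q * Real.log 2 ≤ n * Real.log 2 := by gcongr
      have e6 : 10 ^ 8 * Q * (1 / 2) ≤ 10 ^ 8 * Q * Real.log 2 := by gcongr; linarith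
      linarith
    exact (Real.log_le_log_iff hM0 (by positivity)).1 e4
  have hMn' : M ≤ 2 ^ n := by exact_mod_cast hMn
  have hsub : {ω | ¬ ∀ u ≥ 2 ^ n, ∃ h, dhmOutput F learn δ n u ω = some h ∧ er P h ≤ ν + ε} ⊆
      {ω | ¬ Favourable F P f δ ω} ∪
        {ω | (n : ℝ) ≤ ∑ m ∈ Finset.range M, ((decide (ω m ∈ D m)).toNat : ℝ)} := by
    intro ω hω
    by_contra hcon
    rw [mem_union, not_or] at hcon
    obtain ⟨h1, h2⟩ := hcon
    have hfav : Favourable F P f δ ω := not_not.1 h1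
    have hlt : ∑ m ∈ Finset.range M, ((decide (ω m ∈ D m)).toNat : ℝ) < n := not_le.1 h2
    refine hω fun u hu => ?_
    obtain ⟨m, -, hs, hproc, hq⟩ := hfav.exists_faithful hF hf hl (η := 2 * ε) (by positivity)
      (D := fun m z => decide (z ∈ D m))
      (fun m h hh hP z hz => decide_eq_true (hDF m h hh hP z hz)) n u
    -- If fewer than M examples were processed, either the budget ran out, which would need n
    -- visits, or the run reached the cap u ≥ 2^n ≥ M.
    have hMm : M ≤ m := by
      by_contra hlt'
      push Not at hlt'
      by_cases hqn : (dhmState F learn δ n ω u).queried.length = n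
      · rw [hqn] at hq
        have h3 : ∑ i ∈ Finset.range m, (decide (ω i ∈ D i)).toNat ≤
            ∑ i ∈ Finset.range M, (decide (ω i ∈ D i)).toNat :=
          Finset.sum_le_sum_of_subset fun i hi => by
            simp only [Finset.mem_range] at hi ⊢
            omega
        have h4 : (n : ℝ) ≤ ∑ i ∈ Finset.range M, ((decide (ω i ∈ D i)).toNat : ℝ) := by
          exact_mod_cast hq.trans h3
        linarith
      · have := hproc hqn
        omega
    obtain ⟨-, h, -, hout⟩ := hl.requests_le_and_output hf.nonempty δ n ω u
    refine ⟨h, hout, ?_⟩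
    have hWm : W ≤ m := hM1.trans (by exact_mod_cast hMm)
    have hm1 : 1 ≤ m := by exact_mod_cast hW1.trans hWm
    exact hfav.er_le_add hF hl hs hm1 hout hε (dhmBeta_sq_le_of_ge hd hd1 (hg _) hm1 hδ hδ1 hε
      hε1 hν0 hν1 hL (by linarith) hW hWm) hε1
  refine (measure_mono hsub).trans ((measure_union_le _ _).trans ?_)
  refine (add_le_add (prob_not_favourable_le hT hF hf hg hδ hδ1)
    (hcount.trans (ENNReal.ofReal_le_ofReal hexp))).trans ?_
  rw [← ENNReal.ofReal_add (by positivity) (by positivity)]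
  exact ENNReal.ofReal_le_ofReal (by linarith)

end

end ActiveLearning
end

open ActiveLearning
theorem mainTheorem10 :
    ∃ c : ℝ, 0 < c ∧
      ∀ (X : Type*) [MeasurableSpace X] (P : Measure (X × Bool)) [IsProbabilityMeasure P]
        (F : Set (X → Bool)) (_ : ∀ h ∈ F, Measurable h) (_ : TraceMeasurable F P)
        (f : X → Bool) (_ : IsInfimal F P f)
        (learn : List (X × Bool) → List (X × Bool) → Option (X → Bool)) (_ : IsLearner F learn)
        (ε δ : ℝ) (_ : ε ∈ Ioo (0 : ℝ) (1 / 2)) (_ : δ ∈ Ioo (0 : ℝ) (1 / 2)) (n : ℕ),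
        (∀ (ω : ℕ → X × Bool) (u : ℕ),
          dhmRequests F learn δ n u ω ≤ n ∧ ∃ h ∈ F, dhmOutput F learn δ n u ω = some h) ∧
        ∀ d : ℕ, vcDim F = d →
          c * ((maxCompressionBound F P f (er P f + ε) : ℝ) + 1) *
              (er P f ^ 2 / ε ^ 2 + 1) *
              (d * Real.log (1 / ε) + Real.log (1 / δ)) * Real.log (1 / ε) ≤ n →
          Measure.infinitePi (fun _ : ℕ => P)
            {ω | ¬ ∀ u ≥ 2 ^ n, ∃ h, dhmOutput F learn δ n u ω = some h ∧
              er P h ≤ er P f + ε} ≤ ENNReal.ofReal δ := by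
  refine ⟨10 ^ 8, by norm_num, ?_⟩
  intro X _ P _ F hF hT f hf learn hl ε δ hε hδ n
  refine ⟨fun ω u => hl.requests_le_and_output hf.nonempty δ n ω u, fun d hd hn => ?_⟩
  -- The growth estimates divide by d. For d = 0 the class is a single hypothesis, whose error is
  -- that of f*.
  rcases Nat.eq_zero_or_pos d with h0 | hd1
  · have hsub := subsingleton_of_vcDim_eq_zero (by simpa [h0] using hd)
    have hempty : {ω | ¬ ∀ u ≥ 2 ^ n, ∃ h, dhmOutput F learn δ n u ω = some h ∧
        er P h ≤ er P f + ε} = ∅ := by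
      refine eq_empty_of_forall_notMem fun ω hω => hω fun u _ => ?_
      obtain ⟨-, h, hh, hout⟩ := hl.requests_le_and_output hf.nonempty δ n ω u
      exact ⟨h, hout, by rw [er_eq_of_subsingleton hsub hf hh]; linarith [hε.1]⟩
    rw [hempty, measure_empty]
    exact zero_le
  · exact prob_not_er_le hT hF hf hl hε hδ hd hd1 hn
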